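/- Let $\overline M$ be a smooth Riemannian seven-manifold with a $G_2$-structure, given by a three-form $\varphi$ that near each point can be written $\varphi=\sum_{i\in\mathbb Z_7}e_i\wedge e_{i+1}\wedge e_{i+3}$ in a smooth local orthonormal frame $e_0,\dots,e_6$ (a Cayley frame). Let $P$ be the cross product, $\langle P(x,y),z\rangle=\varphi(x,y,z)$, let $\ast\varphi=-\sum_{i\in\mathbb Z_7}e_{i+2}\wedge e_{i+4}\wedge e_{i+5}\wedge e_{i+6}$ in Cayley frames, let $\overline\nabla$ be the Levi-Civita connection, and put $\overline r(\varphi)(x,y)=\tfrac14\langle\overline\nabla_x\varphi,\,y\lrcorner\ast\varphi\rangle$. The structure is of type $\mathcal X_1$ if $\overline r(\varphi)$ is a constant multiple of the metric, and of type $\mathcal P$ if $\overline r(\varphi)=0$. Let $M$ be a non-empty hypersurface of $\overline M$ with inclusion $\iota$ and unit normal vector field $n$, second fundamental form $B(x,y)=\langle II(x,y),n\rangle$ ($II$ the shape tensor), mean curvature vector $H=\tfrac16\operatorname{tr}II$ and $h=\langle H,n\rangle$. Then $M$ is minimal if $H=0$, totally umbilic if $II=\langle\cdot,\cdot\rangle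 H$, and totally geodesic if $II=0$. For a constant $\theta$, $M$ carries the $SU(3)$-structure consisting of the induced metric, $Ix=P(n,x)$, and the complex volume form $\psi_++i\psi_-$ with $\psi_+=\cos\theta\,\iota^*\varphi-\sin\theta\,\iota^*(n\lrcorner\ast\varphi)$ and $\psi_-=\sin\theta\,\iota^*\varphi+\cos\theta\,\iota^*(n\lrcorner\ast\varphi)$. Put $\omega(x,y)=\langle x,Iy\rangle$ and $(IB)(x,y)=B(Ix,Iy)$. Let $\nabla$ be the Levi-Civita connection of $M$. The intrinsic torsion of the $SU(3)$-structure is the tensor $T\in T^*M\otimes\mathfrak{su}(3)^\perp$, $\mathfrak{su}(3)^\perp\subset\mathfrak{so}(6)$, for which $\nabla+T$ preserves $\omega,\psi_+,\psi_-$. Write $T=\eta+\xi$ according to $\mathfrak{su}(3)^\perp=\mathbb R I\oplus\mathfrak u(3)^\perp$; the part $\xi$ is identified with $\nabla\omega=-\xi\omega$. Let $\mathcal W_1,\mathcal W_2,\mathcal W_3,\mathcal W_4$ be the Gray–Hervella modules of $T^*M\otimes\mathfrak u(3)^\perp\subset T^*M\otimes\Lambda^2T^*M$, and for $i=1,2$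 let $\mathcal W_i^{+}$ (resp. $\mathcal W_i^{-}$) be the set of those $a\in\mathcal W_i$ for which $r(a)(x,y)=\tfrac12\langle x\lrcorner a,\,y\lrcorner\psi_+\rangle$ is symmetric (resp. skew-symmetric). For a sum $\mathcal W$ of some of the modules $\mathcal W_1^\pm,\mathcal W_2^\pm,\mathcal W_3$, "$M$ is of type $\mathcal W$" means that $\eta=0$ and $\nabla\omega\in\mathcal W$ at every point. **Theorem.** Suppose that $\overline M$ is of type $\mathcal X_1$ with $d\varphi=k\ast\varphi$, $k\in\mathbb R$ constant, and that $\theta=0$ (resp. $\theta=\pi/2$). Then $M$ is of type $\mathcal W_1^{+(-)}+\mathcal W_1^{-(+)}+\mathcal W_2^{+(-)}+\mathcal W_3$, where the signs in parentheses are for $\theta=\pi/2$. Moreover $M$ is of type 1. $\mathcal W_1^{+(-)}+\mathcal W_1^{-(+)}+\mathcal W_2^{+(-)}$ iff $IB=B$; 2. $\mathcal W_1^{+(-)}+\mathcal W_1^{-(+)}+\mathcal W_3$ iff $B+IB=2h\langle\cdot,\cdot\rangle$; 3. $\mathcal W_1^{+(-)}+\mathcal W_2^{+(-)}+\mathcal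 W_3$ iff $\overline M$ is of type $\mathcal P$; 4. $\mathcal W_1^{-(+)}+\mathcal W_2^{+(-)}+\mathcal W_3$ iff $M$ is minimal; 5. $\mathcal W_1^{+(-)}+\mathcal W_1^{-(+)}$ iff $M$ is totally umbilic; 6. $\mathcal W_1^{+(-)}+\mathcal W_2^{+(-)}$ iff $IB=B$ and $\overline M$ is of type $\mathcal P$; 7. $\mathcal W_1^{-(+)}+\mathcal W_2^{+(-)}$ iff $IB=B$ and $M$ is minimal; 8. $\mathcal W_1^{+(-)}+\mathcal W_3$ iff $B+IB=2h\langle\cdot,\cdot\rangle$ and $\overline M$ is of type $\mathcal P$; 9. $\mathcal W_1^{-(+)}+\mathcal W_3$ iff $IB=-B$; 10. $\mathcal W_2^{+(-)}+\mathcal W_3$ iff $M$ is minimal and $\overline M$ is of type $\mathcal P$; 11. $\mathcal W_3$ iff $IB=-B$ and $\overline M$ is of type $\mathcal P$; 12. $\mathcal W_2^{+(-)}$ iff $IB=B$, $M$ is minimal and $\overline M$ is of type $\mathcal P$; 13. $\mathcal W_1^{-(+)}$ iff $M$ is totally geodesic; 14. $\mathcal W_1^{+(-)}$ iff $M$ is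 totally umbilic and $\overline M$ is of type $\mathcal P$; 15. $\{0\}$ iff $M$ is totally geodesic and $\overline M$ is of type $\mathcal P$. -/

import Mathlib

open scoped Manifold ContDiff BigOperators

noncomputable section

/-! ## Linear algebra of tensors on a Euclidean vector space

Tensors on a real vector space `V` are plain real valued functions of vectors; the metric is a
function `g : V → V → ℝ`.  A `p`-form is a function of a tuple `Fin p → V`. -/

section LinearAlgebra

variable {V : Type*} [AddCommGroup V] [Module ℝ V]

/-- The metric dual of a one-form `ℓ`: the vector `v` with `g v w = ℓ w` for all `w`. -/
def sharp (g : V → V → ℝ) (ℓ : V → ℝ) : V :=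
  Classical.epsilon fun v => ∀ w, g v w = ℓ w

/-- The tuple `e` is orthonormal with respect to `g`. -/
def IsOrthonormalTuple (g : V → V → ℝ) {m : ℕ} (e : Fin m → V) : Prop :=
  ∀ i j, g (e i) (e j) = if i = j then 1 else 0

/-- A choice of an orthonormal tuple of `m` vectors (used with `m` the dimension of `V`, so that it
is an orthonormal basis; nothing below depends on which one is chosen). -/
def orthoBasis (m : ℕ) (g : V → V → ℝ) : Fin m → V :=
  Classical.epsilon fun e => IsOrthonormalTuple g e

/-- The scalar product of `p`-forms on an `m`-dimensional space,
`⟨a, b⟩ = (1 / p!) ∑ a(e_{i₁}, …, e_{iₚ}) b(e_{i₁}, …, e_{iₚ})`. -/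
def formInner (m : ℕ) (g : V → V → ℝ) {p : ℕ} (a b : (Fin p → V) → ℝ) : ℝ :=
  (1 / (p.factorial : ℝ)) * ∑ i : Fin p → Fin m,
    a (fun s => orthoBasis m g (i s)) * b (fun s => orthoBasis m g (i s))

/-- Interior product `x ⌟ a`. -/
def interiorProd {p : ℕ} (x : V) (a : (Fin (p + 1) → V) → ℝ) : (Fin p → V) → ℝ :=
  fun v => a (Matrix.vecCons x v)

/-- The action of an endomorphism on `p`-forms,
`(A · α)(v₁, …, vₚ) = - ∑ α(v₁, …, A vᵢ, …, vₚ)`. -/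
def endAct {p : ℕ} (A : V → V) (α : (Fin p → V) → ℝ) (v : Fin p → V) : ℝ :=
  - ∑ i, α (Function.update v i (A (v i)))

/-! ### `G₂`-structures on a vector space -/

/-- The two-fold vector cross product: `⟨P(x, y), z⟩ = φ(x, y, z)`. -/
def crossProd (g : V → V → ℝ) (φ : (Fin 3 → V) → ℝ) (x y : V) : V :=
  sharp g fun z => φ ![x, y, z]

/-- The four-form `∗φ`, as the cyclic sum over `y, z, u` of
`-(1/3) ⟨P(x, y), P(z, u)⟩`; in a Cayley basis it is
`- ∑ i, e_{i+2} ∧ e_{i+4} ∧ e_{i+5} ∧ e_{i+6}`. -/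
def starPhi (g : V → V → ℝ) (φ : (Fin 3 → V) → ℝ) (v : Fin 4 → V) : ℝ :=
  -(1 / 3) * (g (crossProd g φ (v 0) (v 1)) (crossProd g φ (v 2) (v 3))
    + g (crossProd g φ (v 0) (v 2)) (crossProd g φ (v 3) (v 1))
    + g (crossProd g φ (v 0) (v 3)) (crossProd g φ (v 1) (v 2)))

/-- A Cayley basis: an orthonormal basis with `φ = ∑ i ∈ ℤ/7, e_i ∧ e_{i+1} ∧ e_{i+3}`
(a wedge product of one-forms is a determinant). -/
def IsCayleyBasis (g : V → V → ℝ) (φ : (Fin 3 → V) → ℝ) (e : Fin 7 → V) : Prop :=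
  IsOrthonormalTuple g e ∧
    ∀ v, φ v = ∑ i : Fin 7,
      Matrix.det (Matrix.of fun a b : Fin 3 => g (e ((![i, i + 1, i + 3] : Fin 3 → Fin 7) a)) (v b))

/-- `r̄(α)(x, y) = (1/4) ⟨x ⌟ α, y ⌟ ∗φ⟩` for `α ∈ T* ⊗ Λ³T*`, `dim V = 7`. -/
def rBar (g : V → V → ℝ) (φ : (Fin 3 → V) → ℝ) (α : V → (Fin 3 → V) → ℝ) (x y : V) : ℝ :=
  (1 / 4) * formInner 7 g (α x) (interiorProd y (starPhi g φ))

/-! ### `SU(3)`-structures on a six-dimensional vector space -/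

/-- The Kähler form `ω(x, y) = ⟨x, I y⟩`. -/
def kahler (g : V → V → ℝ) (I : V → V) (v : Fin 2 → V) : ℝ := g (v 0) (I (v 1))

/-- The Lie algebra `su(3)`: skew endomorphisms annihilating `ω`, `ψ₊` and `ψ₋`. -/
def IsInSu3 (g : V → V → ℝ) (I : V → V) (ψp ψm : (Fin 3 → V) → ℝ) (A : V →ₗ[ℝ] V) : Prop :=
  (∀ x y, g (A x) y = - g x (A y)) ∧ (∀ v, endAct A (kahler g I) v = 0) ∧
    (∀ v, endAct A ψp v = 0) ∧ (∀ v, endAct A ψm v = 0)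

/-- `r(a)(x, y) = (1/2) ⟨x ⌟ a, y ⌟ ψ₊⟩` for `a ∈ T* ⊗ Λ²T*`, `dim V = 6`. -/
def rSix (g : V → V → ℝ) (ψp : (Fin 3 → V) → ℝ) (a : V →ₗ[ℝ] V →ₗ[ℝ] V →ₗ[ℝ] ℝ) (x y : V) : ℝ :=
  (1 / 2) * formInner 6 g (fun v : Fin 2 → V => a x (v 0) (v 1)) (interiorProd y ψp)

/-- The space `W = T* ⊗ u(3)^⊥ = W₁ + W₂ + W₃ + W₄` of Gray and Hervella:
`a(x, y, z) = - a(x, z, y) = - a(x, I y, I z)`. -/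
def spaceW (I : V → V) : Submodule ℝ (V →ₗ[ℝ] V →ₗ[ℝ] V →ₗ[ℝ] ℝ) where
  carrier := {a | (∀ x y z, a x y z = - a x z y) ∧ ∀ x y z, a x y z = - a x (I y) (I z)}
  zero_mem' := by simp
  add_mem' := by
    rintro a b ⟨ha, ha'⟩ ⟨hb, hb'⟩
    refine ⟨fun x y z => ?_, fun x y z => ?_⟩
    · simp only [LinearMap.add_apply]; rw [ha x y z, hb x y z]; ring
    · simp only [LinearMap.add_apply]; rw [ha' x y z, hb' x y z]; ring
  smul_mem' := by
    rintro c a ⟨ha, ha'⟩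
    refine ⟨fun x y z => ?_, fun x y z => ?_⟩
    · simp only [LinearMap.smul_apply, smul_eq_mul]; rw [ha x y z]; ring
    · simp only [LinearMap.smul_apply, smul_eq_mul]; rw [ha' x y z]; ring

/-- The Gray–Hervella module `W₁`: the `a ∈ W` with `a(x, x, z) = 0`. -/
def spaceW1 (I : V → V) : Submodule ℝ (V →ₗ[ℝ] V →ₗ[ℝ] V →ₗ[ℝ] ℝ) :=
  spaceW I ⊓
  { carrier := {a | ∀ x z, a x x z = 0}
    zero_mem' := by simp
    add_mem' := by
      intro a b ha hb x z
      simp only [LinearMap.add_apply]; rw [ha x z, hb x z]; ring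
    smul_mem' := by
      intro c a ha x z
      simp only [LinearMap.smul_apply, smul_eq_mul]; rw [ha x z]; ring }

/-- The Gray–Hervella module `W₂`: the `a ∈ W` whose cyclic sum vanishes. -/
def spaceW2 (I : V → V) : Submodule ℝ (V →ₗ[ℝ] V →ₗ[ℝ] V →ₗ[ℝ] ℝ) :=
  spaceW I ⊓
  { carrier := {a | ∀ x y z, a x y z + a y z x + a z x y = 0}
    zero_mem' := by simp
    add_mem' := by
      intro a b ha hb x y z
      have h1 := ha x y z
      have h2 := hb x y z
      simp only [LinearMap.add_apply]; linarith
    smul_mem' := by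
      intro c a ha x y z
      have h1 := ha x y z
      simp only [LinearMap.smul_apply, smul_eq_mul]
      rw [← mul_add, ← mul_add, h1, mul_zero] }

/-- The Gray–Hervella module `W₃`: the `a ∈ W` with `a(x, y, z) = a(I x, I y, z)` and
`∑ i, a(e_i, e_i, z) = 0`. -/
def spaceW3 (g : V → V → ℝ) (I : V → V) : Submodule ℝ (V →ₗ[ℝ] V →ₗ[ℝ] V →ₗ[ℝ] ℝ) :=
  spaceW I ⊓
  { carrier := {a | (∀ x y z, a x y z = a (I x) (I y) z) ∧
      ∀ z, ∑ i, a (orthoBasis 6 g i) (orthoBasis 6 g i) z = 0}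
    zero_mem' := by simp
    add_mem' := by
      rintro a b ⟨ha, ha'⟩ ⟨hb, hb'⟩
      refine ⟨fun x y z => ?_, fun z => ?_⟩
      · simp only [LinearMap.add_apply]; rw [ha x y z, hb x y z]
      · simp only [LinearMap.add_apply, Finset.sum_add_distrib]; rw [ha' z, hb' z, add_zero]
    smul_mem' := by
      rintro c a ⟨ha, ha'⟩
      refine ⟨fun x y z => ?_, fun z => ?_⟩
      · simp only [LinearMap.smul_apply, smul_eq_mul]; rw [ha x y z]
      · simp only [LinearMap.smul_apply, smul_eq_mul, ← Finset.mul_sum]; rw [ha' z, mul_zero] }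

/-- The tensors `a` for which `r(a)` is symmetric (`ε = 1`) or skew-symmetric (`ε = -1`). -/
def rParity (g : V → V → ℝ) (ψp : (Fin 3 → V) → ℝ) (ε : ℝ) :
    Submodule ℝ (V →ₗ[ℝ] V →ₗ[ℝ] V →ₗ[ℝ] ℝ) where
  carrier := {a | ∀ x y, rSix g ψp a y x = ε * rSix g ψp a x y}
  zero_mem' := by simp [rSix, formInner]
  add_mem' := by
    intro a b ha hb x y
    have key : ∀ x y, rSix g ψp (a + b) x y = rSix g ψp a x y + rSix g ψp b x y := by
      intro x y
      simp only [rSix, formInner, LinearMap.add_apply, add_mul, Finset.sum_add_distrib, mul_add]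
    rw [key, key, ha x y, hb x y]; ring
  smul_mem' := by
    intro c a ha x y
    have key : ∀ x y, rSix g ψp (c • a) x y = c * rSix g ψp a x y := by
      intro x y
      simp only [rSix, formInner, LinearMap.smul_apply, smul_eq_mul, mul_assoc, ← Finset.mul_sum]
      ring
    rw [key, key, ha x y]; ring

/-- The `SU(3)`-modules `W₁⁺` (`ε = 1`) and `W₁⁻` (`ε = -1`). -/
def spaceW1Sign (g : V → V → ℝ) (I : V → V) (ψp : (Fin 3 → V) → ℝ) (ε : ℝ) :
    Submodule ℝ (V →ₗ[ℝ] V →ₗ[ℝ] V →ₗ[ℝ] ℝ) :=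
  spaceW1 I ⊓ rParity g ψp ε

/-- The `SU(3)`-modules `W₂⁺` (`ε = 1`) and `W₂⁻` (`ε = -1`). -/
def spaceW2Sign (g : V → V → ℝ) (I : V → V) (ψp : (Fin 3 → V) → ℝ) (ε : ℝ) :
    Submodule ℝ (V →ₗ[ℝ] V →ₗ[ℝ] V →ₗ[ℝ] ℝ) :=
  spaceW2 I ⊓ rParity g ψp ε

end LinearAlgebra

/-! ## Levi-Civita derivative in charts

The derivatives at a point `p` are computed in the preferred chart at `p`, with respect to which
the tangent space at `p` is the model space. -/

section Charts

variable {m : ℕ} {M : Type*} [TopologicalSpace M] [ChartedSpace (EuclideanSpace ℝ (Fin m)) M]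

/-- The expression in the chart at `p` of a covariant `k`-tensor field: its pull-back by the
inverse of the chart. -/
def inChart (p : M) {k : ℕ} (α : ∀ q : M, (Fin k → TangentSpace (𝓡 m) q) → ℝ)
    (y : EuclideanSpace ℝ (Fin m)) (v : Fin k → EuclideanSpace ℝ (Fin m)) : ℝ :=
  α ((extChartAt (𝓡 m) p).symm y)
    (fun i => mfderiv (𝓡 m) (𝓡 m) (extChartAt (𝓡 m) p).symm y (v i))

/-- The derivative at `p`, in the direction `X`, of the coefficient of `α` on the coordinate
constant vector fields `v`. -/
def coordDeriv (p : M) {k : ℕ} (α : ∀ q : M, (Fin k → TangentSpace (𝓡 m) q) → ℝ)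
    (X : TangentSpace (𝓡 m) p) (v : Fin k → TangentSpace (𝓡 m) p) : ℝ :=
  fderiv ℝ (fun y => inChart p α y v) (extChartAt (𝓡 m) p p) X

/-- The Christoffel symbol `Γ(X, Y)` at `p` of the Levi-Civita connection of `g`:
`⟨Γ(X, Y), Z⟩ = (1/2) (∂_X g(Y, Z) + ∂_Y g(X, Z) - ∂_Z g(X, Y))`. -/
def christoffel (g : ∀ q : M, TangentSpace (𝓡 m) q → TangentSpace (𝓡 m) q → ℝ) (p : M)
    (X Y : TangentSpace (𝓡 m) p) : TangentSpace (𝓡 m) p :=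
  sharp (g p) fun Z => (1 / 2) *
    (coordDeriv p (fun q (v : Fin 2 → TangentSpace (𝓡 m) q) => g q (v 0) (v 1)) X ![Y, Z]
      + coordDeriv p (fun q (v : Fin 2 → TangentSpace (𝓡 m) q) => g q (v 0) (v 1)) Y ![X, Z]
      - coordDeriv p (fun q (v : Fin 2 → TangentSpace (𝓡 m) q) => g q (v 0) (v 1)) Z ![X, Y])

/-- The Levi-Civita covariant derivative `(∇_X α)(v₁, …, v_k)` at `p`. -/
def covDeriv (g : ∀ q : M, TangentSpace (𝓡 m) q → TangentSpace (𝓡 m) q → ℝ) {k : ℕ}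
    (α : ∀ q : M, (Fin k → TangentSpace (𝓡 m) q) → ℝ) (p : M)
    (X : TangentSpace (𝓡 m) p) (v : Fin k → TangentSpace (𝓡 m) p) : ℝ :=
  coordDeriv p α X v + endAct (christoffel g p X) (α p) v

/-- The exterior derivative of a differential form,
`dα(v₀, …, v_k) = ∑ (-1)^i ∂_{v_i} α(v₀, …, v̂_i, …, v_k)` in a chart. -/
def extDer {k : ℕ} (α : ∀ q : M, (Fin k → TangentSpace (𝓡 m) q) → ℝ) (p : M)
    (v : Fin (k + 1) → TangentSpace (𝓡 m) p) : ℝ :=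
  ∑ i : Fin (k + 1), (-1) ^ (i : ℕ) * coordDeriv p α (v i) (fun j => v (i.succAbove j))

end Charts

/-! ## Intrinsic torsion and type of an `SU(3)`-structure -/

section SU3

variable {M : Type*} [TopologicalSpace M] [ChartedSpace (EuclideanSpace ℝ (Fin 6)) M]

/-- `T` is the intrinsic `SU(3)`-torsion at `p` of the structure `(g, I, ψ₊ + i ψ₋)`: it takes
values in the orthogonal complement of `su(3)` in `so(6)`, and `∇ + T` annihilates `ω`, `ψ₊` and
`ψ₋`, i.e. it is the minimal `SU(3)`-connection. -/
structure IsIntrinsicTorsion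
    (g : ∀ q : M, TangentSpace (𝓡 6) q → TangentSpace (𝓡 6) q → ℝ)
    (I : ∀ q : M, TangentSpace (𝓡 6) q → TangentSpace (𝓡 6) q)
    (ψp ψm : ∀ q : M, (Fin 3 → TangentSpace (𝓡 6) q) → ℝ) (p : M)
    (T : TangentSpace (𝓡 6) p →ₗ[ℝ] TangentSpace (𝓡 6) p →ₗ[ℝ] TangentSpace (𝓡 6) p) : Prop where
  skew : ∀ x y z, g p (T x y) z = - g p y (T x z)
  orthogonal : ∀ A : TangentSpace (𝓡 6) p →ₗ[ℝ] TangentSpace (𝓡 6) p,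
    IsInSu3 (g p) (I p) (ψp p) (ψm p) A →
      ∀ x, LinearMap.trace ℝ (TangentSpace (𝓡 6) p) (A ∘ₗ T x) = 0
  omega : ∀ x v, covDeriv g (fun q => kahler (g q) (I q)) p x v
    + endAct (T x) (kahler (g p) (I p)) v = 0
  psiPlus : ∀ x v, covDeriv g ψp p x v + endAct (T x) (ψp p) v = 0
  psiMinus : ∀ x v, covDeriv g ψm p x v + endAct (T x) (ψm p) v = 0

/-- The `SU(3)`-structure is of type `C`, where `C` is a sum of some of the modules `W₁^±`,
`W₂^±`, `W₃` (and `W₅` is not a summand): at every point the intrinsic torsion takes values in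
`u(3)^⊥`, i.e. its `W₅`-part `η` vanishes, and its remaining part `ξ`, identified with
`∇ω = - ξ ω`, lies in `C`. -/
def IsOfType
    (g : ∀ q : M, TangentSpace (𝓡 6) q → TangentSpace (𝓡 6) q → ℝ)
    (I : ∀ q : M, TangentSpace (𝓡 6) q → TangentSpace (𝓡 6) q)
    (ψp ψm : ∀ q : M, (Fin 3 → TangentSpace (𝓡 6) q) → ℝ)
    (C : ∀ p : M, Submodule ℝ (TangentSpace (𝓡 6) p →ₗ[ℝ]
      TangentSpace (𝓡 6) p →ₗ[ℝ] TangentSpace (𝓡 6) p →ₗ[ℝ] ℝ)) : Prop :=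
  ∀ p : M, ∃ T : TangentSpace (𝓡 6) p →ₗ[ℝ] TangentSpace (𝓡 6) p →ₗ[ℝ] TangentSpace (𝓡 6) p,
    IsIntrinsicTorsion g I ψp ψm p T ∧
    (∀ x y, T x (I p y) = - I p (T x y)) ∧
    ∃ a ∈ C p, ∀ x y z, a x y z = covDeriv g (fun q => kahler (g q) (I q)) p x ![y, z]

end SU3

/-! ## `G₂`-structures on seven-manifolds -/

/-- A `G₂`-structure on the Riemannian seven-manifold `N`: a Riemannian metric and a three-form
which near each point has the standard expression in a smooth local orthonormal frame. -/
structure G2Structure (N : Type*) [TopologicalSpace N]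
    [ChartedSpace (EuclideanSpace ℝ (Fin 7)) N] [IsManifold (𝓡 7) ∞ N] where
  metric : Bundle.ContMDiffRiemannianMetric (𝓡 7) ∞ (EuclideanSpace ℝ (Fin 7))
    (fun p : N => TangentSpace (𝓡 7) p)
  form : ∀ p : N, (TangentSpace (𝓡 7) p) [⋀^Fin 3]→ₗ[ℝ] ℝ
  exists_frame : ∀ p : N, ∃ U : Set N, IsOpen U ∧ p ∈ U ∧
    ∃ e : Fin 7 → ∀ q : N, TangentSpace (𝓡 7) q,
      (∀ i, ContMDiffOn (𝓡 7) (𝓡 7).tangent ∞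
        (fun q => (⟨q, e i q⟩ : TangentBundle (𝓡 7) N)) U) ∧
      ∀ q ∈ U, IsCayleyBasis (fun x y => metric.inner q x y) (fun v => form q v) (fun i => e i q)

namespace G2Structure

variable {N : Type*} [TopologicalSpace N] [ChartedSpace (EuclideanSpace ℝ (Fin 7)) N]
  [IsManifold (𝓡 7) ∞ N] (S : G2Structure N)

/-- The metric. -/
def g (p : N) (x y : TangentSpace (𝓡 7) p) : ℝ := S.metric.inner p x y

/-- The fundamental three-form `φ`. -/
def phi (p : N) (v : Fin 3 → TangentSpace (𝓡 7) p) : ℝ := S.form p v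

/-- The four-form `∗φ`. -/
def star (p : N) : (Fin 4 → TangentSpace (𝓡 7) p) → ℝ := starPhi (S.g p) (S.phi p)

/-- The two-fold vector cross product `P`. -/
def cross (p : N) : TangentSpace (𝓡 7) p → TangentSpace (𝓡 7) p → TangentSpace (𝓡 7) p :=
  crossProd (S.g p) (S.phi p)

/-- The bilinear form `r̄(φ) = r̄(∇φ)`. -/
def r (p : N) : TangentSpace (𝓡 7) p → TangentSpace (𝓡 7) p → ℝ :=
  rBar (S.g p) (S.phi p) (covDeriv S.g S.phi p)

/-- Type `P`: parallel `G₂`-structures. -/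
def IsTypeP : Prop := ∀ p x y, S.r p x y = 0

/-- Type `X₁`: nearly parallel `G₂`-structures (including the parallel ones). -/
def IsTypeX1 : Prop := ∃ k : ℝ, ∀ p x y, S.r p x y = k / 4 * S.g p x y

end G2Structure

/-! ## Hypersurfaces -/

/-- An (immersed) hypersurface `M` of the manifold `N` with `G₂`-structure, with a unit normal
vector field. -/
structure OrientedHypersurface (M : Type*) [TopologicalSpace M]
    [ChartedSpace (EuclideanSpace ℝ (Fin 6)) M]
    {N : Type*} [TopologicalSpace N] [ChartedSpace (EuclideanSpace ℝ (Fin 7)) N]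
    [IsManifold (𝓡 7) ∞ N] (S : G2Structure N) where
  incl : M → N
  smooth_incl : ContMDiff (𝓡 6) (𝓡 7) ∞ incl
  injective_mfderiv : ∀ p, Function.Injective (mfderiv (𝓡 6) (𝓡 7) incl p)
  normal : ∀ p : M, TangentSpace (𝓡 7) (incl p)
  smooth_normal : ContMDiff (𝓡 6) (𝓡 7).tangent ∞
    (fun p => (⟨incl p, normal p⟩ : TangentBundle (𝓡 7) N))
  normal_unit : ∀ p, S.g (incl p) (normal p) (normal p) = 1
  normal_orthogonal : ∀ p x, S.g (incl p) (normal p) (mfderiv (𝓡 6) (𝓡 7) incl p x) = 0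

namespace OrientedHypersurface

variable {M : Type*} [TopologicalSpace M] [ChartedSpace (EuclideanSpace ℝ (Fin 6)) M]
  {N : Type*} [TopologicalSpace N] [ChartedSpace (EuclideanSpace ℝ (Fin 7)) N]
  [IsManifold (𝓡 7) ∞ N] {S : G2Structure N} (X : OrientedHypersurface M S)

/-- The differential of the inclusion. -/
def push (p : M) (x : TangentSpace (𝓡 6) p) : TangentSpace (𝓡 7) (X.incl p) :=
  mfderiv (𝓡 6) (𝓡 7) X.incl p x

/-- The induced metric. -/
def g (p : M) (x y : TangentSpace (𝓡 6) p) : ℝ := S.g (X.incl p) (X.push p x) (X.push p y)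

/-- The almost complex structure: `I x` is the tangent vector equal to `P(n, x)`. -/
def I (p : M) (x : TangentSpace (𝓡 6) p) : TangentSpace (𝓡 6) p :=
  Classical.epsilon fun w => X.push p w = S.cross (X.incl p) (X.normal p) (X.push p x)

/-- `ι^*φ`. -/
def pullPhi (p : M) (v : Fin 3 → TangentSpace (𝓡 6) p) : ℝ :=
  S.phi (X.incl p) fun i => X.push p (v i)

/-- `ι^*(n ⌟ ∗φ)`. -/
def pullNStar (p : M) (v : Fin 3 → TangentSpace (𝓡 6) p) : ℝ :=
  interiorProd (X.normal p) (S.star (X.incl p)) fun i => X.push p (v i)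

/-- The real part `ψ₊` of the complex volume form with phase function `θ`. -/
def psiPlus (θ : M → ℝ) (p : M) (v : Fin 3 → TangentSpace (𝓡 6) p) : ℝ :=
  Real.cos (θ p) * X.pullPhi p v - Real.sin (θ p) * X.pullNStar p v

/-- The imaginary part `ψ₋` of the complex volume form with phase function `θ`. -/
def psiMinus (θ : M → ℝ) (p : M) (v : Fin 3 → TangentSpace (𝓡 6) p) : ℝ :=
  Real.sin (θ p) * X.pullPhi p v + Real.cos (θ p) * X.pullNStar p v

/-- The second derivative of `ι` at `p`, in the charts at `p` and at `ι(p)`. -/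
def hessian (p : M) (x y : TangentSpace (𝓡 6) p) : TangentSpace (𝓡 7) (X.incl p) :=
  fderiv ℝ (fun u => fderiv ℝ (writtenInExtChartAt (𝓡 6) (𝓡 7) p X.incl) u y)
    (extChartAt (𝓡 6) p p) x

/-- The ambient derivative `∇̄_x (ι_* Y)` at `p`, where `Y` is the vector field with constant
components `y` in the chart at `p`: `∂²ι(x, y) + Γ̄(ι_* x, ι_* y)`. -/
def ambientDeriv (p : M) (x y : TangentSpace (𝓡 6) p) : TangentSpace (𝓡 7) (X.incl p) :=
  X.hessian p x y + christoffel S.g (X.incl p) (X.push p x) (X.push p y)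

/-- The shape tensor `II(x, y)`: the normal part of the ambient derivative. -/
def II (p : M) (x y : TangentSpace (𝓡 6) p) : TangentSpace (𝓡 7) (X.incl p) :=
  S.g (X.incl p) (X.ambientDeriv p x y) (X.normal p) • X.normal p

/-- The second fundamental form `B(x, y) = ⟨II(x, y), n⟩`. -/
def B (p : M) (x y : TangentSpace (𝓡 6) p) : ℝ := S.g (X.incl p) (X.II p x y) (X.normal p)

/-- The mean curvature vector `H = (1/6) tr II`. -/
def H (p : M) : TangentSpace (𝓡 7) (X.incl p) :=
  (1 / 6 : ℝ) • ∑ i : Fin 6, X.II p (orthoBasis 6 (X.g p) i) (orthoBasis 6 (X.g p) i)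

/-- `h = ⟨H, n⟩`. -/
def h (p : M) : ℝ := S.g (X.incl p) (X.H p) (X.normal p)

/-- `M` is a minimal variety: `H = 0`. -/
def IsMinimal : Prop := ∀ p, X.H p = 0

/-- `M` is totally geodesic: `II = 0`. -/
def IsTotallyGeodesic : Prop := ∀ p x y, X.II p x y = 0

/-- `M` is totally umbilic: `II = ⟨·, ·⟩ H`. -/
def IsTotallyUmbilic : Prop := ∀ p x y, X.II p x y = X.g p x y • X.H p

/-- `I B`, that is `(I B)(x, y) = B(I x, I y)`. -/
def IB (p : M) (x y : TangentSpace (𝓡 6) p) : ℝ := X.B p (X.I p x) (X.I p y)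

/-- The induced `SU(3)`-structure with phase function `θ` is of type `C`. -/
def HasType (θ : M → ℝ) (C : ∀ p : M, Submodule ℝ (TangentSpace (𝓡 6) p →ₗ[ℝ]
    TangentSpace (𝓡 6) p →ₗ[ℝ] TangentSpace (𝓡 6) p →ₗ[ℝ] ℝ)) : Prop :=
  IsOfType X.g X.I (X.psiPlus θ) (X.psiMinus θ) C

/-- `W₁⁺` (`ε = 1`) and `W₁⁻` (`ε = -1`) at `p` for the induced structure with phase `θ`. -/
def W1 (θ : M → ℝ) (ε : ℝ) (p : M) : Submodule ℝ (TangentSpace (𝓡 6) p →ₗ[ℝ]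
    TangentSpace (𝓡 6) p →ₗ[ℝ] TangentSpace (𝓡 6) p →ₗ[ℝ] ℝ) :=
  spaceW1Sign (X.g p) (X.I p) (X.psiPlus θ p) ε

/-- `W₂⁺` (`ε = 1`) and `W₂⁻` (`ε = -1`) at `p` for the induced structure with phase `θ`. -/
def W2 (θ : M → ℝ) (ε : ℝ) (p : M) : Submodule ℝ (TangentSpace (𝓡 6) p →ₗ[ℝ]
    TangentSpace (𝓡 6) p →ₗ[ℝ] TangentSpace (𝓡 6) p →ₗ[ℝ] ℝ) :=
  spaceW2Sign (X.g p) (X.I p) (X.psiPlus θ p) ε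

/-- `W₃` at `p` for the induced structure. -/
def W3 (p : M) : Submodule ℝ (TangentSpace (𝓡 6) p →ₗ[ℝ]
    TangentSpace (𝓡 6) p →ₗ[ℝ] TangentSpace (𝓡 6) p →ₗ[ℝ] ℝ) :=
  spaceW3 (X.g p) (X.I p)

end OrientedHypersurface

end

noncomputable section

section CrossProduct

open scoped RealInnerProductSpace

variable {E : Type*} [NormedAddCommGroup E] [InnerProductSpace ℝ E]

/-- A two-fold vector cross product on a Euclidean vector space. -/
structure IsCrossProduct (P : E →L[ℝ] E →L[ℝ] E) : Prop where
  swap : ∀ x y, P x y = - P y x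
  inner_right_swap : ∀ x y z, ⟪P x y, z⟫ = - ⟪P x z, y⟫
  inner_same : ∀ x y z, ⟪P x y, P x z⟫ = ⟪x, x⟫ * ⟪y, z⟫ - ⟪x, y⟫ * ⟪x, z⟫

/-- The four-form of a cross product. -/
def crossStar (P : E →L[ℝ] E →L[ℝ] E) (w x y z : E) : ℝ :=
  - ⟪P w x, P y z⟫ - ⟪x, y⟫ * ⟪z, w⟫ + ⟪x, z⟫ * ⟪y, w⟫

namespace IsCrossProduct

variable {P : E →L[ℝ] E →L[ℝ] E} (hP : IsCrossProduct P)
include hP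

theorem inner_swap (x y z : E) : ⟪P x y, z⟫ = - ⟪P y x, z⟫ := by
  rw [hP.swap x y, inner_neg_left]

theorem inner_cycle (x y z : E) : ⟪P x y, z⟫ = ⟪P y z, x⟫ := by
  rw [hP.inner_swap x y z, hP.inner_right_swap y x z, neg_neg]

theorem self (x : E) : P x x = 0 := by
  have h := hP.swap x x
  have : (2 : ℝ) • P x x = 0 := by rw [two_smul]; nth_rw 1 [h]; simp
  simpa using this

theorem inner_polar (x w y z : E) : ⟪P x y, P w z⟫ + ⟪P w y, P x z⟫
    = 2 * ⟪x, w⟫ * ⟪y, z⟫ - ⟪x, y⟫ * ⟪w, z⟫ - ⟪w, y⟫ * ⟪x, z⟫ := by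
  have h := hP.inner_same (x + w) y z
  simp only [map_add, add_apply, inner_add_left, inner_add_right] at h
  rw [real_inner_comm x w] at h
  linarith [hP.inner_same x y z, hP.inner_same w y z]

theorem inner_same_right (w x y : E) :
    ⟪P w y, P x y⟫ = ⟪w, x⟫ * ⟪y, y⟫ - ⟪w, y⟫ * ⟪x, y⟫ := by
  rw [hP.swap w, hP.swap x, inner_neg_neg, hP.inner_same, real_inner_comm y w,
    real_inner_comm y x]
  ring

theorem star_swap12 (w x y z : E) : crossStar P w x y z = - crossStar P x w y z := by
  simp only [crossStar]
  rw [hP.inner_swap w x, real_inner_comm z x, real_inner_comm z w, real_inner_comm y w,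
    real_inner_comm y x]
  ring

theorem star_swap34 (w x y z : E) : crossStar P w x y z = - crossStar P w x z y := by
  simp only [crossStar]
  rw [hP.swap y z, inner_neg_right]
  ring

theorem star_swap23 (w x y z : E) : crossStar P w x y z = - crossStar P w y x z := by
  have h := hP.inner_polar x y w z
  simp only [crossStar]
  rw [hP.swap w x, hP.swap w y, inner_neg_left, inner_neg_left]
  simp only [real_inner_comm] at h ⊢
  linarith

theorem star_zero12 (x y z : E) : crossStar P x x y z = 0 := by
  linarith [hP.star_swap12 x x y z]

theorem star_cycle (w x y z : E) : crossStar P w x y z = crossStar P w y z x := by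
  rw [hP.star_swap23 w x y z, hP.star_swap34 w y x z, neg_neg]

theorem starPhi_eq (w x y z : E) :
    -(1 / 3) * (⟪P w x, P y z⟫ + ⟪P w y, P z x⟫ + ⟪P w z, P x y⟫) = crossStar P w x y z := by
  have h1 := hP.star_cycle w x y z
  have h2 := hP.star_cycle w y z x
  simp only [crossStar] at h1 h2 ⊢
  simp only [real_inner_comm] at h1 h2 ⊢
  linarith

theorem star_cross_add (p q x y z : E) :
    crossStar P (P p q) x y z + crossStar P (P y z) p q x =
      - ⟪x, y⟫ * ⟪P p q, z⟫ + ⟪x, z⟫ * ⟪P p q, y⟫ - ⟪x, p⟫ * ⟪P y z, q⟫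
        + ⟪x, q⟫ * ⟪P y z, p⟫ := by
  rw [hP.star_cycle (P y z) p q x, hP.star_cycle (P y z) q x p]
  simp only [crossStar]
  rw [hP.inner_right_swap (P p q) x (P y z), hP.inner_swap (P p q) (P y z) x,
    hP.inner_right_swap (P y z) (P p q) x, real_inner_comm (P p q) z, real_inner_comm (P p q) y,
    real_inner_comm (P y z) q, real_inner_comm (P y z) p]
  ring

/-- Contraction of the four-form with the cross product. -/
theorem star_cross (p q x y z : E) : crossStar P (P p q) x y z =
    - (⟪p, x⟫ * ⟪P q y, z⟫ - ⟪q, x⟫ * ⟪P p y, z⟫ + ⟪p, y⟫ * ⟪P q z, x⟫ - ⟪q, y⟫ * ⟪P p z, x⟫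
      + ⟪p, z⟫ * ⟪P q x, y⟫ - ⟪q, z⟫ * ⟪P p x, y⟫) := by
  have h1 := hP.star_cross_add p q x y z
  have h2 := hP.star_cross_add x y z p q
  have h3 := hP.star_cross_add z p q x y
  have h4 := hP.star_cross_add q x y z p
  have h5 := hP.star_cross_add y z p q x
  simp only [hP.inner_right_swap p z x,
    (hP.inner_cycle p q x).symm,
    hP.inner_right_swap q z x,
    (hP.inner_cycle p x y).symm,
    (hP.inner_cycle q x y).symm,
    (hP.inner_cycle p y z).symm,
    (hP.inner_cycle q y z).symm,
    (hP.inner_cycle x y z).symm,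
    hP.inner_cycle z p q,
    hP.inner_cycle z p x,
    hP.inner_cycle z p y] at h1 h2 h3 h4 h5 ⊢
  simp only [real_inner_comm] at h1 h2 h3 h4 h5 ⊢
  linarith

omit hP in
theorem star_sum_left {ι : Type*} (s : Finset ι) (f : ι → E) (x y z : E) :
    crossStar P (∑ i ∈ s, f i) x y z = ∑ i ∈ s, crossStar P (f i) x y z := by
  simp only [crossStar, map_sum, FunLike.coe_sum, Finset.sum_apply, sum_inner,
    inner_sum, Finset.mul_sum, Finset.sum_add_distrib, Finset.sum_sub_distrib,
    Finset.sum_neg_distrib]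

omit hP in
theorem star_smul_left (c : ℝ) (w x y z : E) :
    crossStar P (c • w) x y z = c * crossStar P w x y z := by
  simp only [crossStar, map_smul, smul_apply, inner_smul_left, inner_smul_right, conj_trivial]
  ring

/-- The derivation of the three-form by a skew endomorphism is an interior product of the
four-form. -/
theorem exists_star_eq_of_skew {m : ℕ} (b : OrthonormalBasis (Fin m) ℝ E) (A : E →ₗ[ℝ] E)
    (hA : ∀ x y, ⟪A x, y⟫ = - ⟪x, A y⟫) : ∃ s : E, ∀ x y z,
    ⟪P (A x) y, z⟫ + ⟪P x (A y), z⟫ + ⟪P x y, A z⟫ = crossStar P s x y z := by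
  refine ⟨(-(1 / 2) : ℝ) • ∑ p, P (b p) (A (b p)), fun x y z => ?_⟩
  have hs : ∀ u v : E, ∑ p, ⟪b p, u⟫ * ⟪b p, v⟫ = ⟪u, v⟫ := fun u v => by
    rw [← b.sum_inner_mul_inner u v]
    exact Finset.sum_congr rfl fun p _ => by rw [real_inner_comm u]
  have h : ∀ p, crossStar P (P (b p) (A (b p))) x y z =
      ⟪b p, x⟫ * ⟪b p, A (P y z)⟫ - ⟪b p, A x⟫ * ⟪b p, P y z⟫
      + (⟪b p, y⟫ * ⟪b p, A (P z x)⟫ - ⟪b p, A y⟫ * ⟪b p, P z x⟫)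
      + (⟪b p, z⟫ * ⟪b p, A (P x y)⟫ - ⟪b p, A z⟫ * ⟪b p, P x y⟫) := fun p => by
    rw [hP.star_cross]
    simp only [hP.inner_cycle (A (b p)), hP.inner_cycle (b p), hA (b p),
      real_inner_comm (A (b p)), real_inner_comm (b p)]
    ring
  rw [star_smul_left, star_sum_left]
  simp only [h, Finset.sum_add_distrib, Finset.sum_sub_distrib, hs]
  rw [hP.inner_cycle (A x), hP.inner_cycle x (A y), hP.inner_cycle (A y),
    real_inner_comm (A x), real_inner_comm (A y), real_inner_comm (A z), hA x, hA y, hA z]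
  ring

theorem sum_star_mul_star (b : OrthonormalBasis (Fin 7) ℝ E) (u v : E) :
    ∑ i, ∑ j, ∑ k, crossStar P u (b i) (b j) (b k) * crossStar P v (b i) (b j) (b k)
      = 24 * ⟪u, v⟫ := by
  have hs : ∀ u v : E, ∑ p, ⟪u, b p⟫ * ⟪v, b p⟫ = ⟪u, v⟫ := fun u v => by
    rw [← b.sum_inner_mul_inner u v]
    exact Finset.sum_congr rfl fun p _ => by rw [real_inner_comm v]
  have h1 : ∀ i : Fin 7, ⟪b i, b i⟫ = 1 := fun i => by simp
  have hc : ∀ w i j k : E, crossStar P w i j k = ⟪P j (P w i) - ⟪i, j⟫ • w + ⟪w, j⟫ • i, k⟫ := by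
    intro w i j k
    rw [inner_add_left, inner_sub_left, inner_smul_left, inner_smul_left, hP.inner_right_swap j,
      crossStar, real_inner_comm k w, real_inner_comm j w, real_inner_comm (P w i)]
    simp
    ring
  have hj : ∀ i j : Fin 7, ∑ k, crossStar P u (b i) (b j) (b k) * crossStar P v (b i) (b j) (b k)
      = ⟪P u (b i), P v (b i)⟫ * ⟪b j, b j⟫ - ⟪P u (b i), b j⟫ * ⟪P v (b i), b j⟫
        + ⟪b i, b j⟫ * ⟪P v (P u (b i)), b j⟫ + ⟪b i, b j⟫ * ⟪P u (P v (b i)), b j⟫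
        - ⟪v, b j⟫ * ⟪P (b i) (P u (b i)), b j⟫ - ⟪u, b j⟫ * ⟪P (b i) (P v (b i)), b j⟫
        + ⟪b i, b j⟫ * ⟪b i, b j⟫ * ⟪u, v⟫ + ⟪u, b j⟫ * ⟪v, b j⟫ * ⟪b i, b i⟫
        - ⟪b i, b j⟫ * ⟪v, b j⟫ * ⟪u, b i⟫ - ⟪b i, b j⟫ * ⟪u, b j⟫ * ⟪v, b i⟫ := by
    intro i j
    have hr : ∀ x y z, ⟪P x y, z⟫ = - ⟪P z y, x⟫ := fun x y z => by
      rw [hP.inner_swap z, neg_neg, hP.inner_cycle x]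
    simp only [hc, hs]
    simp only [inner_add_left, inner_sub_left, inner_add_right, inner_sub_right, inner_smul_left,
      inner_smul_right, conj_trivial, hP.inner_same]
    rw [hr (b j) _ v, hr (b j) _ (b i), real_inner_comm _ u, hr (b j) _ u,
      real_inner_comm (P (b j) _) (b i), hr (b j) _ (b i), real_inner_comm (b i) v,
      real_inner_comm (P u (b i)) (b j), real_inner_comm (P v (b i)) (b j)]
    ring
  have hi : ∀ i : Fin 7, ∑ j, ∑ k, crossStar P u (b i) (b j) (b k) *
      crossStar P v (b i) (b j) (b k) = 4 * ⟪u, v⟫ - 4 * (⟪u, b i⟫ * ⟪v, b i⟫) := by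
    intro i
    simp only [hj, Finset.sum_add_distrib, Finset.sum_sub_distrib, ← Finset.sum_mul, hs, h1]
    have hr : ∀ x y z, ⟪P x y, z⟫ = - ⟪P z y, x⟫ := fun x y z => by
      rw [hP.inner_swap z, neg_neg, hP.inner_cycle x]
    rw [real_inner_comm (P v (P u (b i))), real_inner_comm (P u (P v (b i))),
      real_inner_comm (P (b i) (P u (b i))), real_inner_comm (P (b i) (P v (b i))),
      hr (b i) _ v, hr (b i) _ u, hP.inner_right_swap v (P u (b i)) (b i),
      hP.inner_right_swap u (P v (b i)) (b i), real_inner_comm (P u (b i)) (P v (b i)),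
      hP.inner_same_right, h1, real_inner_comm u (b i), real_inner_comm v (b i)]
    simp
    ring
  simp only [hi, Finset.sum_sub_distrib, ← Finset.mul_sum, hs]
  simp
  ring

end IsCrossProduct

/-- The cross product of the octonions, `P e_i e_{i+1} = e_{i+3}`. -/
def octonionCross : EuclideanSpace ℝ (Fin 7) →L[ℝ] EuclideanSpace ℝ (Fin 7) →L[ℝ]
    EuclideanSpace ℝ (Fin 7) :=
  (LinearMap.mk₂ ℝ (fun x y => WithLp.toLp 2 fun k : Fin 7 =>
      (x (k + 1) * y (k + 3) - x (k + 3) * y (k + 1)) + (x (k + 2) * y (k + 6) - x (k + 6) * y (k +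
          2))
        + (x (k + 4) * y (k + 5) - x (k + 5) * y (k + 4)))
    (fun x y z => by ext k; simp; ring) (fun c x y => by ext k; simp; ring)
    (fun x y z => by ext k; simp; ring) (fun c x y => by ext k; simp; ring)).toContinuousBilinearMap

theorem octonionCross_apply (x y : EuclideanSpace ℝ (Fin 7)) (k : Fin 7) :
    octonionCross x y k =
      (x (k + 1) * y (k + 3) - x (k + 3) * y (k + 1)) + (x (k + 2) * y (k + 6) - x (k + 6) * y (k +
          2))
        + (x (k + 4) * y (k + 5) - x (k + 5) * y (k + 4)) := rfl

theorem isCrossProduct_octonionCross : IsCrossProduct octonionCross where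
  swap x y := by
    ext k
    simp only [octonionCross_apply, PiLp.neg_apply]
    ring
  inner_right_swap x y z := by
    simp only [PiLp.inner_apply, octonionCross_apply, Fin.sum_univ_seven, RCLike.inner_apply,
      conj_trivial, Fin.isValue, Fin.reduceAdd, zero_add]
    ring
  inner_same x y z := by
    simp only [PiLp.inner_apply, octonionCross_apply, Fin.sum_univ_seven, RCLike.inner_apply,
      conj_trivial, Fin.isValue, Fin.reduceAdd, zero_add]
    ring

theorem sum_det_cayley (x : Fin 3 → EuclideanSpace ℝ (Fin 7)) :
    ∑ i : Fin 7, Matrix.det (Matrix.of fun a b : Fin 3 => x b ((![i, i + 1, i + 3] : Fin 3 → Fin 7)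
        a))
      = ⟪octonionCross (x 0) (x 1), x 2⟫ := by
  simp only [PiLp.inner_apply, octonionCross_apply, Fin.sum_univ_seven, RCLike.inner_apply,
      conj_trivial, Matrix.det_fin_three, Matrix.of_apply, Matrix.cons_val, Fin.isValue,
      Fin.reduceAdd, zero_add]
  ring

end CrossProduct

section HyperplaneAlgebra

open scoped RealInnerProductSpace

variable {E : Type*} [NormedAddCommGroup E] [InnerProductSpace ℝ E]
  {V : Type*} [AddCommGroup V] [Module ℝ V]

/-- `e` identifies `V` with the orthogonal complement of the unit vector `ν`, and `I` corresponds
to the complex structure `P(ν, ·)`. -/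
structure IsComplexHyperplane (P : E →L[ℝ] E →L[ℝ] E) (e : V →ₗ[ℝ] E) (ν : E)
    (I : V →ₗ[ℝ] V) : Prop where
  cross : IsCrossProduct P
  injective : Function.Injective e
  unit : ⟪ν, ν⟫ = 1
  orthogonal : ∀ x, ⟪ν, e x⟫ = 0
  exists_eq : ∀ w, ⟪ν, w⟫ = 0 → ∃ x, e x = w
  map_I : ∀ x, e (I x) = P ν (e x)

namespace IsComplexHyperplane

variable {P : E →L[ℝ] E →L[ℝ] E} {e : V →ₗ[ℝ] E} {ν : E} {I : V →ₗ[ℝ] V}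
  (h : IsComplexHyperplane P e ν I)
include h

theorem eq_of_inner (x y : V) (hxy : ∀ z, ⟪e x, e z⟫ = ⟪e y, e z⟫) : x = y := by
  have h1 := hxy (x - y)
  rw [← sub_eq_zero, ← inner_sub_left, ← map_sub, inner_self_eq_zero] at h1
  exact sub_eq_zero.1 (h.injective (by simpa using h1))

theorem inner_I_left (x y : V) : ⟪e (I x), e y⟫ = - ⟪e x, e (I y)⟫ := by
  rw [h.map_I, h.map_I, h.cross.inner_right_swap, real_inner_comm]

theorem inner_I_I (x y : V) : ⟪e (I x), e (I y)⟫ = ⟪e x, e y⟫ := by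
  rw [h.map_I, h.map_I, h.cross.inner_same, h.unit, h.orthogonal, h.orthogonal]
  ring

theorem I_I (x : V) : I (I x) = - x := by
  refine h.eq_of_inner _ _ fun z => ?_
  rw [h.inner_I_left, h.inner_I_I, map_neg, inner_neg_left]

theorem inner_I_self (x : V) : ⟪e x, e (I x)⟫ = 0 := by
  linarith [h.inner_I_left x x, real_inner_comm (e x) (e (I x))]

theorem inner_cross_normal (x y : V) : ⟪P (e x) (e y), ν⟫ = - ⟪e x, e (I y)⟫ := by
  rw [← h.inner_I_left, h.map_I, h.cross.inner_cycle ν, h.cross.inner_cycle, h.cross.inner_cycle]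

theorem phi_I_right (x y z : V) :
    ⟪P (e x) (e y), e (I z)⟫ = ⟪P (e x) (e (I y)), e z⟫ := by
  have h1 := h.cross.inner_polar ν (e x) (e y) (e z)
  simp only [h.orthogonal] at h1
  rw [← h.map_I, ← h.map_I, real_inner_comm (P (e x) (e z)), h.cross.inner_right_swap] at h1
  linarith

theorem phi_I_left (x y z : V) :
    ⟪P (e (I x)) (e y), e z⟫ = ⟪P (e x) (e (I y)), e z⟫ := by
  rw [h.cross.inner_swap, ← h.phi_I_right, h.cross.inner_swap, neg_neg, h.phi_I_right]

theorem phi_I_I_left (x y z : V) :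
    ⟪P (e (I x)) (e (I y)), e z⟫ = - ⟪P (e x) (e y), e z⟫ := by
  rw [h.phi_I_left, h.I_I]
  simp

theorem phi_I_I_right (x y z : V) :
    ⟪P (e x) (e (I y)), e (I z)⟫ = - ⟪P (e x) (e y), e z⟫ := by
  rw [h.phi_I_right, h.I_I]
  simp

/-- The tangential part of the cross product. -/
theorem exists_tangential (w : E) : ∃ t : V, e t = w - ⟪ν, w⟫ • ν :=
  h.exists_eq _ (by rw [inner_sub_right, inner_smul_right, h.unit]; ring)

/-- A form with the symmetries of a totally skew four-form of two incompatible complex types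
vanishes. -/
theorem eq_zero_of_skew (D : V → V → V → V → ℝ)
    (h2 : ∀ u v i j, D u v i j = - D u v j i) (h3 : ∀ u v i w, D u v i w + D u w i v = 0)
    (h4 : ∀ u v i j, D (I u) v i j = D u (I v) i j)
    (h5 : ∀ u v i j, D (I u) v (I i) j = D u v i j)
    (hn : ∀ u v i j, D u (-v) i j = - D u v i j) (u v i j : V) : D u v i j = 0 := by
  have h6 : ∀ u v i j, D u v i j = - D u i v j := fun u v i j => by
    linarith [h2 u v i j, h3 u v j i, h2 u i j v]
  have h7 : D (I u) v (I i) j = - D (I u) (I i) v j := h6 _ _ _ _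
  rw [h5, h4, h.I_I, hn, neg_neg] at h7
  linarith [h6 u v i j]

theorem inner_cross_eq (t : V → V → V)
    (ht : ∀ i j, e (t i j) = P (e i) (e j) - ⟪ν, P (e i) (e j)⟫ • ν) (w : E) (i j : V) :
    ⟪w, P (e i) (e j)⟫ = ⟪w, e (t i j)⟫ - ⟪w, ν⟫ * ⟪e i, e (I j)⟫ := by
  rw [ht, real_inner_comm (P (e i) (e j)) ν, h.inner_cross_normal, inner_sub_right,
    inner_smul_right]
  ring

theorem inner_cross_cross (u v i j : V) : ⟪P (e u) (e v), P (e i) (e j)⟫ =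
    ⟪e u, e (I v)⟫ * ⟪e i, e (I j)⟫ + ⟪e u, e i⟫ * ⟪e v, e j⟫ - ⟪e u, e j⟫ * ⟪e v, e i⟫
      - ⟪e u, e (I i)⟫ * ⟪e v, e (I j)⟫ + ⟪e u, e (I j)⟫ * ⟪e v, e (I i)⟫ := by
  let D : V → V → V → V → ℝ := fun u v i j => ⟪P (e u) (e v), P (e i) (e j)⟫ -
    (⟪e u, e (I v)⟫ * ⟪e i, e (I j)⟫ + ⟪e u, e i⟫ * ⟪e v, e j⟫ - ⟪e u, e j⟫ * ⟪e v, e i⟫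
      - ⟪e u, e (I i)⟫ * ⟪e v, e (I j)⟫ + ⟪e u, e (I j)⟫ * ⟪e v, e (I i)⟫)
  have hsw : ∀ x y, ⟪e x, e (I y)⟫ = - ⟪e y, e (I x)⟫ := fun x y => by
    rw [← h.inner_I_left, real_inner_comm]
  choose t ht using fun i j => h.exists_tangential (P (e i) (e j))
  have htI : ∀ i j, t (I i) j = - I (t i j) := fun i j => by
    refine h.eq_of_inner _ _ fun z => ?_
    have h1 := h.inner_cross_eq t ht (e z) (I i) j
    have h2 := h.inner_cross_eq t ht (e (I z)) i j
    rw [real_inner_comm ν, h.orthogonal, real_inner_comm] at h1 h2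
    rw [map_neg, inner_neg_left, h.inner_I_left, neg_neg, real_inner_comm, real_inner_comm (e (I
        z))]
    linarith [h.phi_I_left i j z, h.phi_I_right i j z]
  have h0 := h.eq_zero_of_skew D
    (fun u v i j => by
      simp only [D]
      rw [h.cross.swap (e i), inner_neg_right, hsw i j]; ring)
    (fun u v i w => by
      simp only [D]
      have h1 := h.cross.inner_polar (e v) (e w) (e u) (e i)
      rw [h.cross.swap (e u), h.cross.swap (e i), inner_neg_neg, h.cross.swap (e u),
        h.cross.swap (e i) (e v), inner_neg_neg, hsw i w, hsw v i, hsw v w, hsw i v,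
        real_inner_comm (e v) (e w)]
      rw [real_inner_comm (e u) (e v), real_inner_comm (e u) (e w)] at h1
      linarith)
    (fun u v i j => by
      simp only [D]
      rw [h.inner_cross_eq t ht, h.inner_cross_eq t ht, h.inner_cross_normal,
        h.inner_cross_normal, h.phi_I_left, h.inner_I_left, h.inner_I_left u]
      simp only [h.I_I, map_neg, inner_neg_right, h.inner_I_left]
      ring)
    (fun u v i j => by
      simp only [D]
      rw [h.inner_cross_eq t ht, h.inner_cross_eq t ht, h.inner_cross_normal,
        h.inner_cross_normal, htI]
      simp only [map_neg, inner_neg_right, h.phi_I_right, h.phi_I_I_left, h.inner_I_I,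
        h.inner_I_left, h.I_I]
      ring)
    (fun u v i j => by simp only [D, map_neg, inner_neg_left, inner_neg_right]; ring)
    u v i j
  simp only [D] at h0
  linarith

theorem star_normal (x y z : V) :
    crossStar P ν (e x) (e y) (e z) = - ⟪P (e (I x)) (e y), e z⟫ := by
  rw [crossStar, ← h.map_I, real_inner_comm ν (e z), h.orthogonal, real_inner_comm ν (e y),
    h.orthogonal, real_inner_comm, h.cross.inner_cycle (e (I x))]
  ring

theorem star_tangential (x y z w : V) : crossStar P (e x) (e y) (e z) (e w) =
    ⟪e x, e (I z)⟫ * ⟪e y, e (I w)⟫ - ⟪e x, e (I w)⟫ * ⟪e y, e (I z)⟫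
      - ⟪e x, e (I y)⟫ * ⟪e z, e (I w)⟫ := by
  rw [crossStar, h.inner_cross_cross, real_inner_comm (e x), real_inner_comm (e x) (e z)]
  ring

end IsComplexHyperplane
end HyperplaneAlgebra

section OrthonormalTuples

open scoped RealInnerProductSpace

variable {E : Type*} [NormedAddCommGroup E] [InnerProductSpace ℝ E]
  {V : Type*} [AddCommGroup V] [Module ℝ V]

theorem IsOrthonormalTuple.sum_smul {m : ℕ} {e : V →ₗ[ℝ] E} {o : Fin m → V}
    (ho : IsOrthonormalTuple (fun x y => ⟪e x, e y⟫) o) (hm : Module.finrank ℝ V = m)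
    [FiniteDimensional ℝ V] (x : V) :
    ∑ i, ⟪e x, e (o i)⟫ • o i = x := by
  have ho' : Orthonormal ℝ (e ∘ o) := orthonormal_iff_ite.2 ho
  have hli : LinearIndependent ℝ o := LinearIndependent.of_comp e ho'.linearIndependent
  rcases m with _ | m
  · have := Module.finrank_zero_iff.1 hm
    exact Subsingleton.elim _ _
  have hb : ∀ y : V, ∃ c : Fin (m + 1) → ℝ, y = ∑ i, c i • o i := fun y => by
    let B := basisOfLinearIndependentOfCardEqFinrank hli (by simp [hm])
    refine ⟨fun i => B.repr y i, ?_⟩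
    conv_lhs => rw [← B.sum_repr y]
    simp [B]
  obtain ⟨c, rfl⟩ := hb x
  refine Finset.sum_congr rfl fun i _ => ?_
  congr 1
  simp only [map_sum, map_smul, sum_inner, inner_smul_left]
  have := fun j => ho j i
  simp only at this
  simp [this]

theorem IsOrthonormalTuple.sum_inner_mul {m : ℕ} {e : V →ₗ[ℝ] E} {o : Fin m → V}
    (ho : IsOrthonormalTuple (fun x y => ⟪e x, e y⟫) o) (hm : Module.finrank ℝ V = m)
    [FiniteDimensional ℝ V] (x y : V) :
    ∑ i, ⟪e x, e (o i)⟫ * ⟪e (o i), e y⟫ = ⟪e x, e y⟫ := by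
  conv_rhs => rw [← ho.sum_smul hm x]
  simp [sum_inner, inner_smul_left]

theorem IsOrthonormalTuple.sum_bilinear {m : ℕ} {e : V →ₗ[ℝ] E} {o : Fin m → V}
    (ho : IsOrthonormalTuple (fun x y => ⟪e x, e y⟫) o) (hm : Module.finrank ℝ V = m)
    [FiniteDimensional ℝ V] (β : V →ₗ[ℝ] V →ₗ[ℝ] ℝ) (x y : V) :
    ∑ i, ∑ j, β (o i) (o j) * (⟪e x, e (o i)⟫ * ⟪e y, e (o j)⟫) = β x y := by
  conv_rhs => rw [← ho.sum_smul hm x, ← ho.sum_smul hm y]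
  simp only [map_sum, map_smul, LinearMap.sum_apply, LinearMap.smul_apply, smul_eq_mul,
    Finset.mul_sum]
  rw [Finset.sum_comm]
  exact Finset.sum_congr rfl fun i _ => Finset.sum_congr rfl fun j _ => by ring

theorem exists_isOrthonormalTuple {m : ℕ} {e : V →ₗ[ℝ] E} (he : Function.Injective e)
    (hm : Module.finrank ℝ V = m) [FiniteDimensional ℝ V] :
    ∃ o : Fin m → V, IsOrthonormalTuple (fun x y => ⟪e x, e y⟫) o := by
  have h1 : Module.finrank ℝ (LinearMap.range e) = m := by
    rw [LinearMap.finrank_range_of_inj he, hm]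
  let b := (stdOrthonormalBasis ℝ (LinearMap.range e)).reindex (finCongr h1)
  choose o ho using fun i => (b i).2
  refine ⟨o, fun i j => ?_⟩
  simp only [ho]
  exact orthonormal_iff_ite.1 b.orthonormal i j

theorem isOrthonormalTuple_orthoBasis {m : ℕ} {e : V →ₗ[ℝ] E} (he : Function.Injective e)
    (hm : Module.finrank ℝ V = m) [FiniteDimensional ℝ V] :
    IsOrthonormalTuple (fun x y => ⟪e x, e y⟫) (orthoBasis m fun x y => ⟪e x, e y⟫) :=
  Classical.epsilon_spec (exists_isOrthonormalTuple he hm)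

theorem sum_fin_succ_fun {α : Type*} [Fintype α] {n : ℕ} (F : (Fin (n + 1) → α) → ℝ) :
    ∑ f, F f = ∑ a, ∑ f : Fin n → α, F (Matrix.vecCons a f) := by
  rw [← (Fin.consEquiv fun _ => α).sum_comp, Fintype.sum_prod_type]
  rfl

omit [Module ℝ V] in
theorem formInner_two (m : ℕ) (g : V → V → ℝ) (a b : (Fin 2 → V) → ℝ) :
    formInner m g a b = 1 / 2 * ∑ i, ∑ j, a ![orthoBasis m g i, orthoBasis m g j] *
      b ![orthoBasis m g i, orthoBasis m g j] := by
  have hv : ∀ i j : Fin m, (fun s => orthoBasis m g ((![i, j] : Fin 2 → Fin m) s)) =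
      ![orthoBasis m g i, orthoBasis m g j] := fun i j => by ext s; fin_cases s <;> rfl
  simp only [formInner, sum_fin_succ_fun, Fintype.sum_unique, ← hv]
  norm_num [Nat.factorial]
  rfl

omit [Module ℝ V] in
theorem formInner_three (m : ℕ) (g : V → V → ℝ) (a b : (Fin 3 → V) → ℝ) :
    formInner m g a b = 1 / 6 * ∑ i, ∑ j, ∑ k,
      a ![orthoBasis m g i, orthoBasis m g j, orthoBasis m g k] *
      b ![orthoBasis m g i, orthoBasis m g j, orthoBasis m g k] := by
  have hv : ∀ i j k : Fin m, (fun s => orthoBasis m g ((![i, j, k] : Fin 3 → Fin m) s)) =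
      ![orthoBasis m g i, orthoBasis m g j, orthoBasis m g k] := fun i j k => by
    ext s; fin_cases s <;> rfl
  simp only [formInner, sum_fin_succ_fun, Fintype.sum_unique, ← hv]
  norm_num [Nat.factorial]
  rfl

end OrthonormalTuples
section HyperplaneModules

open scoped RealInnerProductSpace

variable {E : Type*} [NormedAddCommGroup E] [InnerProductSpace ℝ E]
  {V : Type*} [AddCommGroup V] [Module ℝ V]

/-- The tensor `Φ(b x, y, z)`, where `Φ` is the three-form of the cross product. -/
def phiTensor (P : E →L[ℝ] E →L[ℝ] E) (e : V →ₗ[ℝ] E) (b : V →ₗ[ℝ] V) :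
    V →ₗ[ℝ] V →ₗ[ℝ] V →ₗ[ℝ] ℝ :=
  LinearMap.mk₂ ℝ (fun x y => innerₗ E (P (e (b x)) (e y)) ∘ₗ e)
    (fun x y z => by ext; simp) (fun c x y => by ext; simp)
    (fun x y z => by ext; simp) (fun c x y => by ext; simp)

theorem phiTensor_apply (P : E →L[ℝ] E →L[ℝ] E) (e : V →ₗ[ℝ] E) (b : V →ₗ[ℝ] V) (x y z : V) :
    phiTensor P e b x y z = ⟪P (e (b x)) (e y), e z⟫ := rfl

theorem phiTensor_add (P : E →L[ℝ] E →L[ℝ] E) (e : V →ₗ[ℝ] E) (b c : V →ₗ[ℝ] V) :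
    phiTensor P e (b + c) = phiTensor P e b + phiTensor P e c := by
  ext x y z
  simp [phiTensor_apply, inner_add_left]

theorem phiTensor_smul (P : E →L[ℝ] E →L[ℝ] E) (e : V →ₗ[ℝ] E) (r : ℝ) (b : V →ₗ[ℝ] V) :
    phiTensor P e (r • b) = r • phiTensor P e b := by
  ext x y z
  simp [phiTensor_apply, inner_smul_left]

namespace IsComplexHyperplane

variable {P : E →L[ℝ] E →L[ℝ] E} {e : V →ₗ[ℝ] E} {ν : E} {I : V →ₗ[ℝ] V}
  (h : IsComplexHyperplane P e ν I)
include h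

theorem phiTensor_mem_spaceW (b : V →ₗ[ℝ] V) : phiTensor P e b ∈ spaceW (I : V → V) := by
  refine ⟨fun x y z => ?_, fun x y z => ?_⟩
  · exact h.cross.inner_right_swap _ _ _
  · simp only [phiTensor_apply]
    rw [h.phi_I_I_right, neg_neg]

variable [FiniteDimensional ℝ V] (hm : Module.finrank ℝ V = 6) {o : Fin 6 → V}
  (ho : IsOrthonormalTuple (fun x y => ⟪e x, e y⟫) o)
include hm ho

theorem sum_phi_mul_phi (w u y v : V) :
    ∑ j, ⟪P (e w) (e u), e (o j)⟫ * ⟪P (e y) (e v), e (o j)⟫ =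
      ⟪e w, e y⟫ * ⟪e u, e v⟫ - ⟪e w, e v⟫ * ⟪e u, e y⟫
      - ⟪e w, e (I y)⟫ * ⟪e u, e (I v)⟫ + ⟪e w, e (I v)⟫ * ⟪e u, e (I y)⟫ := by
  choose t ht using fun i j => h.exists_tangential (P (e i) (e j))
  have h1 : ∀ w u z, ⟪P (e w) (e u), e z⟫ = ⟪e (t w u), e z⟫ := fun w u z => by
    have h2 := h.inner_cross_eq t ht (e z) w u
    rw [real_inner_comm ν, h.orthogonal] at h2
    rw [real_inner_comm, h2, real_inner_comm]
    ring
  have h2 : ∑ j, ⟪P (e w) (e u), e (o j)⟫ * ⟪P (e y) (e v), e (o j)⟫ =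
      ⟪P (e w) (e u), e (t y v)⟫ := by
    simp only [h1]
    rw [← ho.sum_inner_mul hm]
    exact Finset.sum_congr rfl fun j _ => by rw [real_inner_comm (e (t y v))]
  have h3 := h.inner_cross_eq t ht (P (e w) (e u)) y v
  rw [h.inner_cross_normal, h.inner_cross_cross] at h3
  rw [h2]
  linarith

omit h hm [FiniteDimensional ℝ V] in
theorem sum_inner_self : ∑ i, ⟪e (o i), e (o i)⟫ = 6 := by
  have : ∀ i, ⟪e (o i), e (o i)⟫ = 1 := fun i => by simpa using ho i i
  simp only [this]
  simp

theorem sum_inner_I_mul (x y : V) : ∑ i, ⟪e x, e (I (o i))⟫ * ⟪e (o i), e y⟫ =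
    - ⟪e (I x), e y⟫ := by
  rw [← ho.sum_inner_mul hm (I x) y, ← Finset.sum_neg_distrib]
  exact Finset.sum_congr rfl fun i _ => by rw [h.inner_I_left]; ring

theorem sum_sum_phi_mul_phi (w y : V) :
    ∑ i, ∑ j, ⟪P (e w) (e (o i)), e (o j)⟫ * ⟪P (e y) (e (o i)), e (o j)⟫ = 4 * ⟪e w, e y⟫ := by
  simp only [h.sum_phi_mul_phi hm ho, Finset.sum_add_distrib, Finset.sum_sub_distrib,
    ← Finset.mul_sum, sum_inner_self ho, h.inner_I_self, ho.sum_inner_mul hm,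
    h.sum_inner_I_mul hm ho, h.inner_I_I]
  simp
  ring

theorem bilinear_eq_zero (β : V →ₗ[ℝ] V →ₗ[ℝ] ℝ) (hs : ∀ u v, β u v = - β v u)
    (hβ : ∀ u v, β (I u) (I v) = - β u v)
    (h0 : ∀ y, ∑ i, ∑ j, β (o i) (o j) * ⟪P (e y) (e (o i)), e (o j)⟫ = 0) (u v : V) :
    β u v = 0 := by
  obtain ⟨t, ht⟩ := h.exists_tangential (P (e u) (e v))
  have hsk : ∀ x y : V, ⟪e x, e (I y)⟫ = - ⟪e (I x), e y⟫ := fun x y => by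
    rw [h.inner_I_left, neg_neg]
  have h1 : ∀ i j, ⟪P (e t) (e (o i)), e (o j)⟫ =
      ⟪e u, e (o i)⟫ * ⟪e v, e (o j)⟫ - ⟪e v, e (o i)⟫ * ⟪e u, e (o j)⟫
      - ⟪e (I u), e (o i)⟫ * ⟪e (I v), e (o j)⟫ + ⟪e (I v), e (o i)⟫ * ⟪e (I u), e (o j)⟫ := by
    intro i j
    rw [h.cross.inner_cycle, real_inner_comm, ht, inner_sub_left, inner_smul_left,
      h.inner_cross_cross, real_inner_comm _ ν, real_inner_comm _ ν, h.inner_cross_normal,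
      h.inner_cross_normal, hsk u (o i), hsk v (o j), hsk v (o i), hsk u (o j)]
    simp only [conj_trivial]
    ring
  have h2 := h0 t
  simp only [h1, mul_add, mul_sub, Finset.sum_add_distrib, Finset.sum_sub_distrib,
    ho.sum_bilinear hm, hβ] at h2
  linarith [hs u v]

omit ho in
theorem rSix_phiTensor {J : V →ₗ[ℝ] V} {ψp : (Fin 3 → V) → ℝ}
    (hψ : ∀ v, ψp v = ⟪P (e (J (v 0))) (e (v 1)), e (v 2)⟫) (b : V →ₗ[ℝ] V) (x y : V) :
    rSix (fun x y => ⟪e x, e y⟫) ψp (phiTensor P e b) x y = ⟪e (b x), e (J y)⟫ := by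
  have ho := isOrthonormalTuple_orthoBasis h.injective hm
  simp only [rSix, formInner_two, interiorProd, hψ, phiTensor_apply, Matrix.cons_val]
  rw [h.sum_sum_phi_mul_phi hm ho]
  ring

omit ho in
theorem eq_zero_of_rSix_eq_zero {J : V →ₗ[ℝ] V} (hJ : Function.Surjective J)
    {ψp : (Fin 3 → V) → ℝ} (hψ : ∀ v, ψp v = ⟪P (e (J (v 0))) (e (v 1)), e (v 2)⟫)
    {a : V →ₗ[ℝ] V →ₗ[ℝ] V →ₗ[ℝ] ℝ} (ha : a ∈ spaceW (I : V → V))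
    (h0 : ∀ x y, rSix (fun x y => ⟪e x, e y⟫) ψp a x y = 0) : a = 0 := by
  have ho := isOrthonormalTuple_orthoBasis h.injective hm
  ext x u v
  refine h.bilinear_eq_zero hm ho (a x) (ha.1 x) (fun u v => ?_) (fun y => ?_) u v
  · linarith [ha.2 x u v]
  · obtain ⟨z, rfl⟩ := hJ y
    have := h0 x z
    simp only [rSix, formInner_two, interiorProd, hψ, Matrix.cons_val] at this
    linarith

omit ho in
theorem phiTensor_eq_zero {b : V →ₗ[ℝ] V} (hb : phiTensor P e b = 0) : b = 0 := by
  ext x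
  refine h.eq_of_inner _ _ fun z => ?_
  have h1 := h.rSix_phiTensor (J := LinearMap.id) hm (fun _ => rfl) b x z
  rw [hb] at h1
  simpa [rSix, formInner_two] using h1.symm

/-- The derivation of the three-form by a symmetric, trace free, complex linear endomorphism
vanishes. -/
theorem phi_derivation_eq_zero {b : V →ₗ[ℝ] V} (hsym : ∀ x y, ⟪e (b x), e y⟫ = ⟪e x, e (b y)⟫)
    (hbI : ∀ x, b (I x) = I (b x)) (htr : ∑ i, ⟪e (b (o i)), e (o i)⟫ = 0) (x y z : V) :
    ⟪P (e (b x)) (e y), e z⟫ + ⟪P (e x) (e (b y)), e z⟫ + ⟪P (e x) (e y), e (b z)⟫ = 0 := by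
  refine h.bilinear_eq_zero hm ho (phiTensor P e b x + (phiTensor P e LinearMap.id x).comp b
    + (phiTensor P e LinearMap.id x).compl₂ b) (fun u v => ?_) (fun u v => ?_) (fun y => ?_) y z
  · simp only [LinearMap.add_apply, LinearMap.comp_apply, LinearMap.compl₂_apply, phiTensor_apply,
      LinearMap.id_apply]
    rw [h.cross.inner_right_swap _ (e u), h.cross.inner_right_swap _ (e (b u)),
      h.cross.inner_right_swap _ (e u) (e (b v))]
    ring
  · simp only [LinearMap.add_apply, LinearMap.comp_apply, LinearMap.compl₂_apply, phiTensor_apply,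
      LinearMap.id_apply, hbI, h.phi_I_I_right]
    ring
  · have hII : ∀ i, ⟪e (b (o i)), e (I (o i))⟫ = 0 := fun i => by
      have h1 := h.inner_I_left (o i) (b (o i))
      rw [← hbI, real_inner_comm] at h1
      linarith [hsym (o i) (I (o i))]
    have hc : ∑ i, ∑ j, ⟪P (e x) (e (o i)), e (b (o j))⟫ * ⟪P (e y) (e (o i)), e (o j)⟫ =
        ∑ i, ∑ j, ⟪P (e x) (e (b (o i))), e (o j)⟫ * ⟪P (e y) (e (o i)), e (o j)⟫ := by
      rw [Finset.sum_comm]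
      refine Finset.sum_congr rfl fun j _ => Finset.sum_congr rfl fun i _ => ?_
      rw [h.cross.inner_right_swap, h.cross.inner_right_swap (e y)]
      ring
    simp only [LinearMap.add_apply, LinearMap.comp_apply, LinearMap.compl₂_apply, phiTensor_apply,
      LinearMap.id_apply, add_mul, Finset.sum_add_distrib, hc, h.sum_sum_phi_mul_phi hm ho]
    simp only [hsym] at htr
    simp only [h.sum_phi_mul_phi hm ho, Finset.sum_add_distrib, Finset.sum_sub_distrib,
      ← Finset.mul_sum, htr, hII, hsym, ho.sum_inner_mul hm, h.sum_inner_I_mul hm ho, hbI,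
      h.inner_I_I]
    simp
    ring

end IsComplexHyperplane
end HyperplaneModules

section HyperplaneModules

open scoped RealInnerProductSpace

theorem Submodule.mem_sup_four_iff {W : Type*} [AddCommGroup W] [Module ℝ W]
    {U₁ U₂ U₃ U₄ V₁ V₂ V₃ V₄ : Submodule ℝ W}
    (hU : ∀ x₁ ∈ U₁, ∀ x₂ ∈ U₂, ∀ x₃ ∈ U₃, ∀ x₄ ∈ U₄, x₁ + x₂ + x₃ + x₄ = 0 →
      x₁ = 0 ∧ x₂ = 0 ∧ x₃ = 0 ∧ x₄ = 0)
    (h₁ : V₁ ≤ U₁) (h₂ : V₂ ≤ U₂) (h₃ : V₃ ≤ U₃) (h₄ : V₄ ≤ U₄) {x₁ x₂ x₃ x₄ : W}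
    (hx₁ : x₁ ∈ U₁) (hx₂ : x₂ ∈ U₂) (hx₃ : x₃ ∈ U₃) (hx₄ : x₄ ∈ U₄) :
    x₁ + x₂ + x₃ + x₄ ∈ V₁ ⊔ V₂ ⊔ V₃ ⊔ V₄ ↔ x₁ ∈ V₁ ∧ x₂ ∈ V₂ ∧ x₃ ∈ V₃ ∧ x₄ ∈ V₄ := by
  constructor
  · intro hx
    obtain ⟨y, hy, y₄, hy₄, e₁⟩ := Submodule.mem_sup.1 hx
    obtain ⟨z, hz, y₃, hy₃, e₂⟩ := Submodule.mem_sup.1 hy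
    obtain ⟨y₁, hy₁, y₂, hy₂, e₃⟩ := Submodule.mem_sup.1 hz
    obtain ⟨r₁, r₂, r₃, r₄⟩ := hU _ (U₁.sub_mem hx₁ (h₁ hy₁)) _ (U₂.sub_mem hx₂ (h₂ hy₂))
      _ (U₃.sub_mem hx₃ (h₃ hy₃)) _ (U₄.sub_mem hx₄ (h₄ hy₄)) (by
        rw [← sub_eq_zero] at e₁
        rw [← e₃] at e₂
        rw [← e₂, ← neg_eq_zero] at e₁
        rw [← e₁]; abel)
    rw [sub_eq_zero] at r₁ r₂ r₃ r₄
    subst r₁ r₂ r₃ r₄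
    exact ⟨hy₁, hy₂, hy₃, hy₄⟩
  · rintro ⟨m₁, m₂, m₃, m₄⟩
    exact Submodule.add_mem_sup (Submodule.add_mem_sup (Submodule.add_mem_sup m₁ m₂) m₃) m₄

theorem spaceW1_cycle {V : Type*} [AddCommGroup V] [Module ℝ V] {J : V → V}
    {a : V →ₗ[ℝ] V →ₗ[ℝ] V →ₗ[ℝ] ℝ} (ha : a ∈ spaceW1 J)
    (x y z : V) : a y z x = a x y z := by
  have := ha.2 (x + y) z
  simp only [map_add, LinearMap.add_apply] at this
  linarith [ha.1.1 y z x, ha.2 x z, ha.2 y z]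

theorem spaceW1_map_map {V : Type*} [AddCommGroup V] [Module ℝ V] {J : V → V}
    {a : V →ₗ[ℝ] V →ₗ[ℝ] V →ₗ[ℝ] ℝ} (ha : a ∈ spaceW1 J) (x y z : V) :
    a (J x) (J y) z = - a x y z := by
  rw [spaceW1_cycle ha z (J x) (J y)]
  linarith [ha.1.2 z x y, spaceW1_cycle ha z x y]

variable {E : Type*} [NormedAddCommGroup E] [InnerProductSpace ℝ E]
  {V : Type*} [AddCommGroup V] [Module ℝ V]

namespace IsComplexHyperplane

variable {P : E →L[ℝ] E →L[ℝ] E} {e : V →ₗ[ℝ] E} {ν : E} {I : V →ₗ[ℝ] V}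
  (h : IsComplexHyperplane P e ν I)
include h

theorem spaceW_I_mid {a : V →ₗ[ℝ] V →ₗ[ℝ] V →ₗ[ℝ] ℝ} (ha : a ∈ spaceW (I : V → V)) (x y z : V) :
    a x (I y) z = a x y (I z) := by
  have := ha.2 x y (I z)
  rw [h.I_I, map_neg, neg_neg] at this
  exact this.symm

theorem spaceW2_I_I {a : V →ₗ[ℝ] V →ₗ[ℝ] V →ₗ[ℝ] ℝ} (ha : a ∈ spaceW2 (I : V → V)) (x y z : V) :
    a (I x) (I y) z = - a x y z := by
  have h0 := ha.2 x y z
  have h1 := ha.2 (I x) (I y) z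
  have h2 := ha.2 (I x) y (I z)
  have h3 := ha.2 x (I y) (I z)
  have e1 := h.spaceW_I_mid ha.1 (I x) y z
  have e2 := h.spaceW_I_mid ha.1 (I y) z x
  have e3 := h.spaceW_I_mid ha.1 (I z) x y
  linarith [ha.1.2 x y z, ha.1.2 y z x, ha.1.2 z x y]

variable [FiniteDimensional ℝ V] (hm : Module.finrank ℝ V = 6) {J : V →ₗ[ℝ] V}
  {ψp : (Fin 3 → V) → ℝ} {ε : ℝ}
  (hψ : ∀ v, ψp v = ⟪P (e (J (v 0))) (e (v 1)), e (v 2)⟫)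
  (hJ : (J = LinearMap.id ∧ ε = 1) ∨ (J = I ∧ ε = -1))
include hm hψ hJ

set_option maxSynthPendingDepth 3 in
theorem modules_independent (x₁ : V →ₗ[ℝ] V →ₗ[ℝ] V →ₗ[ℝ] ℝ)
    (h₁ : x₁ ∈ spaceW1Sign (fun x y => ⟪e x, e y⟫) I ψp ε) (x₂ : V →ₗ[ℝ] V →ₗ[ℝ] V →ₗ[ℝ] ℝ)
    (h₂ : x₂ ∈ spaceW1Sign (fun x y => ⟪e x, e y⟫) I ψp (-ε)) (x₃ : V →ₗ[ℝ] V →ₗ[ℝ] V →ₗ[ℝ] ℝ)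
    (h₃ : x₃ ∈ spaceW2Sign (fun x y => ⟪e x, e y⟫) I ψp ε) (x₄ : V →ₗ[ℝ] V →ₗ[ℝ] V →ₗ[ℝ] ℝ)
    (h₄ : x₄ ∈ spaceW3 (fun x y => ⟪e x, e y⟫) I) (hs : x₁ + x₂ + x₃ + x₄ = 0) :
    x₁ = 0 ∧ x₂ = 0 ∧ x₃ = 0 ∧ x₄ = 0 := by
  have hs' : ∀ x y z, x₁ x y z + x₂ x y z + x₃ x y z + x₄ x y z = 0 := fun x y z => by
    rw [← LinearMap.add_apply, ← LinearMap.add_apply, ← LinearMap.add_apply, ← LinearMap.add_apply,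
      ← LinearMap.add_apply, ← LinearMap.add_apply, ← LinearMap.add_apply, ← LinearMap.add_apply,
      ← LinearMap.add_apply, hs]
    rfl
  have z₄ : x₄ = 0 := by
    ext x y z
    have e1 := hs' (I x) (I y) z
    rw [spaceW1_map_map h₁.1, spaceW1_map_map h₂.1, h.spaceW2_I_I h₃.1, ← h₄.2.1] at e1
    have e2 := hs' x y z
    simp only [LinearMap.zero_apply]
    linarith
  subst z₄
  have z₃ : x₃ = 0 := by
    ext x y z
    have e1 := hs' x y z
    have e2 := hs' y z x
    have e3 := hs' z x y
    have e4 := h₃.1.2 x y z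
    rw [spaceW1_cycle h₁.1 x y z, spaceW1_cycle h₂.1 x y z] at e2
    rw [← spaceW1_cycle h₁.1 z x y, ← spaceW1_cycle h₂.1 z x y] at e3
    simp only [LinearMap.zero_apply] at e1 e2 e3 ⊢
    linarith
  subst z₃
  have z₂ : x₂ = - x₁ := by
    rw [add_zero, add_zero] at hs
    exact (neg_eq_of_add_eq_zero_right hs).symm
  subst z₂
  have z₁ : x₁ = 0 := by
    have hJs : Function.Surjective J := by
      rcases hJ with ⟨rfl, -⟩ | ⟨rfl, -⟩
      · exact fun x => ⟨x, rfl⟩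
      · exact fun x => ⟨- J x, by rw [map_neg, h.I_I, neg_neg]⟩
    refine h.eq_zero_of_rSix_eq_zero hm hJs hψ h₁.1.1 fun x y => ?_
    have e1 := h₁.2 y x
    have e2 := (Submodule.neg_mem_iff _).1 h₂.2 y x
    linarith
  simp [z₁]

theorem phiTensor_id_mem :
    phiTensor P e LinearMap.id ∈ spaceW1Sign (fun x y => ⟪e x, e y⟫) I ψp ε := by
  refine ⟨⟨h.phiTensor_mem_spaceW _, fun x z => ?_⟩, fun x y => ?_⟩
  · simp [phiTensor_apply, h.cross.self]
  · rw [h.rSix_phiTensor hm hψ, h.rSix_phiTensor hm hψ]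
    rcases hJ with ⟨rfl, rfl⟩ | ⟨rfl, rfl⟩
    · simp [real_inner_comm]
    · simp only [LinearMap.id_apply]
      rw [← real_inner_comm, h.inner_I_left]
      ring

theorem phiTensor_I_mem :
    phiTensor P e I ∈ spaceW1Sign (fun x y => ⟪e x, e y⟫) I ψp (-ε) := by
  refine ⟨⟨h.phiTensor_mem_spaceW _, fun x z => ?_⟩, fun x y => ?_⟩
  · have h1 := h.phi_I_left x x z
    rw [h.cross.inner_swap (e x)] at h1
    simp only [phiTensor_apply]
    linarith
  · rw [h.rSix_phiTensor hm hψ, h.rSix_phiTensor hm hψ]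
    rcases hJ with ⟨rfl, rfl⟩ | ⟨rfl, rfl⟩
    · simp only [LinearMap.id_apply]
      rw [← real_inner_comm, h.inner_I_left]
      ring
    · simp [real_inner_comm]

theorem phiTensor_mem_spaceW2Sign {b : V →ₗ[ℝ] V}
    (hsym : ∀ x y, ⟪e (b x), e y⟫ = ⟪e x, e (b y)⟫) (hbI : ∀ x, b (I x) = I (b x))
    {o : Fin 6 → V} (ho : IsOrthonormalTuple (fun x y => ⟪e x, e y⟫) o)
    (htr : ∑ i, ⟪e (b (o i)), e (o i)⟫ = 0) :
    phiTensor P e b ∈ spaceW2Sign (fun x y => ⟪e x, e y⟫) I ψp ε := by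
  refine ⟨⟨h.phiTensor_mem_spaceW _, fun x y z => ?_⟩, fun x y => ?_⟩
  · have h1 := h.phi_derivation_eq_zero hm ho hsym hbI htr x y z
    simp only [phiTensor_apply]
    rw [h.cross.inner_cycle (e (b z)), h.cross.inner_cycle (e (b y)),
      h.cross.inner_cycle (e z) (e x)]
    linarith
  · rw [h.rSix_phiTensor hm hψ, h.rSix_phiTensor hm hψ]
    rcases hJ with ⟨rfl, rfl⟩ | ⟨rfl, rfl⟩
    · simp only [LinearMap.id_apply]
      rw [hsym, real_inner_comm]
      ring
    · rw [hsym, hbI, ← real_inner_comm, h.inner_I_left]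
      ring

omit hψ hJ in
theorem phiTensor_mem_spaceW3 {b : V →ₗ[ℝ] V}
    (hsym : ∀ x y, ⟪e (b x), e y⟫ = ⟪e x, e (b y)⟫) (hbI : ∀ x, b (I x) = - I (b x)) :
    phiTensor P e b ∈ spaceW3 (fun x y => ⟪e x, e y⟫) I := by
  have ho := isOrthonormalTuple_orthoBasis h.injective hm
  refine ⟨h.phiTensor_mem_spaceW _, fun x y z => ?_, fun z => ?_⟩
  · simp only [phiTensor_apply, hbI, map_neg, neg_apply, inner_neg_left, h.phi_I_I_left]
    ring
  · set o := orthoBasis 6 fun x y => ⟪e x, e y⟫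
    have h1 : ∀ i, phiTensor P e b (o i) (o i) z =
        ∑ j, ⟪e (b (o i)), e (o j)⟫ * ⟪P (e (o j)) (e (o i)), e z⟫ := fun i => by
      conv_lhs => rw [phiTensor_apply, ← ho.sum_smul hm (b (o i))]
      simp [sum_inner, inner_smul_left]
    have h2 : ∑ i, ∑ j, ⟪e (b (o i)), e (o j)⟫ * ⟪P (e (o j)) (e (o i)), e z⟫ =
        - ∑ i, ∑ j, ⟪e (b (o i)), e (o j)⟫ * ⟪P (e (o j)) (e (o i)), e z⟫ := by
      conv_lhs => rw [Finset.sum_comm]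
      simp only [← Finset.sum_neg_distrib]
      refine Finset.sum_congr rfl fun i _ => Finset.sum_congr rfl fun j _ => ?_
      have h3 : ⟪e (b (o j)), e (o i)⟫ = ⟪e (b (o i)), e (o j)⟫ := by
        rw [hsym, real_inner_comm]
      rw [h3, h.cross.inner_swap (e (o i)) (e (o j))]
      ring
    simp only [h1]
    linarith

end IsComplexHyperplane
end HyperplaneModules

section HyperplaneTorsion

open scoped RealInnerProductSpace

variable {E : Type*} [NormedAddCommGroup E] [InnerProductSpace ℝ E]
  {V : Type*} [AddCommGroup V] [Module ℝ V]

/-- The derivation of the four-form by a skew endomorphism in terms of the derivation of the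
three-form. -/
theorem IsCrossProduct.star_derivation {P : E →L[ℝ] E →L[ℝ] E} (hP : IsCrossProduct P)
    {A : E →ₗ[ℝ] E} (hA : ∀ x y, ⟪A x, y⟫ = - ⟪x, A y⟫) {s : E}
    (hs : ∀ x y z, ⟪P (A x) y, z⟫ + ⟪P x (A y), z⟫ + ⟪P x y, A z⟫ = crossStar P s x y z)
    (w x y z : E) : crossStar P (A w) x y z + crossStar P w (A x) y z + crossStar P w x (A y) z
      + crossStar P w x y (A z) = crossStar P (P y z) w x s + crossStar P (P w x) y z s := by
  have h1 := hs w x (P y z)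
  have h2 := hs y z (P w x)
  have h3 : ∀ s w x q, crossStar P s w x q = - crossStar P q w x s := fun s w x q => by
    rw [hP.star_swap12 s, hP.star_swap23 w, hP.star_swap34 w, hP.star_swap23 w x,
      hP.star_swap12 w]
    ring
  rw [h3] at h1 h2
  have h4 := hA (P w x) (P y z)
  generalize crossStar P (P y z) w x s = r₁ at *
  generalize crossStar P (P w x) y z s = r₂ at *
  simp only [crossStar]
  rw [hA x y, hA x z, hA y w, hA z w]
  rw [real_inner_comm (P (A y) z) (P w x), real_inner_comm (P y (A z)) (P w x)]
  linarith [real_inner_comm (P y z) (A (P w x))]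

namespace IsComplexHyperplane

variable {P : E →L[ℝ] E →L[ℝ] E} {e : V →ₗ[ℝ] E} {ν : E} {I : V →ₗ[ℝ] V}
  (h : IsComplexHyperplane P e ν I)
include h

theorem exists_torsion (b : V →ₗ[ℝ] V) : ∃ T : V →ₗ[ℝ] V →ₗ[ℝ] V,
    ∀ x y, e (T x y) = (1 / 2 : ℝ) • P ν (P (e (b x)) (e y)) := by
  choose t ht using fun x y => h.exists_eq ((1 / 2 : ℝ) • P ν (P (e (b x)) (e y))) (by
    rw [inner_smul_right, real_inner_comm, h.cross.inner_cycle, h.cross.inner_swap,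
      h.cross.inner_right_swap, h.cross.self]
    simp)
  refine ⟨LinearMap.mk₂ ℝ t ?_ ?_ ?_ ?_, fun x y => ht x y⟩ <;> intros <;> apply h.injective <;>
    simp only [ht, map_add, map_smul, add_apply, smul_apply, smul_add]
  · exact smul_comm _ _ _
  · exact smul_comm _ _ _

section

variable {b : V →ₗ[ℝ] V} {T : V →ₗ[ℝ] V →ₗ[ℝ] V}
  (hT : ∀ x y, e (T x y) = (1 / 2 : ℝ) • P ν (P (e (b x)) (e y)))
include hT

theorem inner_torsion (x y z : V) :
    ⟪e (T x y), e z⟫ = - (1 / 2) * ⟪P (e (b x)) (e y), e (I z)⟫ := by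
  rw [hT, inner_smul_left, h.cross.inner_right_swap, h.map_I, real_inner_comm]
  simp

theorem torsion_skew (x y z : V) : ⟪e (T x y), e z⟫ = - ⟪e y, e (T x z)⟫ := by
  rw [real_inner_comm _ (e y), h.inner_torsion hT, h.inner_torsion hT, h.phi_I_right,
    h.cross.inner_right_swap]
  ring

theorem torsion_I (x y : V) : T x (I y) = - I (T x y) := by
  refine h.eq_of_inner _ _ fun z => ?_
  rw [map_neg, inner_neg_left, h.inner_I_left, h.inner_torsion hT, h.inner_torsion hT,
    h.phi_I_I_right, h.I_I]
  simp

theorem phi_torsion (x y z w : V) : ⟪P (e (T x y)) (e z), e w⟫ = (1 / 2) *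
    (⟪e (b x), e (I z)⟫ * ⟪e y, e w⟫ - ⟪e (b x), e w⟫ * ⟪e y, e (I z)⟫
      + ⟪e (b x), e z⟫ * ⟪e y, e (I w)⟫ - ⟪e (b x), e (I w)⟫ * ⟪e y, e z⟫) := by
  have h1 := h.cross.inner_polar ν (e z) (P (e (b x)) (e y)) (e w)
  rw [h.orthogonal, h.orthogonal, ← h.map_I, h.cross.inner_right_swap (e z),
    real_inner_comm (P (e (b x)) (e y)) (P (e z) (e (I w))), h.inner_cross_cross,
    real_inner_comm _ ν, h.inner_cross_normal] at h1
  rw [h.cross.inner_cycle, real_inner_comm, hT, inner_smul_left]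
  simp only [h.I_I, map_neg, inner_neg_right, conj_trivial] at h1 ⊢
  linarith [real_inner_comm (e z) (e w), h.inner_I_left z w]

theorem phiTensor_add_endAct_kahler (x : V) (v : Fin 2 → V) :
    phiTensor P e b x (v 0) (v 1) + endAct (T x) (kahler (fun x y => ⟪e x, e y⟫) I) v = 0 := by
  simp only [endAct, kahler, Fin.sum_univ_two, phiTensor_apply, Function.update_self, ne_eq,
    zero_ne_one, one_ne_zero, not_false_eq_true, Function.update_of_ne]
  have h1 := h.inner_torsion hT x (v 0) (I (v 1))
  have h2 := h.torsion_skew hT x (v 0) (I (v 1))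
  rw [h.torsion_I hT, map_neg, inner_neg_right] at h2
  rw [h.I_I, map_neg, inner_neg_right] at h1
  linarith

theorem trace_comp_torsion_eq_zero [FiniteDimensional ℝ V] {ψp ψm : (Fin 3 → V) → ℝ}
    {A : V →ₗ[ℝ] V} (hA : IsInSu3 (fun x y => ⟪e x, e y⟫) I ψp ψm A) (x : V) :
    LinearMap.trace ℝ V (A ∘ₗ T x) = 0 := by
  have hAI : ∀ y, A (I y) = I (A y) := fun y => by
    refine h.eq_of_inner _ _ fun z => ?_
    have h1 := hA.2.1 ![z, y]
    have h2 := hA.1 z (I y)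
    simp only [endAct, kahler, Fin.sum_univ_two, Function.update_self, ne_eq, Matrix.cons_val,
      zero_ne_one, one_ne_zero, not_false_eq_true, Function.update_of_ne] at h1 h2
    rw [real_inner_comm, real_inner_comm (e z)]
    linarith
  have h1 : A ∘ₗ T x = (A ∘ₗ T x ∘ₗ I) ∘ₗ (-I) := by
    ext y
    simp [h.I_I]
  have h2 : (-I) ∘ₗ (A ∘ₗ T x ∘ₗ I) = - (A ∘ₗ T x) := by
    ext y
    simp [← hAI, h.torsion_I hT, h.I_I]
  have h3 := LinearMap.trace_comp_comm' (R := ℝ) (-I) (A ∘ₗ T x ∘ₗ I)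
  rw [h2, ← h1, map_neg] at h3
  linarith

/-- The tangential three-form is annihilated by the connection with torsion `T`. -/
theorem phi_parallel {A : V →ₗ[ℝ] V} {κ : ℝ} (hb : ∀ x, b x = A x - κ • I x) (x y z w : V) :
    κ * crossStar P (e x) (e y) (e z) (e w) + ⟪e (A x), e y⟫ * ⟪P ν (e z), e w⟫
      + ⟪e (A x), e z⟫ * ⟪P (e y) ν, e w⟫ + ⟪e (A x), e w⟫ * ⟪P (e y) (e z), ν⟫
      = ⟪P (e (T x y)) (e z), e w⟫ + ⟪P (e y) (e (T x z)), e w⟫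
        + ⟪P (e y) (e z), e (T x w)⟫ := by
  rw [h.cross.inner_cycle (e y) (e (T x z)), h.cross.inner_cycle (e y) (e z) (e (T x w)),
    h.cross.inner_cycle (e z) (e (T x w)), h.phi_torsion hT, h.phi_torsion hT, h.phi_torsion hT,
    h.star_tangential, h.cross.swap (e y) ν, ← h.map_I, ← h.map_I, h.inner_cross_normal, hb]
  simp only [map_sub, map_smul, inner_sub_left, inner_smul_left, inner_neg_left, conj_trivial,
    h.inner_I_left, h.I_I, map_neg, inner_neg_right]
  have hsw : ∀ x y, ⟪e x, e (I y)⟫ = - ⟪e y, e (I x)⟫ := fun x y => by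
    rw [← h.inner_I_left, real_inner_comm]
  rw [real_inner_comm (e w) (e z), real_inner_comm (e y) (e z), real_inner_comm (e y) (e w),
    hsw z y, hsw w z, hsw w y]
  ring

/-- The tangential part of the contracted four-form is annihilated by the connection with torsion
`T`. -/
theorem star_parallel {A : V →ₗ[ℝ] V} {κ : ℝ} (hb : ∀ x, b x = A x - κ • I x) (x y z w : V) :
    κ * (crossStar P (P (e z) (e w)) ν (e y) (e x) + crossStar P (P ν (e y)) (e z) (e w) (e x))
      - crossStar P (e (A x)) (e y) (e z) (e w)
      = crossStar P ν (e (T x y)) (e z) (e w) + crossStar P ν (e y) (e (T x z)) (e w)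
        + crossStar P ν (e y) (e z) (e (T x w)) := by
  have hTI : ∀ y, e (I (T x y)) = - e (T x (I y)) := fun y => by
    rw [h.torsion_I hT, map_neg, neg_neg]
  have hν : ∀ x, ⟪e x, ν⟫ = 0 := fun x => by rw [real_inner_comm, h.orthogonal]
  have hsw : ∀ x y, ⟪e x, e (I y)⟫ = - ⟪e y, e (I x)⟫ := fun x y => by
    rw [← h.inner_I_left, real_inner_comm]
  rw [h.star_normal, h.star_normal, h.star_normal, h.phi_I_left y (T x z),
    h.phi_I_left y z, ← h.phi_I_right y z, hTI, hTI, hTI, h.cross.inner_cycle (e y) (- _),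
    h.cross.inner_cycle (e y) (e z) (- _), h.cross.inner_cycle (e z) (- _), h.star_tangential,
    h.cross.star_cross, h.cross.star_cross]
  simp only [map_neg, neg_apply, inner_neg_left, h.phi_torsion hT, hν, h.orthogonal,
    ← h.map_I, h.inner_cross_normal, hb]
  simp only [h.cross.swap _ ν, ← h.map_I, map_sub, map_smul, inner_sub_left, inner_smul_left,
    inner_neg_left, conj_trivial, h.inner_I_left, h.I_I, map_neg, inner_neg_right]
  rw [real_inner_comm (e w) (e z), real_inner_comm (e y) (e z), real_inner_comm (e y) (e w),
    real_inner_comm (e x) (e y), real_inner_comm (e x) (e z), real_inner_comm (e x) (e w),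
    hsw z y, hsw w z, hsw w y, hsw z x]
  ring

end

end IsComplexHyperplane
end HyperplaneTorsion

section HyperplaneTypes

open scoped RealInnerProductSpace

variable {E : Type*} [NormedAddCommGroup E] [InnerProductSpace ℝ E]
  {V : Type*} [AddCommGroup V] [Module ℝ V]

namespace IsComplexHyperplane

variable {P : E →L[ℝ] E →L[ℝ] E} {e : V →ₗ[ℝ] E} {ν : E} {I : V →ₗ[ℝ] V}
  (h : IsComplexHyperplane P e ν I)
include h

variable [FiniteDimensional ℝ V] (hm : Module.finrank ℝ V = 6)
include hm

theorem sum_inner_I_I {o : Fin 6 → V} (ho : IsOrthonormalTuple (fun x y => ⟪e x, e y⟫) o)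
    (A : V →ₗ[ℝ] V) :
    ∑ i, ⟪e (A (I (o i))), e (I (o i))⟫ = ∑ i, ⟪e (A (o i)), e (o i)⟫ := by
  have h1 : ∀ x y, ⟪e (A x), e y⟫ =
      ∑ i, ∑ j, ⟪e (A (o i)), e (o j)⟫ * (⟪e x, e (o i)⟫ * ⟪e y, e (o j)⟫) := fun x y =>
    (ho.sum_bilinear hm (((innerₗ E).comp (e ∘ₗ A)).compl₂ e) x y).symm
  have h2 : ∀ k i j, ⟪e (I (o k)), e (o i)⟫ * ⟪e (I (o k)), e (o j)⟫ =
      ⟪e (I (o i)), e (o k)⟫ * ⟪e (o k), e (I (o j))⟫ := fun k i j => by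
    rw [h.inner_I_left (o i), h.inner_I_left (o k) (o j), real_inner_comm (e (I (o k)))]
    ring
  simp_rw [h1 (I (o _)) (I (o _)), h2]
  rw [Finset.sum_comm]
  have h3 : ∀ i j, ⟪e (o i), e (o j)⟫ = if i = j then (1 : ℝ) else 0 := fun i j => ho i j
  refine Finset.sum_congr rfl fun i _ => ?_
  rw [Finset.sum_comm]
  simp only [← Finset.mul_sum, ho.sum_inner_mul hm, h.inner_I_I, h3]
  simp

variable {J : V →ₗ[ℝ] V} {ψp : (Fin 3 → V) → ℝ} {ε : ℝ}
  (hψ : ∀ v, ψp v = ⟪P (e (J (v 0))) (e (v 1)), e (v 2)⟫)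
  (hJ : (J = LinearMap.id ∧ ε = 1) ∨ (J = I ∧ ε = -1))
include hψ hJ

set_option maxSynthPendingDepth 3 in
open scoped Classical in
/-- The modules to which the tensor `Φ((A - κ I) x, y, z)` belongs, for a symmetric `A`. -/
theorem phiTensor_mem_sup_iff {A : V →ₗ[ℝ] V} (hA : ∀ x y, ⟪e (A x), e y⟫ = ⟪e x, e (A y)⟫)
    (κ : ℝ) {μ : ℝ} {o : Fin 6 → V} (ho : IsOrthonormalTuple (fun x y => ⟪e x, e y⟫) o)
    (hμ : μ = 1 / 6 * ∑ i, ⟪e (A (o i)), e (o i)⟫) (p₁ p₂ p₃ p₄ : Prop) :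
    phiTensor P e (A - κ • I) ∈
      (if p₁ then spaceW1Sign (fun x y => ⟪e x, e y⟫) I ψp ε else ⊥) ⊔
      (if p₂ then spaceW1Sign (fun x y => ⟪e x, e y⟫) I ψp (-ε) else ⊥) ⊔
      (if p₃ then spaceW2Sign (fun x y => ⟪e x, e y⟫) I ψp ε else ⊥) ⊔
      (if p₄ then spaceW3 (fun x y => ⟪e x, e y⟫) I else ⊥) ↔
    (p₁ ∨ μ = 0) ∧ (p₂ ∨ κ = 0) ∧
      (p₃ ∨ ∀ x y, ⟪e (A x), e y⟫ + ⟪e (A (I x)), e (I y)⟫ = 2 * μ * ⟪e x, e y⟫) ∧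
      (p₄ ∨ ∀ x y, ⟪e (A (I x)), e (I y)⟫ = ⟪e (A x), e y⟫) := by
  set b₂ : V →ₗ[ℝ] V := (1 / 2 : ℝ) • (A - I ∘ₗ A ∘ₗ I) - μ • LinearMap.id with hb₂
  set b₃ : V →ₗ[ℝ] V := (1 / 2 : ℝ) • (A + I ∘ₗ A ∘ₗ I) with hb₃
  have e₂ : ∀ x y, ⟪e (b₂ x), e y⟫ =
      (⟪e (A x), e y⟫ + ⟪e (A (I x)), e (I y)⟫) / 2 - μ * ⟪e x, e y⟫ := fun x y => by
    simp only [hb₂, LinearMap.sub_apply, LinearMap.smul_apply, LinearMap.comp_apply,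
      LinearMap.id_apply, map_sub, map_smul, inner_sub_left, inner_smul_left, conj_trivial,
      h.inner_I_left]
    ring
  have e₃ : ∀ x y, ⟪e (b₃ x), e y⟫ =
      (⟪e (A x), e y⟫ - ⟪e (A (I x)), e (I y)⟫) / 2 := fun x y => by
    simp only [hb₃, LinearMap.add_apply, LinearMap.smul_apply, LinearMap.comp_apply,
      map_add, map_smul, inner_add_left, inner_smul_left, conj_trivial, h.inner_I_left]
    ring
  have hsum : A - κ • I = μ • LinearMap.id + (-κ) • I + b₂ + b₃ := by
    rw [hb₂, hb₃]
    module
  have m₁ := Submodule.smul_mem _ μ (h.phiTensor_id_mem hm hψ hJ)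
  have m₂ := Submodule.smul_mem _ (-κ) (h.phiTensor_I_mem hm hψ hJ)
  have m₃ : phiTensor P e b₂ ∈ spaceW2Sign (fun x y => ⟪e x, e y⟫) I ψp ε := by
    refine h.phiTensor_mem_spaceW2Sign hm hψ hJ (fun x y => ?_) (fun x => ?_) ho ?_
    · rw [e₂, real_inner_comm (e (b₂ y)), e₂, hA, hA, real_inner_comm (e (A y)),
        real_inner_comm (e (A (I y))), real_inner_comm (e y)]
    · refine h.eq_of_inner _ _ fun z => ?_
      rw [e₂, h.inner_I_left (b₂ x), e₂, h.I_I, h.I_I, h.inner_I_left x]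
      simp only [map_neg, inner_neg_left, inner_neg_right]
      ring
    · simp only [e₂, Finset.sum_sub_distrib, ← Finset.sum_div, Finset.sum_add_distrib,
        h.sum_inner_I_I hm ho, ← Finset.mul_sum, sum_inner_self ho, hμ]
      ring
  have m₄ : phiTensor P e b₃ ∈ spaceW3 (fun x y => ⟪e x, e y⟫) I := by
    refine h.phiTensor_mem_spaceW3 hm (fun x y => ?_) (fun x => ?_)
    · rw [e₃, real_inner_comm (e (b₃ y)), e₃, hA, hA, real_inner_comm (e (A y)),
        real_inner_comm (e (A (I y)))]
    · refine h.eq_of_inner _ _ fun z => ?_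
      rw [map_neg, inner_neg_left, e₃, h.inner_I_left, e₃, h.I_I, h.I_I]
      simp only [map_neg, inner_neg_left, inner_neg_right]
      ring
  have hle : ∀ (p : Prop) (U : Submodule ℝ (V →ₗ[ℝ] V →ₗ[ℝ] V →ₗ[ℝ] ℝ)),
      (if p then U else ⊥) ≤ U := fun p U => by split_ifs <;> simp
  have hif : ∀ (p : Prop) (U : Submodule ℝ (V →ₗ[ℝ] V →ₗ[ℝ] V →ₗ[ℝ] ℝ)), ∀ x ∈ U,
      (x ∈ (if p then U else ⊥) ↔ p ∨ x = 0) := fun p U x hx => by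
    split_ifs with hp <;> simp [hp, hx]
  have hz : ∀ b : V →ₗ[ℝ] V, phiTensor P e b = 0 ↔ ∀ x y, ⟪e (b x), e y⟫ = 0 := fun b => by
    constructor
    · intro hb x y
      rw [h.phiTensor_eq_zero hm hb]
      simp
    · intro hb
      have : b = 0 := by
        ext x
        exact h.eq_of_inner _ _ fun z => by simp [hb]
      rw [this]
      ext
      simp [phiTensor_apply]
  have hne : ∃ x : V, ⟪e x, e x⟫ ≠ 0 := ⟨o 0, by rw [show ⟪e (o 0), e (o 0)⟫ = 1 from ho 0 0]; simp⟩
  obtain ⟨x₀, hx₀⟩ := hne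
  rw [hsum, phiTensor_add, phiTensor_add, phiTensor_add, phiTensor_smul, phiTensor_smul,
    Submodule.mem_sup_four_iff (h.modules_independent hm hψ hJ) (hle _ _) (hle _ _) (hle _ _)
      (hle _ _) m₁ m₂ m₃ m₄, hif _ _ _ m₁, hif _ _ _ m₂, hif _ _ _ m₃, hif _ _ _ m₄,
    ← phiTensor_smul, ← phiTensor_smul, hz, hz, hz, hz]
  refine and_congr (or_congr Iff.rfl ?_) (and_congr (or_congr Iff.rfl ?_)
    (and_congr (or_congr Iff.rfl ?_) (or_congr Iff.rfl ?_)))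
  · constructor
    · intro hx
      have h1 := hx x₀ x₀
      rw [LinearMap.smul_apply, LinearMap.id_apply, map_smul, inner_smul_left, conj_trivial] at h1
      exact (mul_eq_zero.1 h1).resolve_right hx₀
    · rintro rfl x y
      simp
  · constructor
    · intro hx
      have h1 := hx x₀ (I x₀)
      rw [LinearMap.smul_apply, map_smul, inner_smul_left, conj_trivial, h.inner_I_I] at h1
      exact neg_eq_zero.1 ((mul_eq_zero.1 h1).resolve_right hx₀)
    · rintro rfl x y
      simp
  · refine forall₂_congr fun x y => ?_
    rw [e₂]
    constructor <;> intro <;> linarith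
  · refine forall₂_congr fun x y => ?_
    rw [e₃]
    constructor <;> intro <;> linarith

end IsComplexHyperplane
end HyperplaneTypes

section SharpCross

open scoped RealInnerProductSpace

variable {E : Type*} [NormedAddCommGroup E] [InnerProductSpace ℝ E]
  {V : Type*} [AddCommGroup V] [Module ℝ V] [FiniteDimensional ℝ V]

theorem map_sharp {g : V → V → ℝ} {e : V →ₗ[ℝ] E} (he : Function.Injective e)
    (hg : ∀ x y, g x y = ⟪e x, e y⟫) (ℓ : V →ₗ[ℝ] ℝ) (w : V) :
    ⟪e (sharp g ℓ), e w⟫ = ℓ w := by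
  have h1 : ∃ v, ∀ w, g v w = ℓ w := by
    obtain ⟨o, ho⟩ := exists_isOrthonormalTuple he (m := Module.finrank ℝ V) rfl
    refine ⟨∑ i, ℓ (o i) • o i, fun w => ?_⟩
    conv_rhs => rw [← ho.sum_smul rfl w]
    rw [hg]
    simp only [map_sum, map_smul, sum_inner, inner_smul_left, conj_trivial, smul_eq_mul]
    exact Finset.sum_congr rfl fun i _ => by rw [real_inner_comm]; ring
  have h2 := Classical.epsilon_spec h1 w
  rw [hg] at h2
  exact h2

variable {P : E →L[ℝ] E →L[ℝ] E} {g : V → V → ℝ} {φ : (Fin 3 → V) → ℝ} {c : V →ₗ[ℝ] E}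

theorem map_crossProd (hc : Function.Bijective c) (hg : ∀ x y, g x y = ⟪c x, c y⟫)
    (hφ : ∀ v, φ v = ⟪P (c (v 0)) (c (v 1)), c (v 2)⟫) (x y : V) :
    c (crossProd g φ x y) = P (c x) (c y) := by
  refine ext_inner_right ℝ fun w => ?_
  obtain ⟨w, rfl⟩ := hc.2 w
  have h1 : (fun z => φ ![x, y, z]) = (innerₗ E (P (c x) (c y))) ∘ₗ c := by
    ext z
    simp [hφ]
  rw [crossProd, h1, map_sharp hc.1 hg]
  rfl

theorem starPhi_eq_crossStar (hP : IsCrossProduct P) (hc : Function.Bijective c)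
    (hg : ∀ x y, g x y = ⟪c x, c y⟫) (hφ : ∀ v, φ v = ⟪P (c (v 0)) (c (v 1)), c (v 2)⟫)
    (v : Fin 4 → V) :
    starPhi g φ v = crossStar P (c (v 0)) (c (v 1)) (c (v 2)) (c (v 3)) := by
  simp only [starPhi, hg, map_crossProd hc hg hφ]
  rw [hP.starPhi_eq]

omit [FiniteDimensional ℝ V] in
/-- The components with respect to a tuple of vectors. -/
def tupleComponents {m : ℕ} (β : V →ₗ[ℝ] V →ₗ[ℝ] ℝ) (e : Fin m → V) :
    V →ₗ[ℝ] EuclideanSpace ℝ (Fin m) :=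
  (WithLp.linearEquiv 2 ℝ (Fin m → ℝ)).symm.toLinearMap ∘ₗ LinearMap.pi fun i => β (e i)

omit [FiniteDimensional ℝ V] in
theorem tupleComponents_apply {m : ℕ} (β : V →ₗ[ℝ] V →ₗ[ℝ] ℝ) (e : Fin m → V) (v : V) (i : Fin m) :
    tupleComponents β e v i = β (e i) v := rfl

omit [FiniteDimensional ℝ V] in
theorem tupleComponents_sum {m : ℕ} {β : V →ₗ[ℝ] V →ₗ[ℝ] ℝ} {e : Fin m → V}
    (he : IsOrthonormalTuple (fun x y => β x y) e) (w : EuclideanSpace ℝ (Fin m)) :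
    tupleComponents β e (∑ i, w i • e i) = w := by
  ext i
  have h1 : ∀ j, β (e i) (e j) = if i = j then 1 else 0 := fun j => he i j
  rw [tupleComponents_apply]
  simp [h1]

theorem sum_tupleComponents {m : ℕ} {β : V →ₗ[ℝ] V →ₗ[ℝ] ℝ} {e : Fin m → V}
    (he : IsOrthonormalTuple (fun x y => β x y) e) (hm : Module.finrank ℝ V = m) (v : V) :
    ∑ i, tupleComponents β e v i • e i = v := by
  have hs : Function.Surjective (tupleComponents β e) := fun w => ⟨_, tupleComponents_sum he w⟩
  have hi : Function.Injective (tupleComponents β e) :=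
    (LinearMap.injective_iff_surjective_of_finrank_eq_finrank (by simp [hm])).2 hs
  exact hi (tupleComponents_sum he _)

theorem inner_tupleComponents {m : ℕ} {β : V →ₗ[ℝ] V →ₗ[ℝ] ℝ} {e : Fin m → V}
    (he : IsOrthonormalTuple (fun x y => β x y) e) (hm : Module.finrank ℝ V = m) (u v : V) :
    β u v = ⟪tupleComponents β e u, tupleComponents β e v⟫ := by
  conv_lhs => rw [← sum_tupleComponents he hm u]
  simp only [map_sum, map_smul, LinearMap.sum_apply, LinearMap.smul_apply, smul_eq_mul,
    PiLp.inner_apply, RCLike.inner_apply, conj_trivial, tupleComponents_apply]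
  exact Finset.sum_congr rfl fun i _ => mul_comm _ _

end SharpCross

section LeviCivita

open scoped RealInnerProductSpace

variable {E : Type*} [NormedAddCommGroup E] [InnerProductSpace ℝ E]
  {V : Type*} [AddCommGroup V] [Module ℝ V]

/-- The symmetry, bilinearity and metric compatibility of Christoffel symbols given by the Koszul
formula. -/
theorem koszul_connection {e : V →ₗ[ℝ] E} (he : Function.Injective e) {D : V → V → V → ℝ}
    {d : V →ₗ[ℝ] V →ₗ[ℝ] E} (hD : ∀ X Y Z, D X Y Z = ⟪d X Y, e Z⟫ + ⟪e Y, d X Z⟫) {Γ : V → V → V}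
    (hΓ : ∀ X Y Z, ⟪e (Γ X Y), e Z⟫ = 1 / 2 * (D X Y Z + D Y X Z - D Z X Y)) :
    ∃ G : V →ₗ[ℝ] V →ₗ[ℝ] V, (∀ X Y, Γ X Y = G X Y) ∧ (∀ X Y, G X Y = G Y X) ∧
      ∀ X Y Z, ⟪d X Y, e Z⟫ + ⟪e Y, d X Z⟫ = ⟪e (G X Y), e Z⟫ + ⟪e Y, e (G X Z)⟫ := by
  have hext : ∀ x y : V, (∀ z, ⟪e x, e z⟫ = ⟪e y, e z⟫) → x = y := fun x y hxy => by
    have h1 := hxy (x - y)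
    rw [← sub_eq_zero, ← inner_sub_left, ← map_sub, inner_self_eq_zero] at h1
    exact sub_eq_zero.1 (he (by simpa using h1))
  have hDs : ∀ X Y Z, D X Y Z = D X Z Y := fun X Y Z => by
    rw [hD, hD, real_inner_comm (e Z), real_inner_comm (e Y) (d X Z)]
    ring
  have hsym : ∀ X Y, Γ X Y = Γ Y X := fun X Y => hext _ _ fun Z => by
    rw [hΓ, hΓ, hDs Z X Y]
    ring
  have hadd : ∀ X Y Z, Γ (X + Y) Z = Γ X Z + Γ Y Z := fun X Y Z => hext _ _ fun W => by
    rw [map_add, inner_add_left]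
    simp only [hΓ, hD, map_add, LinearMap.add_apply, inner_add_left, inner_add_right]
    ring
  have hsmul : ∀ (r : ℝ) X Y, Γ (r • X) Y = r • Γ X Y := fun r X Y => hext _ _ fun W => by
    rw [map_smul, inner_smul_left]
    simp only [hΓ, hD, map_smul, LinearMap.smul_apply, inner_smul_left, inner_smul_right,
      conj_trivial]
    ring
  refine ⟨LinearMap.mk₂ ℝ Γ hadd hsmul (fun X Y Z => by rw [hsym, hadd, hsym Y, hsym Z])
    (fun r X Y => by rw [hsym, hsmul, hsym Y]), fun _ _ => rfl, hsym, fun X Y Z => ?_⟩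
  rw [LinearMap.mk₂_apply, LinearMap.mk₂_apply, hΓ, real_inner_comm (e (Γ X Z)), hΓ, ← hD,
    hDs Z X Y, hDs Y X Z, hDs X Z Y]
  ring

end LeviCivita

section ChartDerivative

open scoped RealInnerProductSpace Topology

variable {m : ℕ} {M : Type*} [TopologicalSpace M] [ChartedSpace (EuclideanSpace ℝ (Fin m)) M]

/-- The derivative of the inverse of the preferred chart at `p`, where tangent spaces are identified
with the model space. -/
def chartSymmDeriv (p : M) (y : EuclideanSpace ℝ (Fin m)) :
    EuclideanSpace ℝ (Fin m) →L[ℝ] EuclideanSpace ℝ (Fin m) :=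
  mfderiv (𝓡 m) (𝓡 m) (extChartAt (𝓡 m) p).symm y

/-- The derivative of the preferred chart at `p`, where tangent spaces are identified with the model
space. -/
def chartDeriv (p q : M) : EuclideanSpace ℝ (Fin m) →L[ℝ] EuclideanSpace ℝ (Fin m) :=
  mfderiv (𝓡 m) (𝓡 m) (extChartAt (𝓡 m) p) q

theorem inChart_eq (p : M) {k : ℕ} (α : M → (Fin k → EuclideanSpace ℝ (Fin m)) → ℝ)
    (y : EuclideanSpace ℝ (Fin m)) (v : Fin k → EuclideanSpace ℝ (Fin m)) :
    inChart p α y v = α ((extChartAt (𝓡 m) p).symm y) (fun i => chartSymmDeriv p y (v i)) := rfl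

variable [IsManifold (𝓡 m) ∞ M]

theorem chartSymmDeriv_self (p : M) : chartSymmDeriv p (extChartAt (𝓡 m) p p) =
    ContinuousLinearMap.id ℝ (EuclideanSpace ℝ (Fin m)) := by
  have : IsManifold (𝓡 m) 1 M := IsManifold.of_le (n := ∞) (by norm_cast)
  have h := mfderivWithin_range_extChartAt_symm (I := 𝓡 m) (x := p)
  rw [ModelWithCorners.Boundaryless.range_eq_univ, mfderivWithin_univ] at h
  exact h

theorem chartSymmDeriv_comp_chartDeriv (p : M) {y : EuclideanSpace ℝ (Fin m)}
    (hy : y ∈ (extChartAt (𝓡 m) p).target) :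
    chartSymmDeriv p y ∘L chartDeriv p ((extChartAt (𝓡 m) p).symm y) =
    ContinuousLinearMap.id ℝ (EuclideanSpace ℝ (Fin m)) := by
  have : IsManifold (𝓡 m) 1 M := IsManifold.of_le (n := ∞) (by norm_cast)
  have h := mfderivWithin_extChartAt_symm_comp_mfderiv_extChartAt (I := 𝓡 m) (x := p) hy
  rw [ModelWithCorners.Boundaryless.range_eq_univ, mfderivWithin_univ] at h
  exact h

theorem hasMFDerivAt_extChartAt_symm (p : M) {y : EuclideanSpace ℝ (Fin m)}
    (hy : y ∈ (extChartAt (𝓡 m) p).target) :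
    HasMFDerivAt (𝓡 m) (𝓡 m) (extChartAt (𝓡 m) p).symm y (chartSymmDeriv p y) := by
  have : IsManifold (𝓡 m) 1 M := IsManifold.of_le (n := ∞) (by norm_cast)
  have h := mdifferentiableWithinAt_extChartAt_symm (I := 𝓡 m) (x := p) hy
  rw [ModelWithCorners.Boundaryless.range_eq_univ, mdifferentiableWithinAt_univ] at h
  exact h.hasMFDerivAt

theorem inChart_self (p : M) {k : ℕ} (α : M → (Fin k → EuclideanSpace ℝ (Fin m)) → ℝ)
    (v : Fin k → EuclideanSpace ℝ (Fin m)) :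
    inChart p α (extChartAt (𝓡 m) p p) v = α p v := by
  rw [inChart_eq, extChartAt_to_inv, chartSymmDeriv_self]
  rfl

/-- A map into the tangent bundle which is smooth at `x` has a smooth expression in the chart. -/
theorem contMDiffAt_chartDeriv {H' : Type*} [TopologicalSpace H'] {F' : Type*}
    [NormedAddCommGroup F'] [NormedSpace ℝ F'] {J : ModelWithCorners ℝ F' H'} {X : Type*}
    [TopologicalSpace X] [ChartedSpace H' X] {f : X → M}
    {s : X → EuclideanSpace ℝ (Fin m)} {x : X}
    (hs : ContMDiffAt J (𝓡 m).tangent ∞ (fun q => (⟨f q, s q⟩ : TangentBundle (𝓡 m) M)) x) :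
    ContMDiffAt J 𝓘(ℝ, EuclideanSpace ℝ (Fin m)) ∞ (fun q => chartDeriv (f x) (f q) (s q)) x := by
  have : IsManifold (𝓡 m) 1 M := IsManifold.of_le (n := ∞) (by norm_cast)
  obtain ⟨h1, h2⟩ := Bundle.contMDiffAt_totalSpace.1 hs
  refine h2.congr_of_eventuallyEq ?_
  have h3 : ∀ᶠ q in 𝓝 x, f q ∈ (chartAt (EuclideanSpace ℝ (Fin m)) (f x)).source :=
    h1.continuousAt.eventually ((chartAt _ (f x)).open_source.mem_nhds (mem_chart_source _ _))
  filter_upwards [h3] with q hq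
  have h4 := TangentBundle.continuousLinearMapAt_trivializationAt (I := 𝓡 m) hq
  have h5 := (trivializationAt (EuclideanSpace ℝ (Fin m)) (TangentSpace (𝓡 m))
    (f x)).continuousLinearMapAt_apply_of_mem (R := ℝ) (b := f q) hq (s q)
  exact (DFunLike.congr_fun h4 (s q)).symm.trans h5

theorem differentiableAt_comp_chart_symm {F' : Type*} [NormedAddCommGroup F'] [NormedSpace ℝ F']
    {f : M → F'} {p : M} (hf : ContMDiffAt (𝓡 m) 𝓘(ℝ, F') ∞ f p) :
    DifferentiableAt ℝ (fun y => f ((extChartAt (𝓡 m) p).symm y)) (extChartAt (𝓡 m) p p) := by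
  have h1 := ((contMDiffOn_extChartAt_symm (I := 𝓡 m) (n := ∞) p).contMDiffAt
    (extChartAt_target_mem_nhds p))
  have h2 := ContMDiffAt.comp_of_eq hf h1 (extChartAt_to_inv p)
  exact h2.contDiffAt.differentiableAt (by simp)

end ChartDerivative

section Coframe

theorem clm_mul_eq_one_comm {W : Type*} [NormedAddCommGroup W] [NormedSpace ℝ W]
    [FiniteDimensional ℝ W] {A B : W →L[ℝ] W} (h : A * B = 1) : B * A = 1 := by
  have h1 : (A : W →ₗ[ℝ] W) * (B : W →ₗ[ℝ] W) = 1 := by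
    ext w
    exact DFunLike.congr_fun h w
  ext w
  exact DFunLike.congr_fun (mul_eq_one_comm.1 h1) w

open scoped RealInnerProductSpace Topology

variable {N : Type*} [TopologicalSpace N] [ChartedSpace (EuclideanSpace ℝ (Fin 7)) N]
  [IsManifold (𝓡 7) ∞ N]

/-- Locally, a `G₂`-structure is the pull-back of the flat one by a differentiable coframe. -/
theorem G2Structure.exists_coframe (S : G2Structure N) (p : N) :
    ∃ c : N → (EuclideanSpace ℝ (Fin 7) →L[ℝ] EuclideanSpace ℝ (Fin 7)),
      (∀ᶠ q in 𝓝 p, (∀ u v : EuclideanSpace ℝ (Fin 7), S.g q u v = ⟪c q u, c q v⟫) ∧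
        Function.Bijective (c q) ∧ ∀ v : Fin 3 → EuclideanSpace ℝ (Fin 7),
          S.phi q v = ⟪octonionCross (c q (v 0)) (c q (v 1)), c q (v 2)⟫) ∧
      DifferentiableAt ℝ (fun y => c ((extChartAt (𝓡 7) p).symm y) ∘L chartSymmDeriv p y)
        (extChartAt (𝓡 7) p p) := by
  obtain ⟨U, hU, hpU, e, he, hc⟩ := S.exists_frame p
  let β : ∀ q : N, TangentSpace (𝓡 7) q →ₗ[ℝ] TangentSpace (𝓡 7) q →ₗ[ℝ] ℝ := fun q =>
    LinearMap.mk₂ ℝ (fun u v => S.metric.inner q u v) (by simp) (by simp) (by simp) (by simp)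
  let c : N → (EuclideanSpace ℝ (Fin 7) →L[ℝ] EuclideanSpace ℝ (Fin 7)) := fun q =>
    LinearMap.toContinuousLinearMap (tupleComponents (β q) (fun i => e i q) :
      EuclideanSpace ℝ (Fin 7) →ₗ[ℝ] EuclideanSpace ℝ (Fin 7))
  have hm : ∀ q : N, Module.finrank ℝ (TangentSpace (𝓡 7) q) = 7 := fun q =>
    finrank_euclideanSpace_fin
  have hfd : ∀ q : N, FiniteDimensional ℝ (TangentSpace (𝓡 7) q) := fun q =>
    inferInstanceAs (FiniteDimensional ℝ (EuclideanSpace ℝ (Fin 7)))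
  have hfr : ∀ q ∈ U, ∀ w : EuclideanSpace ℝ (Fin 7), c q (∑ i, w i • e i q) = w := fun q hq w =>
    tupleComponents_sum (β := β q) (hc q hq).1 w
  refine ⟨c, ?_, ?_⟩
  · filter_upwards [hU.mem_nhds hpU] with q hq
    have ho := (hc q hq).1
    refine ⟨fun u v => inner_tupleComponents (β := β q) ho (hm q) u v, ?_, fun v => ?_⟩
    · have hs : Function.Surjective (c q) := fun w => ⟨_, hfr q hq w⟩
      exact ⟨LinearMap.injective_iff_surjective.2 hs, hs⟩
    · exact ((hc q hq).2 v).trans (sum_det_cayley fun i => c q (v i))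
  · set y₀ := extChartAt (𝓡 7) p p with hy₀
    let f : Fin 7 → EuclideanSpace ℝ (Fin 7) → EuclideanSpace ℝ (Fin 7) := fun i y =>
      chartDeriv p ((extChartAt (𝓡 7) p).symm y) (e i ((extChartAt (𝓡 7) p).symm y))
    have hf : ∀ i, DifferentiableAt ℝ (f i) y₀ := fun i => differentiableAt_comp_chart_symm
      (contMDiffAt_chartDeriv (f := id) (s := e i) ((he i).contMDiffAt (hU.mem_nhds hpU)))
    let F : EuclideanSpace ℝ (Fin 7) → (EuclideanSpace ℝ (Fin 7) →L[ℝ] EuclideanSpace ℝ (Fin 7)) :=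
      fun y => ∑ i, (EuclideanSpace.proj i : EuclideanSpace ℝ (Fin 7) →L[ℝ] ℝ).smulRight (f i y)
    have hF : DifferentiableAt ℝ F y₀ := by
      refine DifferentiableAt.fun_sum fun i _ => ?_
      exact (ContinuousLinearMap.smulRightL ℝ (EuclideanSpace ℝ (Fin 7)) (EuclideanSpace ℝ (Fin 7))
        (EuclideanSpace.proj i)).differentiableAt.comp y₀ (hf i)
    have hinv : ∀ y ∈ (extChartAt (𝓡 7) p).target, (extChartAt (𝓡 7) p).symm y ∈ U →
        (c ((extChartAt (𝓡 7) p).symm y) ∘L chartSymmDeriv p y) * F y = 1 := by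
      intro y hy hyU
      ext1 w
      have h1 : chartSymmDeriv p y (F y w) = ∑ i, w i • e i ((extChartAt (𝓡 7) p).symm y) := by
        have h2 : ∀ v, chartSymmDeriv p y (chartDeriv p ((extChartAt (𝓡 7) p).symm y) v) = v :=
          fun v => DFunLike.congr_fun (chartSymmDeriv_comp_chartDeriv p hy) v
        simp only [F, f, FunLike.coe_sum, Finset.sum_apply, map_sum,
          ContinuousLinearMap.smulRight_apply, map_smul]
        exact Finset.sum_congr rfl fun i _ => congrArg (w i • ·) (h2 _)
      change c _ (chartSymmDeriv p y (F y w)) = w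
      rw [h1]
      exact hfr _ hyU w
    have hev : ∀ᶠ y in 𝓝 y₀, y ∈ (extChartAt (𝓡 7) p).target ∧ (extChartAt (𝓡 7) p).symm y ∈ U :=
      (show ∀ᶠ y in 𝓝 y₀, y ∈ (extChartAt (𝓡 7) p).target from extChartAt_target_mem_nhds p).and
        ((continuousAt_extChartAt_symm p).eventually (by
          rw [extChartAt_to_inv]; exact hU.mem_nhds hpU))
    have hu : ∀ y ∈ (extChartAt (𝓡 7) p).target, (extChartAt (𝓡 7) p).symm y ∈ U →
        ∃ u : (EuclideanSpace ℝ (Fin 7) →L[ℝ] EuclideanSpace ℝ (Fin 7))ˣ, (u : _ →L[ℝ] _) = F y ∧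
          ((u⁻¹ : (EuclideanSpace ℝ (Fin 7) →L[ℝ] EuclideanSpace ℝ (Fin 7))ˣ) : _ →L[ℝ] _) =
            c ((extChartAt (𝓡 7) p).symm y) ∘L chartSymmDeriv p y := fun y hy hyU =>
      ⟨⟨F y, _, clm_mul_eq_one_comm (hinv y hy hyU), hinv y hy hyU⟩, rfl, rfl⟩
    have h0 := hev.self_of_nhds
    obtain ⟨u, hu1, -⟩ := hu y₀ h0.1 h0.2
    refine DifferentiableAt.congr_of_eventuallyEq
      ((differentiableAt_inverse (𝕜 := ℝ) ⟨u, hu1⟩).comp y₀ hF) ?_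
    filter_upwards [hev] with y hy
    obtain ⟨u, hu1, hu2⟩ := hu y hy.1 hy.2
    rw [Function.comp_apply, ← hu1, Ring.inverse_unit, hu2]

end Coframe

section Derivatives

open scoped RealInnerProductSpace

variable {E : Type*} [NormedAddCommGroup E] [InnerProductSpace ℝ E]
  {W : Type*} [NormedAddCommGroup W] [NormedSpace ℝ W]
  {P : E →L[ℝ] E →L[ℝ] E} {a b c d : W → E} {y : W}

theorem differentiableAt_bilinear (ha : DifferentiableAt ℝ a y) (hb : DifferentiableAt ℝ b y) :
    DifferentiableAt ℝ (fun t => P (a t) (b t)) y :=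
  (P.hasFDerivAt_of_bilinear ha.hasFDerivAt hb.hasFDerivAt).differentiableAt

theorem fderiv_bilinear_apply (ha : DifferentiableAt ℝ a y) (hb : DifferentiableAt ℝ b y) (X : W) :
    fderiv ℝ (fun t => P (a t) (b t)) y X = P (fderiv ℝ a y X) (b y) + P (a y) (fderiv ℝ b y X) :=
        by
  rw [(P.hasFDerivAt_of_bilinear ha.hasFDerivAt hb.hasFDerivAt).fderiv]
  simp [add_comm]

theorem fderiv_inner_cross_apply (ha : DifferentiableAt ℝ a y) (hb : DifferentiableAt ℝ b y)
    (hc : DifferentiableAt ℝ c y) (X : W) :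
    fderiv ℝ (fun t => ⟪P (a t) (b t), c t⟫) y X = ⟪P (fderiv ℝ a y X) (b y), c y⟫
      + ⟪P (a y) (fderiv ℝ b y X), c y⟫ + ⟪P (a y) (b y), fderiv ℝ c y X⟫ := by
  rw [fderiv_inner_apply ℝ (differentiableAt_bilinear ha hb) hc, fderiv_bilinear_apply ha hb,
    inner_add_left]
  ring

theorem fderiv_crossStar_apply (ha : DifferentiableAt ℝ a y) (hb : DifferentiableAt ℝ b y)
    (hc : DifferentiableAt ℝ c y) (hd : DifferentiableAt ℝ d y) (X : W) :
    fderiv ℝ (fun t => crossStar P (a t) (b t) (c t) (d t)) y X =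
      crossStar P (fderiv ℝ a y X) (b y) (c y) (d y) + crossStar P (a y) (fderiv ℝ b y X) (c y) (d
          y)
      + crossStar P (a y) (b y) (fderiv ℝ c y X) (d y)
      + crossStar P (a y) (b y) (c y) (fderiv ℝ d y X) := by
  have h1 := differentiableAt_bilinear (P := P) ha hb
  have h2 := differentiableAt_bilinear (P := P) hc hd
  have h3 := h1.inner ℝ h2
  have h4 := (hb.inner ℝ hc).mul (hd.inner ℝ ha)
  have h5 := (hb.inner ℝ hd).mul (hc.inner ℝ ha)
  have h6 : fderiv ℝ (fun t => crossStar P (a t) (b t) (c t) (d t)) y =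
      - fderiv ℝ (fun t => ⟪P (a t) (b t), P (c t) (d t)⟫) y
      - fderiv ℝ ((fun t => ⟪b t, c t⟫) * fun t => ⟪d t, a t⟫) y
      + fderiv ℝ ((fun t => ⟪b t, d t⟫) * fun t => ⟪c t, a t⟫) y :=
    ((h3.hasFDerivAt.neg.sub h4.hasFDerivAt).add h5.hasFDerivAt).fderiv
  rw [h6, fderiv_mul (hb.inner ℝ hc) (hd.inner ℝ ha), fderiv_mul (hb.inner ℝ hd) (hc.inner ℝ ha)]
  simp only [add_apply, sub_apply, neg_apply, smul_apply, smul_eq_mul,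
    fderiv_inner_apply ℝ h1 h2, fderiv_inner_apply ℝ hb hc, fderiv_inner_apply ℝ hd ha,
    fderiv_inner_apply ℝ hb hd, fderiv_inner_apply ℝ hc ha, fderiv_bilinear_apply ha hb,
    fderiv_bilinear_apply hc hd, inner_add_left, inner_add_right, crossStar]
  ring

end Derivatives

section InducedMetric

open scoped RealInnerProductSpace Topology

variable {m : ℕ} {M : Type*} [TopologicalSpace M] [ChartedSpace (EuclideanSpace ℝ (Fin m)) M]
  [IsManifold (𝓡 m) ∞ M] {E : Type*} [NormedAddCommGroup E] [InnerProductSpace ℝ E]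

omit [IsManifold (𝓡 m) ∞ M] in
theorem coordDeriv_eq_of_eventuallyEq {p : M} {k : ℕ}
    {α : ∀ q : M, (Fin k → TangentSpace (𝓡 m) q) → ℝ} {v : Fin k → TangentSpace (𝓡 m) p}
    {f : EuclideanSpace ℝ (Fin m) → ℝ}
    (h : ∀ᶠ y in 𝓝 (extChartAt (𝓡 m) p p), inChart p α y v = f y) (X : TangentSpace (𝓡 m) p) :
    coordDeriv p α X v = fderiv ℝ f (extChartAt (𝓡 m) p p) X := by
  rw [coordDeriv, Filter.EventuallyEq.fderiv_eq h]

theorem fderiv_clm_const_apply {W W' : Type*} [NormedAddCommGroup W] [NormedSpace ℝ W]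
    [NormedAddCommGroup W'] [NormedSpace ℝ W'] {e : W → (W' →L[ℝ] E)} {y : W}
    (he : DifferentiableAt ℝ e y) (u : W') (X : W) :
    DifferentiableAt ℝ (fun t => e t u) y ∧ fderiv ℝ (fun t => e t u) y X = fderiv ℝ e y X u := by
  have h := he.hasFDerivAt.clm_apply (hasFDerivAt_const u y)
  refine ⟨h.differentiableAt, ?_⟩
  rw [h.fderiv]
  simp

/-- The Christoffel symbols of a metric which is induced by a differentiable family of maps into a
Euclidean space. -/
theorem exists_christoffel {g : ∀ q : M, TangentSpace (𝓡 m) q → TangentSpace (𝓡 m) q → ℝ} {p : M}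
    {e : EuclideanSpace ℝ (Fin m) → (EuclideanSpace ℝ (Fin m) →L[ℝ] E)}
    (he : DifferentiableAt ℝ e (extChartAt (𝓡 m) p p))
    (hinj : Function.Injective (e (extChartAt (𝓡 m) p p)))
    (hg : ∀ᶠ y in 𝓝 (extChartAt (𝓡 m) p p), ∀ v : Fin 2 → EuclideanSpace ℝ (Fin m),
      inChart p (fun q (v : Fin 2 → TangentSpace (𝓡 m) q) => g q (v 0) (v 1)) y v =
        ⟪e y (v 0), e y (v 1)⟫) :
    ∃ G : EuclideanSpace ℝ (Fin m) →ₗ[ℝ] EuclideanSpace ℝ (Fin m) →ₗ[ℝ] EuclideanSpace ℝ (Fin m),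
      (∀ X Y, christoffel g p X Y = G X Y) ∧ (∀ X Y, G X Y = G Y X) ∧
      ∀ X Y Z, ⟪fderiv ℝ e (extChartAt (𝓡 m) p p) X Y, e (extChartAt (𝓡 m) p p) Z⟫
          + ⟪e (extChartAt (𝓡 m) p p) Y, fderiv ℝ e (extChartAt (𝓡 m) p p) X Z⟫
        = ⟪e (extChartAt (𝓡 m) p p) (G X Y), e (extChartAt (𝓡 m) p p) Z⟫
          + ⟪e (extChartAt (𝓡 m) p p) Y, e (extChartAt (𝓡 m) p p) (G X Z)⟫ := by
  set x₀ := extChartAt (𝓡 m) p p with hx₀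
  let D : EuclideanSpace ℝ (Fin m) → EuclideanSpace ℝ (Fin m) → EuclideanSpace ℝ (Fin m) → ℝ :=
    fun X Y Z => coordDeriv p (fun q (v : Fin 2 → TangentSpace (𝓡 m) q) => g q (v 0) (v 1)) X ![Y,
        Z]
  have hD : ∀ X Y Z, D X Y Z = ⟪fderiv ℝ e x₀ X Y, e x₀ Z⟫ + ⟪e x₀ Y, fderiv ℝ e x₀ X Z⟫ := by
    intro X Y Z
    have h1 := coordDeriv_eq_of_eventuallyEq (p := p) (v := ![Y, Z])
      (f := fun y => ⟪e y Y, e y Z⟫) (hg.mono fun y hy => hy ![Y, Z]) X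
    have h2 := fderiv_clm_const_apply he Y X
    have h3 := fderiv_clm_const_apply he Z X
    have h4 := fderiv_inner_apply ℝ h2.1 h3.1 X
    rw [h2.2, h3.2] at h4
    exact h1.trans (h4.trans (add_comm _ _))
  have hgp : ∀ u v : EuclideanSpace ℝ (Fin m), g p u v = ⟪e x₀ u, e x₀ v⟫ := fun u v => by
    have h1 := hg.self_of_nhds ![u, v]
    have h2 := inChart_self p (fun q (v : Fin 2 → EuclideanSpace ℝ (Fin m)) => g q (v 0) (v 1))
        ![u, v]
    exact h2.symm.trans h1
  let d : EuclideanSpace ℝ (Fin m) →ₗ[ℝ] EuclideanSpace ℝ (Fin m) →ₗ[ℝ] E :=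
    (ContinuousLinearMap.coeLM ℝ) ∘ₗ (fderiv ℝ e x₀ : EuclideanSpace ℝ (Fin m) →ₗ[ℝ] _)
  refine koszul_connection (e := (e x₀ : EuclideanSpace ℝ (Fin m) →ₗ[ℝ] E)) (d := d) hinj hD
    fun X Y Z => ?_
  let ℓ : EuclideanSpace ℝ (Fin m) →ₗ[ℝ] ℝ := (1 / 2 : ℝ) • ((innerₗ E (d X Y)) ∘ₗ (e x₀ : _ →ₗ[ℝ]
      E)
    + (innerₗ E (e x₀ Y)) ∘ₗ d X + ((innerₗ E (d Y X)) ∘ₗ (e x₀ : _ →ₗ[ℝ] E)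
    + (innerₗ E (e x₀ X)) ∘ₗ d Y) - ((innerₗ E (e x₀ Y)) ∘ₗ d.flip X
    + (innerₗ E (e x₀ X)) ∘ₗ d.flip Y))
  have hℓ : ∀ Z, ℓ Z = 1 / 2 * (D X Y Z + D Y X Z - D Z X Y) := fun Z => by
    simp only [ℓ, LinearMap.smul_apply, LinearMap.sub_apply, LinearMap.add_apply,
      LinearMap.comp_apply, innerₗ_apply_apply, LinearMap.flip_apply, smul_eq_mul, hD]
    change 1 / 2 * (⟪fderiv ℝ e x₀ X Y, e x₀ Z⟫ + ⟪e x₀ Y, fderiv ℝ e x₀ X Z⟫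
      + (⟪fderiv ℝ e x₀ Y X, e x₀ Z⟫ + ⟪e x₀ X, fderiv ℝ e x₀ Y Z⟫)
      - (⟪e x₀ Y, fderiv ℝ e x₀ Z X⟫ + ⟪e x₀ X, fderiv ℝ e x₀ Z Y⟫)) = _
    rw [real_inner_comm (fderiv ℝ e x₀ Z X) (e x₀ Y)]
  have h1 : (fun Z => 1 / 2 * (D X Y Z + D Y X Z - D Z X Y)) = ℓ := funext fun Z => (hℓ Z).symm
  have h2 := map_sharp (g := fun u v : EuclideanSpace ℝ (Fin m) => g p u v)
    (e := (e x₀ : EuclideanSpace ℝ (Fin m) →ₗ[ℝ] E)) hinj hgp ℓ Z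
  rw [hℓ, ← h1] at h2
  exact h2

end InducedMetric

section HypersurfaceFrame

open scoped RealInnerProductSpace Topology

variable {M : Type*} [TopologicalSpace M] [ChartedSpace (EuclideanSpace ℝ (Fin 6)) M]
  {N : Type*} [TopologicalSpace N] [ChartedSpace (EuclideanSpace ℝ (Fin 7)) N]
  [IsManifold (𝓡 7) ∞ N] {S : G2Structure N} (X : OrientedHypersurface M S)

namespace OrientedHypersurface

/-- The differential of the inclusion, where tangent spaces are identified with model spaces. -/
def pushDeriv (p : M) : EuclideanSpace ℝ (Fin 6) →L[ℝ] EuclideanSpace ℝ (Fin 7) :=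
  mfderiv (𝓡 6) (𝓡 7) X.incl p

/-- The unit normal vector, where tangent spaces are identified with the model space. -/
def normalVec (p : M) : EuclideanSpace ℝ (Fin 7) := X.normal p

variable {X} {q : M} {c : EuclideanSpace ℝ (Fin 7) →L[ℝ] EuclideanSpace ℝ (Fin 7)}
  (hg : ∀ u v : EuclideanSpace ℝ (Fin 7), S.g (X.incl q) u v = ⟪c u, c v⟫)
  (hc : Function.Bijective c) (hφ : ∀ v : Fin 3 → EuclideanSpace ℝ (Fin 7),
    S.phi (X.incl q) v = ⟪octonionCross (c (v 0)) (c (v 1)), c (v 2)⟫)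
include hg hc hφ

theorem exists_isComplexHyperplane : ∃ J : EuclideanSpace ℝ (Fin 6) →ₗ[ℝ] EuclideanSpace ℝ (Fin 6),
    (∀ x : EuclideanSpace ℝ (Fin 6), X.I q x = J x) ∧
    IsComplexHyperplane octonionCross
      ((c ∘L X.pushDeriv q : _ →L[ℝ] _) : EuclideanSpace ℝ (Fin 6) →ₗ[ℝ] EuclideanSpace ℝ (Fin 7))
      (c (X.normalVec q)) J := by
  set e : EuclideanSpace ℝ (Fin 6) →ₗ[ℝ] EuclideanSpace ℝ (Fin 7) :=
    ((c ∘L X.pushDeriv q : _ →L[ℝ] _) : EuclideanSpace ℝ (Fin 6) →ₗ[ℝ] EuclideanSpace ℝ (Fin 7))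
    with he
  set ν := c (X.normalVec q) with hν
  have hinj : Function.Injective e := hc.1.comp (X.injective_mfderiv q)
  have hunit : ⟪ν, ν⟫ = 1 := (hg _ _).symm.trans (X.normal_unit q)
  have horth : ∀ x, ⟪ν, e x⟫ = 0 := fun x => (hg _ _).symm.trans (X.normal_orthogonal q x)
  have hex : ∀ w, ⟪ν, w⟫ = 0 → ∃ x, e x = w := by
    have h1 : LinearMap.range e ≤ (ℝ ∙ ν)ᗮ := by
      rintro _ ⟨x, rfl⟩
      exact Submodule.mem_orthogonal_singleton_iff_inner_right.2 (horth x)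
    have hν0 : ν ≠ 0 := fun h0 => by simp [h0] at hunit
    have hf : Fact (Module.finrank ℝ (EuclideanSpace ℝ (Fin 7)) = 6 + 1) := ⟨by simp⟩
    have h2 := Submodule.eq_of_le_of_finrank_eq h1 (by
      rw [LinearMap.finrank_range_of_inj hinj, Submodule.finrank_orthogonal_span_singleton (n := 6)
          hν0]
      simp)
    intro w hw
    have h3 : w ∈ LinearMap.range e := by
      rw [h2]
      exact Submodule.mem_orthogonal_singleton_iff_inner_right.2 hw
    exact h3
  have hP := isCrossProduct_octonionCross
  choose t ht using fun x => hex (octonionCross ν (e x)) (by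
    rw [real_inner_comm, hP.inner_cycle, hP.inner_cycle, hP.self]; simp)
  have hcross : ∀ x : EuclideanSpace ℝ (Fin 6),
      c (S.cross (X.incl q) (X.normalVec q) (X.pushDeriv q x)) = octonionCross ν (e x) := fun x =>
    map_crossProd (c := (c : EuclideanSpace ℝ (Fin 7) →ₗ[ℝ] EuclideanSpace ℝ (Fin 7)))
      (P := octonionCross) hc hg hφ (X.normalVec q) (X.pushDeriv q x)
  have hI : ∀ x : EuclideanSpace ℝ (Fin 6), X.I q x = t x := fun x => by
    have h1 : X.push q (X.I q x) = S.cross (X.incl q) (X.normal q) (X.push q x) :=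
      Classical.epsilon_spec (p := fun w => X.push q w =
        S.cross (X.incl q) (X.normal q) (X.push q x)) ⟨t x, hc.1 ((ht x).trans (hcross x).symm)⟩
    exact hinj (((congrArg c h1).trans (hcross x)).trans (ht x).symm)
  refine ⟨⟨⟨t, fun x y => hinj ?_⟩, fun r x => hinj ?_⟩, hI, ⟨hP, hinj, hunit, horth, hex, ht⟩⟩
  · simp only [ht, map_add]
  · simp only [ht, map_smul, RingHom.id_apply]

theorem pullNStar_eq (v : Fin 3 → EuclideanSpace ℝ (Fin 6)) :
    X.pullNStar q v = crossStar octonionCross (c (X.normalVec q)) (c (X.pushDeriv q (v 0)))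
      (c (X.pushDeriv q (v 1))) (c (X.pushDeriv q (v 2))) :=
  starPhi_eq_crossStar (c := (c : EuclideanSpace ℝ (Fin 7) →ₗ[ℝ] EuclideanSpace ℝ (Fin 7)))
    isCrossProduct_octonionCross hc hg hφ
    (Matrix.vecCons (X.normalVec q) fun i => X.pushDeriv q (v i))

theorem kahler_eq (v : Fin 2 → EuclideanSpace ℝ (Fin 6)) : kahler (X.g q) (X.I q) v =
    ⟪octonionCross (c (X.normalVec q)) (c (X.pushDeriv q (v 1))), c (X.pushDeriv q (v 0))⟫ := by
  obtain ⟨J, hJ, h⟩ := exists_isComplexHyperplane hg hc hφ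
  have h1 : kahler (X.g q) (X.I q) v = ⟪c (X.pushDeriv q (v 0)), c (X.pushDeriv q (X.I q (v 1)))⟫ :=
    hg _ _
  refine h1.trans ?_
  rw [real_inner_comm, hJ]
  exact congrArg (fun w => ⟪w, c (X.pushDeriv q (v 0))⟫) (h.map_I (v 1))

end OrientedHypersurface
end HypersurfaceFrame

section HypersurfaceChart

open scoped RealInnerProductSpace Topology

variable {M : Type*} [TopologicalSpace M] [ChartedSpace (EuclideanSpace ℝ (Fin 6)) M]
  {N : Type*} [TopologicalSpace N] [ChartedSpace (EuclideanSpace ℝ (Fin 7)) N]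
  [IsManifold (𝓡 7) ∞ N] {S : G2Structure N} (X : OrientedHypersurface M S)

namespace OrientedHypersurface

/-- The inclusion in the preferred charts at `p` and at its image. -/
def chartIncl (p : M) : EuclideanSpace ℝ (Fin 6) → EuclideanSpace ℝ (Fin 7) :=
  writtenInExtChartAt (𝓡 6) (𝓡 7) p X.incl

theorem contDiffAt_chartIncl (p : M) :
    ContDiffAt ℝ ∞ (X.chartIncl p) (extChartAt (𝓡 6) p p) := by
  have h := (contMDiffAt_iff.1 (X.smooth_incl p)).2
  rw [ModelWithCorners.Boundaryless.range_eq_univ, contDiffWithinAt_univ] at h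
  exact h

theorem chartIncl_self (p : M) :
    X.chartIncl p (extChartAt (𝓡 6) p p) = extChartAt (𝓡 7) (X.incl p) (X.incl p) := by
  simp [chartIncl, writtenInExtChartAt]

theorem eventually_mem_source (p : M) : ∀ᶠ y in 𝓝 (extChartAt (𝓡 6) p p),
    y ∈ (extChartAt (𝓡 6) p).target ∧
      X.incl ((extChartAt (𝓡 6) p).symm y) ∈ (extChartAt (𝓡 7) (X.incl p)).source := by
  refine (show ∀ᶠ y in 𝓝 _, y ∈ (extChartAt (𝓡 6) p).target from
    extChartAt_target_mem_nhds p).and ?_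
  have h : ContinuousAt (fun y => X.incl ((extChartAt (𝓡 6) p).symm y)) (extChartAt (𝓡 6) p p) :=
    ContinuousAt.comp X.smooth_incl.continuous.continuousAt (continuousAt_extChartAt_symm p)
  exact h.eventually (by
    simpa using (isOpen_extChartAt_source (I := 𝓡 7) (X.incl p)).mem_nhds (mem_extChartAt_source _))

variable {p : M} {y : EuclideanSpace ℝ (Fin 6)} (hy : y ∈ (extChartAt (𝓡 6) p).target)
  (hy' : X.incl ((extChartAt (𝓡 6) p).symm y) ∈ (extChartAt (𝓡 7) (X.incl p)).source)

include hy' in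
theorem symm_chartIncl : (extChartAt (𝓡 7) (X.incl p)).symm (X.chartIncl p y) =
    X.incl ((extChartAt (𝓡 6) p).symm y) :=
  (extChartAt (𝓡 7) (X.incl p)).left_inv hy'

variable [IsManifold (𝓡 6) ∞ M]
include hy hy'

theorem fderiv_chartIncl : fderiv ℝ (X.chartIncl p) y =
    chartDeriv (X.incl p) (X.incl ((extChartAt (𝓡 6) p).symm y)) ∘L
      X.pushDeriv ((extChartAt (𝓡 6) p).symm y) ∘L chartSymmDeriv p y := by
  have : IsManifold (𝓡 7) 1 N := IsManifold.of_le (n := ∞) (by norm_cast)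
  have h1 := hasMFDerivAt_extChartAt_symm p hy
  have h2 : HasMFDerivAt (𝓡 6) (𝓡 7) X.incl ((extChartAt (𝓡 6) p).symm y)
      (X.pushDeriv ((extChartAt (𝓡 6) p).symm y)) :=
    ((X.smooth_incl _).mdifferentiableAt (by simp)).hasMFDerivAt
  have h3 : HasMFDerivAt (𝓡 7) (𝓡 7) (extChartAt (𝓡 7) (X.incl p))
      (X.incl ((extChartAt (𝓡 6) p).symm y))
      (chartDeriv (X.incl p) (X.incl ((extChartAt (𝓡 6) p).symm y))) :=
    (mdifferentiableAt_extChartAt (by simpa using hy')).hasMFDerivAt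
  have h4 : HasMFDerivAt (𝓡 6) (𝓡 7) (X.chartIncl p) y
      (chartDeriv (X.incl p) (X.incl ((extChartAt (𝓡 6) p).symm y)) ∘L
        X.pushDeriv ((extChartAt (𝓡 6) p).symm y) ∘L chartSymmDeriv p y) :=
    HasMFDerivAt.comp (f := X.incl ∘ (extChartAt (𝓡 6) p).symm) y h3 (h2.comp y h1)
  have h5 : HasFDerivAt (X.chartIncl p)
      (chartDeriv (X.incl p) (X.incl ((extChartAt (𝓡 6) p).symm y)) ∘L
        X.pushDeriv ((extChartAt (𝓡 6) p).symm y) ∘L chartSymmDeriv p y) y :=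
    hasMFDerivAt_iff_hasFDerivAt.1 h4
  exact h5.fderiv

theorem chartSymmDeriv_comp_fderiv_chartIncl :
    chartSymmDeriv (X.incl p) (X.chartIncl p y) ∘L fderiv ℝ (X.chartIncl p) y =
      X.pushDeriv ((extChartAt (𝓡 6) p).symm y) ∘L chartSymmDeriv p y := by
  have h1 := chartSymmDeriv_comp_chartDeriv (X.incl p) (y := X.chartIncl p y)
    ((extChartAt (𝓡 7) (X.incl p)).map_source hy')
  rw [X.symm_chartIncl hy'] at h1
  rw [X.fderiv_chartIncl hy hy', ← ContinuousLinearMap.comp_assoc, h1,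
    ContinuousLinearMap.id_comp]

omit hy [IsManifold (𝓡 6) ∞ M] in
theorem chartSymmDeriv_chartDeriv_normalVec :
    chartSymmDeriv (X.incl p) (X.chartIncl p y)
      (chartDeriv (X.incl p) (X.incl ((extChartAt (𝓡 6) p).symm y))
        (X.normalVec ((extChartAt (𝓡 6) p).symm y))) =
      X.normalVec ((extChartAt (𝓡 6) p).symm y) := by
  have h1 := chartSymmDeriv_comp_chartDeriv (X.incl p) (y := X.chartIncl p y)
    ((extChartAt (𝓡 7) (X.incl p)).map_source hy')
  rw [X.symm_chartIncl hy'] at h1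
  exact DFunLike.congr_fun h1 _

end OrientedHypersurface
end HypersurfaceChart

section HypersurfaceChartFrame

open scoped RealInnerProductSpace Topology

variable {M : Type*} [TopologicalSpace M] [ChartedSpace (EuclideanSpace ℝ (Fin 6)) M]
  {N : Type*} [TopologicalSpace N] [ChartedSpace (EuclideanSpace ℝ (Fin 7)) N]
  [IsManifold (𝓡 7) ∞ N] {S : G2Structure N} (X : OrientedHypersurface M S)

namespace OrientedHypersurface

/-- The differential of the inclusion in charts, followed by a coframe `C`. -/
def chartFrame (C : EuclideanSpace ℝ (Fin 7) → (EuclideanSpace ℝ (Fin 7) →L[ℝ] EuclideanSpace ℝ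
    (Fin 7)))
    (p : M) (y : EuclideanSpace ℝ (Fin 6)) : EuclideanSpace ℝ (Fin 6) →L[ℝ] EuclideanSpace ℝ (Fin
        7) :=
  C (X.chartIncl p y) ∘L fderiv ℝ (X.chartIncl p) y

/-- The coframe `C` of the ambient manifold and the map `ν` identify the structures near `p`, in the
preferred charts, with the flat `G₂`-structure and the normal vector. -/
structure IsChartFrame (p : M)
    (C : EuclideanSpace ℝ (Fin 7) → (EuclideanSpace ℝ (Fin 7) →L[ℝ] EuclideanSpace ℝ (Fin 7)))
    (ν : EuclideanSpace ℝ (Fin 6) → EuclideanSpace ℝ (Fin 7)) : Prop where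
  differentiableAt_coframe : DifferentiableAt ℝ C (extChartAt (𝓡 7) (X.incl p) (X.incl p))
  differentiableAt_normal : DifferentiableAt ℝ ν (extChartAt (𝓡 6) p p)
  bijective : Function.Bijective (C (extChartAt (𝓡 7) (X.incl p) (X.incl p)))
  map_normal : C (extChartAt (𝓡 7) (X.incl p) (X.incl p)) (X.normalVec p) = ν (extChartAt (𝓡 6) p p)
  ambient : ∀ᶠ z in 𝓝 (extChartAt (𝓡 7) (X.incl p) (X.incl p)),
    (∀ v : Fin 2 → EuclideanSpace ℝ (Fin 7), inChart (X.incl p)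
      (fun q (v : Fin 2 → TangentSpace (𝓡 7) q) => S.g q (v 0) (v 1)) z v = ⟪C z (v 0), C z (v 1)⟫)
          ∧
    ∀ v : Fin 3 → EuclideanSpace ℝ (Fin 7), inChart (X.incl p) S.phi z v =
      ⟪octonionCross (C z (v 0)) (C z (v 1)), C z (v 2)⟫
  metric : ∀ᶠ y in 𝓝 (extChartAt (𝓡 6) p p), ∀ v : Fin 2 → EuclideanSpace ℝ (Fin 6),
    inChart p (fun q (v : Fin 2 → TangentSpace (𝓡 6) q) => X.g q (v 0) (v 1)) y v =
      ⟪X.chartFrame C p y (v 0), X.chartFrame C p y (v 1)⟫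
  kahler : ∀ᶠ y in 𝓝 (extChartAt (𝓡 6) p p), ∀ v : Fin 2 → EuclideanSpace ℝ (Fin 6),
    inChart p (fun q => kahler (X.g q) (X.I q)) y v =
      ⟪octonionCross (ν y) (X.chartFrame C p y (v 1)), X.chartFrame C p y (v 0)⟫
  pullPhi : ∀ᶠ y in 𝓝 (extChartAt (𝓡 6) p p), ∀ v : Fin 3 → EuclideanSpace ℝ (Fin 6),
    inChart p X.pullPhi y v =
      ⟪octonionCross (X.chartFrame C p y (v 0)) (X.chartFrame C p y (v 1)), X.chartFrame C p y (v
          2)⟫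
  pullNStar : ∀ᶠ y in 𝓝 (extChartAt (𝓡 6) p p), ∀ v : Fin 3 → EuclideanSpace ℝ (Fin 6),
    inChart p X.pullNStar y v = crossStar octonionCross (ν y) (X.chartFrame C p y (v 0))
      (X.chartFrame C p y (v 1)) (X.chartFrame C p y (v 2))
  unit : ∀ᶠ y in 𝓝 (extChartAt (𝓡 6) p p), ⟪ν y, ν y⟫ = 1
  orthogonal : ∀ᶠ y in 𝓝 (extChartAt (𝓡 6) p p), ∀ u, ⟪ν y, X.chartFrame C p y u⟫ = 0
  complex : ∃ J : EuclideanSpace ℝ (Fin 6) →ₗ[ℝ] EuclideanSpace ℝ (Fin 6),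
    (∀ x : EuclideanSpace ℝ (Fin 6), X.I p x = J x) ∧
    IsComplexHyperplane octonionCross (X.chartFrame C p (extChartAt (𝓡 6) p p) :
      EuclideanSpace ℝ (Fin 6) →ₗ[ℝ] EuclideanSpace ℝ (Fin 7)) (ν (extChartAt (𝓡 6) p p)) J

variable [IsManifold (𝓡 6) ∞ M]

theorem fderiv_chartIncl_self (p : M) :
    fderiv ℝ (X.chartIncl p) (extChartAt (𝓡 6) p p) = X.pushDeriv p := by
  have h0 := (X.eventually_mem_source p).self_of_nhds
  have h1 := X.chartSymmDeriv_comp_fderiv_chartIncl h0.1 h0.2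
  rw [X.chartIncl_self, chartSymmDeriv_self, chartSymmDeriv_self, extChartAt_to_inv,
    ContinuousLinearMap.id_comp, ContinuousLinearMap.comp_id] at h1
  exact h1

theorem exists_isChartFrame (p : M) : ∃ C ν, X.IsChartFrame p C ν := by
  obtain ⟨c, hc, hC⟩ := S.exists_coframe (X.incl p)
  set x₀ := extChartAt (𝓡 6) p p with hx₀
  set y₀ := extChartAt (𝓡 7) (X.incl p) (X.incl p) with hy₀
  set C : EuclideanSpace ℝ (Fin 7) → (EuclideanSpace ℝ (Fin 7) →L[ℝ] EuclideanSpace ℝ (Fin 7)) :=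
    fun z => c ((extChartAt (𝓡 7) (X.incl p)).symm z) ∘L chartSymmDeriv (X.incl p) z with hCdef
  let n : M → EuclideanSpace ℝ (Fin 7) := fun q =>
    chartDeriv (X.incl p) (X.incl q) (X.normalVec q)
  let ν : EuclideanSpace ℝ (Fin 6) → EuclideanSpace ℝ (Fin 7) := fun y =>
    C (X.chartIncl p y) (n ((extChartAt (𝓡 6) p).symm y))
  have hF0 : X.chartIncl p x₀ = y₀ := X.chartIncl_self p
  have hs0 : (extChartAt (𝓡 6) p).symm x₀ = p := extChartAt_to_inv p
  have hz0 : (extChartAt (𝓡 7) (X.incl p)).symm y₀ = X.incl p := extChartAt_to_inv _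
  have hF : DifferentiableAt ℝ (X.chartIncl p) x₀ :=
    (X.contDiffAt_chartIncl p).differentiableAt (by simp)
  have hn : DifferentiableAt ℝ (fun y => n ((extChartAt (𝓡 6) p).symm y)) x₀ :=
    differentiableAt_comp_chart_symm
      (contMDiffAt_chartDeriv (f := X.incl) (s := X.normalVec) (X.smooth_normal p))
  have hCF : DifferentiableAt ℝ (fun y => C (X.chartIncl p y)) x₀ :=
    DifferentiableAt.comp (g := C) x₀ (by rw [hF0]; exact hC) hF
  have hz := (continuousAt_extChartAt_symm (I := 𝓡 7) (X.incl p)).eventually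
    (p := fun q => (∀ u v : EuclideanSpace ℝ (Fin 7), S.g q u v = ⟪c q u, c q v⟫) ∧
        Function.Bijective (c q) ∧ ∀ v : Fin 3 → EuclideanSpace ℝ (Fin 7),
          S.phi q v = ⟪octonionCross (c q (v 0)) (c q (v 1)), c q (v 2)⟫) (by
      rw [extChartAt_to_inv]; exact hc)
  have hy := (ContinuousAt.comp X.smooth_incl.continuous.continuousAt
    (continuousAt_extChartAt_symm (I := 𝓡 6) p) :
      ContinuousAt (fun y => X.incl ((extChartAt (𝓡 6) p).symm y)) x₀).eventually
    (p := fun q => (∀ u v : EuclideanSpace ℝ (Fin 7), S.g q u v = ⟪c q u, c q v⟫) ∧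
        Function.Bijective (c q) ∧ ∀ v : Fin 3 → EuclideanSpace ℝ (Fin 7),
          S.phi q v = ⟪octonionCross (c q (v 0)) (c q (v 1)), c q (v 2)⟫) (by
      rw [Function.comp_apply, hs0]; exact hc)
  have hframe : ∀ᶠ y in 𝓝 x₀, X.chartFrame C p y =
      c (X.incl ((extChartAt (𝓡 6) p).symm y)) ∘L X.pushDeriv ((extChartAt (𝓡 6) p).symm y) ∘L
        chartSymmDeriv p y := by
    filter_upwards [X.eventually_mem_source p] with y h1
    rw [chartFrame, hCdef, ContinuousLinearMap.comp_assoc,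
      X.chartSymmDeriv_comp_fderiv_chartIncl h1.1 h1.2, X.symm_chartIncl h1.2]
  have hframe' : ∀ᶠ y in 𝓝 x₀, ∀ u, X.chartFrame C p y u =
      c (X.incl ((extChartAt (𝓡 6) p).symm y)) (X.pushDeriv ((extChartAt (𝓡 6) p).symm y)
        (chartSymmDeriv p y u)) := by
    filter_upwards [hframe] with y h1 u
    rw [h1]
    rfl
  have hν : ∀ᶠ y in 𝓝 x₀, ν y = c (X.incl ((extChartAt (𝓡 6) p).symm y))
      (X.normalVec ((extChartAt (𝓡 6) p).symm y)) := by
    filter_upwards [X.eventually_mem_source p] with y h1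
    change c _ (chartSymmDeriv (X.incl p) (X.chartIncl p y) _) = _
    rw [X.chartSymmDeriv_chartDeriv_normalVec h1.2, X.symm_chartIncl h1.2]
  have hC0 : C y₀ = c (X.incl p) := by
    change c ((extChartAt (𝓡 7) (X.incl p)).symm y₀) ∘L chartSymmDeriv (X.incl p) y₀ = _
    rw [hz0, chartSymmDeriv_self, ContinuousLinearMap.comp_id]
  have hc0 := hc.self_of_nhds
  have hν0 : ν x₀ = c (X.incl p) (X.normalVec p) := by
    have h1 := hν.self_of_nhds
    rw [hs0] at h1
    exact h1
  refine ⟨C, ν, hC, hCF.clm_apply hn, by rw [hC0]; exact hc0.2.1, by rw [hC0, hν0], ?_, ?_, ?_, ?_,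
    ?_, ?_, ?_, ?_⟩
  · filter_upwards [hz] with z h1
    exact ⟨fun v => h1.1 _ _, fun v => h1.2.2 _⟩
  · filter_upwards [hy, hframe'] with y h1 h2 v
    rw [h2, h2]
    exact h1.1 _ _
  · filter_upwards [hy, hframe', hν] with y h1 h2 h3 v
    rw [h2, h2, h3]
    exact kahler_eq h1.1 h1.2.1 h1.2.2 fun i => chartSymmDeriv p y (v i)
  · filter_upwards [hy, hframe'] with y h1 h2 v
    rw [h2, h2, h2]
    exact h1.2.2 _
  · filter_upwards [hy, hframe', hν] with y h1 h2 h3 v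
    rw [h2, h2, h2, h3]
    exact pullNStar_eq h1.1 h1.2.1 h1.2.2 fun i => chartSymmDeriv p y (v i)
  · filter_upwards [hy, hν] with y h1 h3
    rw [h3]
    exact (h1.1 _ _).symm.trans (X.normal_unit _)
  · filter_upwards [hy, hframe', hν] with y h1 h2 h3 u
    rw [h2, h3]
    exact (h1.1 _ _).symm.trans (X.normal_orthogonal _ _)
  · have h1 := exists_isComplexHyperplane hc0.1 hc0.2.1 hc0.2.2
    rw [← hν0] at h1
    have h2 : X.chartFrame C p x₀ = c (X.incl p) ∘L X.pushDeriv p := by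
      rw [chartFrame, hF0, hC0, X.fderiv_chartIncl_self]
    rw [h2]
    exact h1

end OrientedHypersurface
end HypersurfaceChartFrame

section CovariantDerivativeInFrame

open scoped RealInnerProductSpace Topology

theorem endAct_two {V : Type*} (A : V → V) (α : (Fin 2 → V) → ℝ) {f : V → V → ℝ}
    (h : ∀ v, α v = f (v 0) (v 1)) (v : Fin 2 → V) :
    endAct A α v = - (f (A (v 0)) (v 1) + f (v 0) (A (v 1))) := by
  simp [endAct, Fin.sum_univ_two, h]

theorem endAct_three {V : Type*} (A : V → V) (α : (Fin 3 → V) → ℝ) {f : V → V → V → ℝ}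
    (h : ∀ v, α v = f (v 0) (v 1) (v 2)) (v : Fin 3 → V) : endAct A α v =
      - (f (A (v 0)) (v 1) (v 2) + f (v 0) (A (v 1)) (v 2) + f (v 0) (v 1) (A (v 2))) := by
  simp [endAct, Fin.sum_univ_three, h]

variable {m : ℕ} {M : Type*} [TopologicalSpace M] [ChartedSpace (EuclideanSpace ℝ (Fin m)) M]
  [IsManifold (𝓡 m) ∞ M] {E : Type*} [NormedAddCommGroup E] [InnerProductSpace ℝ E]
  {P : E →L[ℝ] E →L[ℝ] E}

theorem covDeriv_eq {g : ∀ q : M, TangentSpace (𝓡 m) q → TangentSpace (𝓡 m) q → ℝ} {p : M}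
    {G : EuclideanSpace ℝ (Fin m) → EuclideanSpace ℝ (Fin m) → EuclideanSpace ℝ (Fin m)}
    (hG : ∀ X Y, christoffel g p X Y = G X Y) {k : ℕ}
    {α : ∀ q : M, (Fin k → TangentSpace (𝓡 m) q) → ℝ}
    {f : EuclideanSpace ℝ (Fin m) → (Fin k → EuclideanSpace ℝ (Fin m)) → ℝ}
    (hα : ∀ᶠ y in 𝓝 (extChartAt (𝓡 m) p p), ∀ v, inChart p α y v = f y v)
    (X : EuclideanSpace ℝ (Fin m)) (v : Fin k → EuclideanSpace ℝ (Fin m)) :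
    covDeriv g α p X v = fderiv ℝ (fun y => f y v) (extChartAt (𝓡 m) p p) X
      + endAct (G X) (f (extChartAt (𝓡 m) p p)) v := by
  have h1 : coordDeriv p α X v = fderiv ℝ (fun y => f y v) (extChartAt (𝓡 m) p p) X :=
    coordDeriv_eq_of_eventuallyEq (hα.mono fun y hy => hy v) X
  have h2 : α p = f (extChartAt (𝓡 m) p p) := funext fun w =>
    (inChart_self p (fun q (v : Fin k → EuclideanSpace ℝ (Fin m)) => α q v) w).symm.trans
      (hα.self_of_nhds w)
  have h3 : endAct (christoffel g p X) (α p) v =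
      endAct (G X) (f (extChartAt (𝓡 m) p p)) v := by
    have h4 : christoffel g p X = G X := funext fun Y => hG X Y
    rw [h2, h4]; rfl
  exact congrArg₂ (· + ·) h1 h3

variable {g : ∀ q : M, TangentSpace (𝓡 m) q → TangentSpace (𝓡 m) q → ℝ} {p : M}

section

variable {G : EuclideanSpace ℝ (Fin m) → EuclideanSpace ℝ (Fin m) → EuclideanSpace ℝ (Fin m)}
  {D : EuclideanSpace ℝ (Fin m) → EuclideanSpace ℝ (Fin m) → E}
  {e : EuclideanSpace ℝ (Fin m) → (EuclideanSpace ℝ (Fin m) →L[ℝ] E)}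
  {ν : EuclideanSpace ℝ (Fin m) → E} {x₀ : EuclideanSpace ℝ (Fin m)}
  (hx₀ : extChartAt (𝓡 m) p p = x₀)
  (hG : ∀ X Y, christoffel g p X Y = G X Y) (he : DifferentiableAt ℝ e x₀)
  (hD : ∀ X u, fderiv ℝ e x₀ X u = D X u + e x₀ (G X u))
include hx₀ hG he hD

theorem covDeriv_cross {α : ∀ q : M, (Fin 3 → TangentSpace (𝓡 m) q) → ℝ}
    (hα : ∀ᶠ y in 𝓝 x₀, ∀ v : Fin 3 → EuclideanSpace ℝ (Fin m),
      inChart p α y v = ⟪P (e y (v 0)) (e y (v 1)), e y (v 2)⟫)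
    (X : EuclideanSpace ℝ (Fin m)) (v : Fin 3 → EuclideanSpace ℝ (Fin m)) :
    covDeriv g α p X v = ⟪P (D X (v 0)) (e x₀ (v 1)), e x₀ (v 2)⟫
      + ⟪P (e x₀ (v 0)) (D X (v 1)), e x₀ (v 2)⟫ + ⟪P (e x₀ (v 0)) (e x₀ (v 1)), D X (v 2)⟫ := by
  subst hx₀
  rw [covDeriv_eq hG hα, endAct_three (G X) _ (f := fun a b c => ⟪P (e _ a) (e _ b), e _ c⟫)
    fun _ => rfl]
  have h := fun i => fderiv_clm_const_apply he (v i) X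
  rw [fderiv_inner_cross_apply (h 0).1 (h 1).1 (h 2).1, (h 0).2, (h 1).2, (h 2).2]
  simp only [hD, map_add, add_apply, inner_add_left, inner_add_right]
  ring

theorem covDeriv_normal_cross (hν : DifferentiableAt ℝ ν x₀)
    {α : ∀ q : M, (Fin 2 → TangentSpace (𝓡 m) q) → ℝ}
    (hα : ∀ᶠ y in 𝓝 x₀, ∀ v : Fin 2 → EuclideanSpace ℝ (Fin m),
      inChart p α y v = ⟪P (ν y) (e y (v 1)), e y (v 0)⟫)
    (X : EuclideanSpace ℝ (Fin m)) (v : Fin 2 → EuclideanSpace ℝ (Fin m)) :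
    covDeriv g α p X v = ⟪P (fderiv ℝ ν x₀ X) (e x₀ (v 1)), e x₀ (v 0)⟫
      + ⟪P (ν x₀) (D X (v 1)), e x₀ (v 0)⟫ + ⟪P (ν x₀) (e x₀ (v 1)), D X (v 0)⟫ := by
  subst hx₀
  rw [covDeriv_eq hG hα, endAct_two (G X) _ (f := fun a b => ⟪P (ν _) (e _ b), e _ a⟫)
    fun _ => rfl]
  have h := fun i => fderiv_clm_const_apply he (v i) X
  rw [fderiv_inner_cross_apply hν (h 1).1 (h 0).1, (h 0).2, (h 1).2]
  simp only [hD, map_add, inner_add_left, inner_add_right]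
  ring

theorem covDeriv_normal_crossStar (hν : DifferentiableAt ℝ ν x₀)
    {α : ∀ q : M, (Fin 3 → TangentSpace (𝓡 m) q) → ℝ}
    (hα : ∀ᶠ y in 𝓝 x₀, ∀ v : Fin 3 → EuclideanSpace ℝ (Fin m),
      inChart p α y v = crossStar P (ν y) (e y (v 0)) (e y (v 1)) (e y (v 2)))
    (X : EuclideanSpace ℝ (Fin m)) (v : Fin 3 → EuclideanSpace ℝ (Fin m)) :
    covDeriv g α p X v = crossStar P (fderiv ℝ ν x₀ X) (e x₀ (v 0)) (e x₀ (v 1)) (e x₀ (v 2))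
      + crossStar P (ν x₀) (D X (v 0)) (e x₀ (v 1)) (e x₀ (v 2))
      + crossStar P (ν x₀) (e x₀ (v 0)) (D X (v 1)) (e x₀ (v 2))
      + crossStar P (ν x₀) (e x₀ (v 0)) (e x₀ (v 1)) (D X (v 2)) := by
  subst hx₀
  rw [covDeriv_eq hG hα, endAct_three (G X) _
    (f := fun a b c => crossStar P (ν _) (e _ a) (e _ b) (e _ c)) fun _ => rfl]
  have h := fun i => fderiv_clm_const_apply he (v i) X
  rw [fderiv_crossStar_apply hν (h 0).1 (h 1).1 (h 2).1, (h 0).2, (h 1).2, (h 2).2]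
  simp only [hD, crossStar, map_add, add_apply, inner_add_left, inner_add_right]
  ring

end

end CovariantDerivativeInFrame

section AmbientConnection

open scoped RealInnerProductSpace Topology

theorem rBar_eq {E : Type*} [NormedAddCommGroup E] [InnerProductSpace ℝ E] {V : Type*}
    [AddCommGroup V] [Module ℝ V] [FiniteDimensional ℝ V] {P : E →L[ℝ] E →L[ℝ] E}
    {g : V → V → ℝ} {φ : (Fin 3 → V) → ℝ} {c : V →ₗ[ℝ] E} (hP : IsCrossProduct P)
    (hc : Function.Bijective c) (hg : ∀ x y, g x y = ⟪c x, c y⟫)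
    (hφ : ∀ v, φ v = ⟪P (c (v 0)) (c (v 1)), c (v 2)⟫) (hm : Module.finrank ℝ V = 7)
    {α : V → (Fin 3 → V) → ℝ} {s : V → E}
    (hα : ∀ x v, α x v = crossStar P (s x) (c (v 0)) (c (v 1)) (c (v 2))) (x y : V) :
    rBar g φ α x y = ⟪s x, c y⟫ := by
  obtain rfl : g = fun x y => ⟪c x, c y⟫ := funext fun x => funext fun y => hg x y
  have hfd : FiniteDimensional ℝ E := Module.Finite.of_surjective c hc.2
  have hE : Module.finrank ℝ E = 7 := (LinearEquiv.ofBijective c hc).finrank_eq.symm.trans hm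
  have ho := isOrthonormalTuple_orthoBasis hc.1 hm
  set o := orthoBasis 7 fun x y => ⟪c x, c y⟫ with hodef
  have hon : Orthonormal ℝ fun i => c (o i) := orthonormal_iff_ite.2 fun i j => by
    simpa using ho i j
  let b : OrthonormalBasis (Fin 7) ℝ E := OrthonormalBasis.mk hon
    (hon.linearIndependent.span_eq_top_of_card_eq_finrank (by simp [hE])).ge
  have hb : ∀ i, b i = c (o i) := fun i => by simp [b]
  have h1 := hP.sum_star_mul_star b (s x) (c y)
  simp only [hb] at h1
  rw [rBar, formInner_three]
  simp only [hα, interiorProd, starPhi_eq_crossStar hP hc hg hφ]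
  refine Eq.trans ?_ (show 1 / 4 * (1 / 6 * (24 * ⟪s x, c y⟫)) = _ by ring)
  rw [← h1]
  rfl

variable {N : Type*} [TopologicalSpace N] [ChartedSpace (EuclideanSpace ℝ (Fin 7)) N]
  [IsManifold (𝓡 7) ∞ N] {S : G2Structure N} {q : N}
  {C : EuclideanSpace ℝ (Fin 7) → (EuclideanSpace ℝ (Fin 7) →L[ℝ] EuclideanSpace ℝ (Fin 7))}

/-- The connection form of the Levi-Civita connection in a coframe which identifies the
`G₂`-structure with the flat one; for a nearly parallel structure its action on the three-form is
a multiple of the four-form. -/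
theorem G2Structure.exists_connection_form {k : ℝ} (hk : ∀ p x y, S.r p x y = k / 4 * S.g p x y)
    (hC : DifferentiableAt ℝ C (extChartAt (𝓡 7) q q))
    (hbij : Function.Bijective (C (extChartAt (𝓡 7) q q)))
    (hS : ∀ᶠ z in 𝓝 (extChartAt (𝓡 7) q q),
      (∀ v : Fin 2 → EuclideanSpace ℝ (Fin 7), inChart q
        (fun q (v : Fin 2 → TangentSpace (𝓡 7) q) => S.g q (v 0) (v 1)) z v =
          ⟪C z (v 0), C z (v 1)⟫) ∧
      ∀ v : Fin 3 → EuclideanSpace ℝ (Fin 7), inChart q S.phi z v =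
        ⟪octonionCross (C z (v 0)) (C z (v 1)), C z (v 2)⟫) :
    ∃ (G : EuclideanSpace ℝ (Fin 7) →ₗ[ℝ] EuclideanSpace ℝ (Fin 7) →ₗ[ℝ] EuclideanSpace ℝ (Fin 7))
      (a : EuclideanSpace ℝ (Fin 7) → EuclideanSpace ℝ (Fin 7) →ₗ[ℝ] EuclideanSpace ℝ (Fin 7)),
      (∀ U V, christoffel S.g q U V = G U V) ∧ (∀ U V, G U V = G V U) ∧
      (∀ U V, fderiv ℝ C (extChartAt (𝓡 7) q q) U V = a U (C (extChartAt (𝓡 7) q q) V)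
        + C (extChartAt (𝓡 7) q q) (G U V)) ∧
      (∀ U x y, ⟪a U x, y⟫ = - ⟪x, a U y⟫) ∧
      ∀ U x y z, ⟪octonionCross (a U x) y, z⟫ + ⟪octonionCross x (a U y), z⟫
        + ⟪octonionCross x y, a U z⟫ =
          crossStar octonionCross ((k / 4) • C (extChartAt (𝓡 7) q q) U) x y z := by
  obtain ⟨G, hG, hGs, hGm⟩ := exists_christoffel hC hbij.1 (hS.mono fun z h => h.1)
  set y₀ := extChartAt (𝓡 7) q q with hy₀
  let c : EuclideanSpace ℝ (Fin 7) →ₗ[ℝ] EuclideanSpace ℝ (Fin 7) := C y₀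
  let c' := LinearEquiv.ofBijective c hbij
  have hc' : ∀ w, C y₀ (c'.symm w) = w := fun w => c'.apply_symm_apply w
  have hc'' : ∀ w, c'.symm (C y₀ w) = w := fun w => c'.symm_apply_apply w
  let a : EuclideanSpace ℝ (Fin 7) → EuclideanSpace ℝ (Fin 7) →ₗ[ℝ] EuclideanSpace ℝ (Fin 7) :=
    fun U => ((fderiv ℝ C y₀ U : _ →L[ℝ] _) : EuclideanSpace ℝ (Fin 7) →ₗ[ℝ] _) ∘ₗ
      (c'.symm : EuclideanSpace ℝ (Fin 7) →ₗ[ℝ] _) - c ∘ₗ G U ∘ₗ (c'.symm : _ →ₗ[ℝ] _)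
  have ha : ∀ U w, a U w = fderiv ℝ C y₀ U (c'.symm w) - C y₀ (G U (c'.symm w)) := fun _ _ => rfl
  have hD : ∀ U V, fderiv ℝ C y₀ U V = a U (C y₀ V) + C y₀ (G U V) := fun U V => by
    rw [ha, hc'']
    abel
  have hskew : ∀ U x y, ⟪a U x, y⟫ = - ⟪x, a U y⟫ := fun U x y => by
    have h1 := hGm U (c'.symm x) (c'.symm y)
    rw [hc', hc'] at h1
    rw [ha, ha, inner_sub_left, inner_sub_right]
    linarith
  have hP := isCrossProduct_octonionCross
  choose s hs using fun U => hP.exists_star_eq_of_skew (EuclideanSpace.basisFun (Fin 7) ℝ) (a U)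
    (hskew U)
  have hcov : ∀ (U : EuclideanSpace ℝ (Fin 7)) (v : Fin 3 → EuclideanSpace ℝ (Fin 7)),
      covDeriv S.g S.phi q U v =
        crossStar octonionCross (s U) (C y₀ (v 0)) (C y₀ (v 1)) (C y₀ (v 2)) := fun U v =>
    (covDeriv_cross (P := octonionCross) hy₀.symm hG hC hD (hS.mono fun z h => h.2) U v).trans
      (hs U _ _ _)
  have hgq : ∀ u v : EuclideanSpace ℝ (Fin 7), S.g q u v = ⟪C y₀ u, C y₀ v⟫ := fun u v =>
    (inChart_self q (fun q (v : Fin 2 → EuclideanSpace ℝ (Fin 7)) => S.g q (v 0) (v 1))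
      ![u, v]).symm.trans (hS.self_of_nhds.1 ![u, v])
  have hφq : ∀ v : Fin 3 → EuclideanSpace ℝ (Fin 7), S.phi q v =
      ⟪octonionCross (C y₀ (v 0)) (C y₀ (v 1)), C y₀ (v 2)⟫ := fun v =>
    (inChart_self q (fun q (v : Fin 3 → EuclideanSpace ℝ (Fin 7)) => S.phi q v) v).symm.trans
      (hS.self_of_nhds.2 v)
  have hr : ∀ U V : EuclideanSpace ℝ (Fin 7), S.r q U V = ⟪s U, C y₀ V⟫ := fun U V =>
    rBar_eq (c := c) (V := EuclideanSpace ℝ (Fin 7)) hP hbij hgq hφq (by simp) hcov U V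
  have hsU : ∀ U, s U = (k / 4) • C y₀ U := fun U => ext_inner_right ℝ fun w => by
    obtain ⟨V, rfl⟩ := hbij.2 w
    rw [← hr, inner_smul_left, conj_trivial, ← hgq]
    exact hk q U V
  refine ⟨G, a, hG, hGs, hD, hskew, fun U x y z => ?_⟩
  rw [hs, hsU]

end AmbientConnection

section StructureEquations

open scoped RealInnerProductSpace Topology

variable {M : Type*} [TopologicalSpace M] [ChartedSpace (EuclideanSpace ℝ (Fin 6)) M]
  {N : Type*} [TopologicalSpace N] [ChartedSpace (EuclideanSpace ℝ (Fin 7)) N]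
  [IsManifold (𝓡 7) ∞ N] {S : G2Structure N} (X : OrientedHypersurface M S)

namespace OrientedHypersurface

/-- The structure equations at `p` of a hypersurface with shape operator `A` in a nearly parallel
`G₂`-manifold. -/
structure IsStructureFrame (p : M) (κ : ℝ)
    (e : EuclideanSpace ℝ (Fin 6) →ₗ[ℝ] EuclideanSpace ℝ (Fin 7)) (ν : EuclideanSpace ℝ (Fin 7))
    (J A : EuclideanSpace ℝ (Fin 6) →ₗ[ℝ] EuclideanSpace ℝ (Fin 6)) : Prop where
  complex : IsComplexHyperplane octonionCross e ν J
  I_eq : ∀ x : EuclideanSpace ℝ (Fin 6), X.I p x = J x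
  g_eq : ∀ x y : EuclideanSpace ℝ (Fin 6), X.g p x y = ⟪e x, e y⟫
  pullPhi_eq : ∀ v : Fin 3 → EuclideanSpace ℝ (Fin 6),
    X.pullPhi p v = ⟪octonionCross (e (v 0)) (e (v 1)), e (v 2)⟫
  pullNStar_eq : ∀ v : Fin 3 → EuclideanSpace ℝ (Fin 6),
    X.pullNStar p v = crossStar octonionCross ν (e (v 0)) (e (v 1)) (e (v 2))
  B_eq : ∀ x y : EuclideanSpace ℝ (Fin 6), X.B p x y = ⟪e (A x), e y⟫
  symm : ∀ x y, ⟪e (A x), e y⟫ = ⟪e x, e (A y)⟫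
  covDeriv_kahler : ∀ (x : EuclideanSpace ℝ (Fin 6)) (v : Fin 2 → EuclideanSpace ℝ (Fin 6)),
    covDeriv X.g (fun q => kahler (X.g q) (X.I q)) p x v =
      ⟪octonionCross (e (A x - κ • J x)) (e (v 0)), e (v 1)⟫
  covDeriv_pullPhi : ∀ (x : EuclideanSpace ℝ (Fin 6)) (v : Fin 3 → EuclideanSpace ℝ (Fin 6)),
    covDeriv X.g X.pullPhi p x v =
      κ * crossStar octonionCross (e x) (e (v 0)) (e (v 1)) (e (v 2))
      + ⟪e (A x), e (v 0)⟫ * ⟪octonionCross ν (e (v 1)), e (v 2)⟫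
      + ⟪e (A x), e (v 1)⟫ * ⟪octonionCross (e (v 0)) ν, e (v 2)⟫
      + ⟪e (A x), e (v 2)⟫ * ⟪octonionCross (e (v 0)) (e (v 1)), ν⟫
  covDeriv_pullNStar : ∀ (x : EuclideanSpace ℝ (Fin 6)) (v : Fin 3 → EuclideanSpace ℝ (Fin 6)),
    covDeriv X.g X.pullNStar p x v =
      κ * (crossStar octonionCross (octonionCross (e (v 1)) (e (v 2))) ν (e (v 0)) (e x)
        + crossStar octonionCross (octonionCross ν (e (v 0))) (e (v 1)) (e (v 2)) (e x))
      - crossStar octonionCross (e (A x)) (e (v 0)) (e (v 1)) (e (v 2))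

variable [IsManifold (𝓡 6) ∞ M]

theorem fderiv_chartFrame {C : EuclideanSpace ℝ (Fin 7) → (EuclideanSpace ℝ (Fin 7) →L[ℝ]
    EuclideanSpace ℝ (Fin 7))}
    (p : M) (hC : DifferentiableAt ℝ C (extChartAt (𝓡 7) (X.incl p) (X.incl p))) :
    DifferentiableAt ℝ (X.chartFrame C p) (extChartAt (𝓡 6) p p) ∧
    ∀ x u, fderiv ℝ (X.chartFrame C p) (extChartAt (𝓡 6) p p) x u =
      fderiv ℝ C (extChartAt (𝓡 7) (X.incl p) (X.incl p)) (X.pushDeriv p x) (X.pushDeriv p u)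
      + C (extChartAt (𝓡 7) (X.incl p) (X.incl p)) (X.hessian p x u) := by
  set x₀ := extChartAt (𝓡 6) p p with hx₀
  have hF0 : X.chartIncl p x₀ = extChartAt (𝓡 7) (X.incl p) (X.incl p) := X.chartIncl_self p
  have hF := X.contDiffAt_chartIncl p
  have h1 : DifferentiableAt ℝ (fderiv ℝ (X.chartIncl p)) x₀ :=
    (hF.fderiv_right (m := 1) (by norm_cast)).differentiableAt (by simp)
  have h2 := (hF.differentiableAt (by simp)).hasFDerivAt
  rw [X.fderiv_chartIncl_self] at h2
  have h3 : HasFDerivAt (fun y => C (X.chartIncl p y))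
      (fderiv ℝ C (extChartAt (𝓡 7) (X.incl p) (X.incl p)) ∘L X.pushDeriv p) x₀ :=
    HasFDerivAt.comp (g := C) x₀ (by rw [hF0]; exact hC.hasFDerivAt) h2
  have h4 := h3.clm_comp h1.hasFDerivAt
  refine ⟨h4.differentiableAt, fun x u => ?_⟩
  have h5 : X.hessian p x u = fderiv ℝ (fderiv ℝ (X.chartIncl p)) x₀ x u :=
    (fderiv_clm_const_apply h1 u x).2
  have h6 : fderiv ℝ (X.chartFrame C p) x₀ x u =
      fderiv ℝ C (extChartAt (𝓡 7) (X.incl p) (X.incl p)) (X.pushDeriv p x)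
        (fderiv ℝ (X.chartIncl p) x₀ u)
      + C (X.chartIncl p x₀) (fderiv ℝ (fderiv ℝ (X.chartIncl p)) x₀ x u) :=
    (congrArg (fun L => L x u) h4.fderiv).trans (add_comm _ _)
  rw [X.fderiv_chartIncl_self, hF0] at h6
  exact h6.trans (congrArg (fun w => _ + C _ w) h5.symm)

omit [IsManifold (𝓡 6) ∞ M] in
theorem exists_hessian (p : M) : ∃ H : EuclideanSpace ℝ (Fin 6) →L[ℝ] EuclideanSpace ℝ (Fin 6) →L[ℝ]
    EuclideanSpace ℝ (Fin 7), (∀ x u, X.hessian p x u = H x u) ∧ ∀ x u, H x u = H u x := by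
  have hF := X.contDiffAt_chartIncl p
  have h1 : DifferentiableAt ℝ (fderiv ℝ (X.chartIncl p)) (extChartAt (𝓡 6) p p) :=
    (hF.fderiv_right (m := 1) (by norm_cast)).differentiableAt (by simp)
  have h2 : IsSymmSndFDerivAt ℝ (X.chartIncl p) (extChartAt (𝓡 6) p p) :=
    hF.isSymmSndFDerivAt (by simp only [minSmoothness_of_isRCLikeNormedField]; norm_cast)
  exact ⟨_, fun x u => (fderiv_clm_const_apply h1 u x).2, h2⟩

end OrientedHypersurface
end StructureEquations

section StructureEquationsProof

open scoped RealInnerProductSpace Topology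

theorem IsComplexHyperplane.eq_smul_normal {E : Type*} [NormedAddCommGroup E]
    [InnerProductSpace ℝ E] {V : Type*} [AddCommGroup V] [Module ℝ V] {P : E →L[ℝ] E →L[ℝ] E}
    {e : V →ₗ[ℝ] E} {ν : E} {I : V →ₗ[ℝ] V} (h : IsComplexHyperplane P e ν I) {w : E}
    (hw : ∀ v, ⟪w, e v⟫ = 0) : w = ⟪w, ν⟫ • ν := by
  obtain ⟨t, ht⟩ := h.exists_tangential w
  have h1 : ⟪e t, e t⟫ = 0 := by
    conv_lhs => rw [ht, inner_sub_left, inner_smul_left, ← ht, hw, h.orthogonal]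
    simp
  rw [inner_self_eq_zero, ht, sub_eq_zero, real_inner_comm] at h1
  exact h1

namespace IsComplexHyperplane

variable {E : Type*} [NormedAddCommGroup E] [InnerProductSpace ℝ E] {V : Type*} [AddCommGroup V]
  [Module ℝ V] {P : E →L[ℝ] E →L[ℝ] E} {e : V →ₗ[ℝ] E} {ν n : E} {I : V →ₗ[ℝ] V}
  (h : IsComplexHyperplane P e ν I) {a : E →ₗ[ℝ] E} {κ : ℝ} {x b : V}
  (ha : ∀ u v w, ⟪P (a u) v, w⟫ + ⟪P u (a v), w⟫ + ⟪P u v, a w⟫ = crossStar P (κ • e x) u v w)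
include h ha

theorem derivation_kahler (hn : n = a ν - e b) (c d : ℝ) (y z : V) :
    ⟪P n (e z), e y⟫ + ⟪P ν (a (e z) + c • ν), e y⟫ + ⟪P ν (e z), a (e y) + d • ν⟫ =
      ⟪P (e (b - κ • I x)) (e y), e z⟫ := by
  have h1 := ha ν (e z) (e y)
  rw [IsCrossProduct.star_smul_left, h.cross.star_swap12, h.cross.star_swap34, h.star_normal] at h1
  have h2 : ⟪P ν (e z), ν⟫ = 0 := by rw [← h.map_I, real_inner_comm, h.orthogonal]
  have h3 := h.cross.inner_right_swap (e b) (e z) (e y)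
  simp only [hn, map_sub, map_add, map_smul, sub_apply, smul_apply, inner_sub_left, inner_add_left,
    inner_add_right, real_inner_smul_left, real_inner_smul_right, h.cross.self, inner_zero_left, h2]
  linarith

omit h in
theorem derivation_phi (c₁ c₂ c₃ : ℝ) (y z w : V) :
    ⟪P (a (e y) + c₁ • ν) (e z), e w⟫ + ⟪P (e y) (a (e z) + c₂ • ν), e w⟫
      + ⟪P (e y) (e z), a (e w) + c₃ • ν⟫ =
    κ * crossStar P (e x) (e y) (e z) (e w) + c₁ * ⟪P ν (e z), e w⟫ + c₂ * ⟪P (e y) ν, e w⟫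
      + c₃ * ⟪P (e y) (e z), ν⟫ := by
  rw [← IsCrossProduct.star_smul_left, ← ha]
  simp only [map_add, map_smul, add_apply, smul_apply, inner_add_left,
    inner_add_right, real_inner_smul_left, real_inner_smul_right]
  ring

theorem derivation_star (hsk : ∀ x y, ⟪a x, y⟫ = - ⟪x, a y⟫) (hn : n = a ν - e b) (c₁ c₂ c₃ : ℝ)
    (y z w : V) :
    crossStar P n (e y) (e z) (e w) + crossStar P ν (a (e y) + c₁ • ν) (e z) (e w)
      + crossStar P ν (e y) (a (e z) + c₂ • ν) (e w) + crossStar P ν (e y) (e z) (a (e w) + c₃ • ν)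
          =
    κ * (crossStar P (P (e z) (e w)) ν (e y) (e x) + crossStar P (P ν (e y)) (e z) (e w) (e x))
      - crossStar P (e b) (e y) (e z) (e w) := by
  have h1 := h.cross.star_derivation hsk ha ν (e y) (e z) (e w)
  have h2 : crossStar P ν ν (e z) (e w) = 0 := h.cross.star_zero12 _ _ _
  have h3 : crossStar P ν (e y) ν (e w) = 0 := by
    rw [h.cross.star_swap23, h.cross.star_zero12, neg_zero]
  have h4 : crossStar P ν (e y) (e z) ν = 0 := by
    rw [h.cross.star_swap34, h.cross.star_swap23, h.cross.star_zero12, neg_zero, neg_zero]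
  rw [hn]
  linear_combination (norm := skip) h1 + c₁ * h2 + c₂ * h3 + c₃ * h4
  simp only [crossStar, map_add, map_sub, map_smul, add_apply, sub_apply, smul_apply,
    inner_add_left, inner_add_right, inner_sub_left, inner_sub_right, real_inner_smul_left,
    real_inner_smul_right]
  ring

end IsComplexHyperplane

variable {M : Type*} [TopologicalSpace M] [ChartedSpace (EuclideanSpace ℝ (Fin 6)) M]
  [IsManifold (𝓡 6) ∞ M]
  {N : Type*} [TopologicalSpace N] [ChartedSpace (EuclideanSpace ℝ (Fin 7)) N]
  [IsManifold (𝓡 7) ∞ N] {S : G2Structure N} (X : OrientedHypersurface M S)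

namespace OrientedHypersurface

theorem exists_isStructureFrame {k : ℝ} (hk : ∀ p x y, S.r p x y = k / 4 * S.g p x y) (p : M) :
    ∃ e ν J A, X.IsStructureFrame p (k / 4) e ν J A := by
  obtain ⟨C, ν, fr⟩ := X.exists_isChartFrame p
  obtain ⟨G₇, a, hG₇, hG₇s, haC, hskew, hder⟩ := S.exists_connection_form hk
    fr.differentiableAt_coframe fr.bijective fr.ambient
  obtain ⟨J, hJ, h⟩ := fr.complex
  obtain ⟨hed, he'⟩ := X.fderiv_chartFrame p fr.differentiableAt_coframe
  obtain ⟨G, hG, hGs, hGm⟩ := exists_christoffel hed h.injective fr.metric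
  obtain ⟨H, hH, hHs⟩ := X.exists_hessian p
  have hP := isCrossProduct_octonionCross
  have hn0 := fr.map_normal
  have hnd := fr.differentiableAt_normal
  have hpush : ∀ u, C (extChartAt (𝓡 7) (X.incl p) (X.incl p)) (X.pushDeriv p u) =
      X.chartFrame C p (extChartAt (𝓡 6) p p) u := fun u => by
    rw [chartFrame, X.chartIncl_self, X.fderiv_chartIncl_self]; rfl
  set x₀ := extChartAt (𝓡 6) p p with hx₀
  set y₀ := extChartAt (𝓡 7) (X.incl p) (X.incl p) with hy₀
  set e := X.chartFrame C p x₀ with he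
  let Q : EuclideanSpace ℝ (Fin 6) → EuclideanSpace ℝ (Fin 6) → EuclideanSpace ℝ (Fin 7) :=
    fun x u => C y₀ (H x u + G₇ (X.pushDeriv p x) (X.pushDeriv p u)) - e (G x u)
  have hQ : ∀ x u, Q x u = C y₀ (H x u + G₇ (X.pushDeriv p x) (X.pushDeriv p u)) - e (G x u) :=
    fun _ _ => rfl
  have hDe : ∀ x u, fderiv ℝ (X.chartFrame C p) x₀ x u =
      a (X.pushDeriv p x) (e u) + Q x u + e (G x u) := fun x u => by
    have h1 := (he' x u).trans (congrArg (fun w => _ + C y₀ w) (hH x u))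
    rw [haC, hpush] at h1
    rw [h1, hQ, map_add]
    abel
  have hQs : ∀ x u, Q x u = Q u x := fun x u => by rw [hQ, hQ, hHs, hG₇s, hGs]
  have hQt : ∀ x u v, ⟪Q x u, e v⟫ = - ⟪Q x v, e u⟫ := fun x u v => by
    have h1 := hGm x u v
    rw [hDe, hDe] at h1
    simp only [inner_add_left, inner_add_right] at h1
    linarith [hskew (X.pushDeriv p x) (e u) (e v), real_inner_comm (e u) (Q x v)]
  have hQ0 : ∀ x u v, ⟪Q x u, e v⟫ = 0 := fun x u v => by
    have h1 := hQt x u v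
    have h2 := hQt v x u
    have h3 := hQt u v x
    rw [hQs x v] at h1
    rw [hQs v u] at h2
    rw [hQs u x] at h3
    linarith
  let B : EuclideanSpace ℝ (Fin 6) → EuclideanSpace ℝ (Fin 6) → ℝ := fun x u => ⟪Q x u, ν x₀⟫
  have hQB : ∀ x u, Q x u = B x u • ν x₀ := fun x u => h.eq_smul_normal (hQ0 x u)
  have horth : ∀ u, ⟪ν x₀, e u⟫ = 0 := h.orthogonal
  have horth' : ∀ u, ⟪e u, ν x₀⟫ = 0 := fun u => by rw [real_inner_comm, horth]
  have hB : ∀ x u, B x u = ⟪C y₀ (H x u + G₇ (X.pushDeriv p x) (X.pushDeriv p u)), ν x₀⟫ :=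
    fun x u => by
      change ⟪Q x u, ν x₀⟫ = _
      rw [hQ, inner_sub_left, horth', sub_zero]
  have hBs : ∀ x u, B x u = B u x := fun x u => congrArg (fun w => ⟪w, ν x₀⟫) (hQs x u)
  have hn1 : ∀ x, ⟪fderiv ℝ ν x₀ x, ν x₀⟫ = 0 := fun x => by
    have h1 := fderiv_inner_apply ℝ hnd hnd x
    have h2 : fderiv ℝ (fun y => ⟪ν y, ν y⟫) x₀ = 0 := by
      rw [Filter.EventuallyEq.fderiv_eq (f := fun _ => (1 : ℝ)) fr.unit]
      simp
    rw [h2, zero_apply, real_inner_comm] at h1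
    linarith
  have hn2 : ∀ x u, ⟪fderiv ℝ ν x₀ x, e u⟫ = - B x u - ⟪ν x₀, a (X.pushDeriv p x) (e u)⟫ :=
    fun x u => by
      have h0 := fderiv_clm_const_apply hed u x
      have h1 := fderiv_inner_apply ℝ hnd h0.1 x
      have h2 : fderiv ℝ (fun y => ⟪ν y, X.chartFrame C p y u⟫) x₀ = 0 := by
        rw [Filter.EventuallyEq.fderiv_eq (f := fun _ => (0 : ℝ))
          (fr.orthogonal.mono fun y hy => hy u)]
        simp
      rw [h2, zero_apply, h0.2, hDe, hQB, inner_add_right, inner_add_right, inner_smul_right,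
        h.unit, horth] at h1
      linarith
  choose A₀ hA₀ using fun x => h.exists_eq (a (X.pushDeriv p x) (ν x₀) - fderiv ℝ ν x₀ x) (by
    rw [inner_sub_right, ← real_inner_comm _ (fderiv ℝ ν x₀ x), hn1]
    have h1 := hskew (X.pushDeriv p x) (ν x₀) (ν x₀)
    rw [← real_inner_comm] at h1
    linarith)
  have hAB : ∀ x u, ⟪e (A₀ x), e u⟫ = B x u := fun x u => by
    have h1 : e (A₀ x) = _ := hA₀ x
    rw [h1, inner_sub_left, hn2, hskew]
    ring
  let A : EuclideanSpace ℝ (Fin 6) →ₗ[ℝ] EuclideanSpace ℝ (Fin 6) :=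
    { toFun := A₀
      map_add' := fun x y => h.eq_of_inner _ _ fun z => by
        change ⟪e _, e z⟫ = ⟪e _, e z⟫
        rw [hAB, map_add, inner_add_left, hAB, hAB, hB, hB, hB, ← inner_add_left, ← map_add]
        congr 2
        simp only [map_add, add_apply, LinearMap.add_apply]
        abel
      map_smul' := fun r x => h.eq_of_inner _ _ fun z => by
        change ⟪e _, e z⟫ = ⟪e _, e z⟫
        rw [hAB, RingHom.id_apply, map_smul, inner_smul_left, hAB, hB, hB, conj_trivial,
          ← real_inner_smul_left, ← map_smul]
        congr 2
        simp only [map_smul, smul_apply, LinearMap.smul_apply, smul_add] }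
  have hA : ∀ x, A x = A₀ x := fun _ => rfl
  have hn : ∀ x, fderiv ℝ ν x₀ x = a (X.pushDeriv p x) (ν x₀) - e (A x) := fun x => by
    have h1 : e (A x) = _ := hA₀ x
    rw [h1]
    abel
  have hD : ∀ x u, fderiv ℝ (X.chartFrame C p) x₀ x u =
      (a (X.pushDeriv p x) (e u) + ⟪e (A x), e u⟫ • ν x₀) + e (G x u) := fun x u => by
    rw [hDe, hQB, hA, hAB]
  have hgq : ∀ u v : EuclideanSpace ℝ (Fin 7), S.g (X.incl p) u v = ⟪C y₀ u, C y₀ v⟫ := fun u v =>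
    (inChart_self (X.incl p) (fun q (v : Fin 2 → EuclideanSpace ℝ (Fin 7)) => S.g q (v 0) (v 1))
      ![u, v]).symm.trans (fr.ambient.self_of_nhds.1 ![u, v])
  have hderx : ∀ x u v w, ⟪octonionCross (a (X.pushDeriv p x) u) v, w⟫
      + ⟪octonionCross u (a (X.pushDeriv p x) v), w⟫ + ⟪octonionCross u v, a (X.pushDeriv p x) w⟫ =
      crossStar octonionCross ((k / 4) • e x) u v w := fun x u v w => by
    rw [hder, hpush]
  refine ⟨e, ν x₀, J, A, h, hJ, fun x y => ?_, fun v => ?_, fun v => ?_, fun x y => ?_,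
    fun x y => ?_, fun x v => ?_, fun x v => ?_, fun x v => ?_⟩
  · exact (inChart_self p (fun q (v : Fin 2 → EuclideanSpace ℝ (Fin 6)) => X.g q (v 0) (v 1))
      ![x, y]).symm.trans (fr.metric.self_of_nhds ![x, y])
  · exact (inChart_self p (fun q (v : Fin 3 → EuclideanSpace ℝ (Fin 6)) => X.pullPhi q v)
      v).symm.trans (fr.pullPhi.self_of_nhds v)
  · exact (inChart_self p (fun q (v : Fin 3 → EuclideanSpace ℝ (Fin 6)) => X.pullNStar q v)
      v).symm.trans (fr.pullNStar.self_of_nhds v)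
  · have h1 : X.ambientDeriv p x y = H x y + G₇ (X.pushDeriv p x) (X.pushDeriv p y) :=
      congrArg₂ (· + ·) (hH x y) (hG₇ _ _)
    have h2 : S.g (X.incl p) (X.ambientDeriv p x y) (X.normal p) = B x y := by
      rw [h1, hB, ← hn0]
      exact hgq _ _
    have h3 : X.B p x y = ⟪C y₀ (B x y • X.normalVec p), C y₀ (X.normalVec p)⟫ := by
      rw [← hgq, ← h2]
      rfl
    rw [h3, map_smul, hn0, real_inner_smul_left, h.unit, mul_one]
    exact (hAB x y).symm
  · exact (hAB x y).trans ((hBs x y).trans ((hAB y x).symm.trans (real_inner_comm _ _)))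
  · refine (covDeriv_normal_cross (P := octonionCross) hx₀.symm hG hed hD hnd fr.kahler x v).trans
      ?_
    exact h.derivation_kahler (hderx x) (hn x) _ _ (v 0) (v 1)
  · refine (covDeriv_cross (P := octonionCross) hx₀.symm hG hed hD fr.pullPhi x v).trans ?_
    exact IsComplexHyperplane.derivation_phi (hderx x) _ _ _ (v 0) (v 1) (v 2)
  · refine (covDeriv_normal_crossStar (P := octonionCross) hx₀.symm hG hed hD hnd
      fr.pullNStar x v).trans ?_
    exact h.derivation_star (hderx x) (hskew (X.pushDeriv p x)) (hn x) _ _ _ (v 0) (v 1) (v 2)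

end OrientedHypersurface
end StructureEquationsProof

section TypeOfHypersurface

open scoped RealInnerProductSpace Topology

theorem covDeriv_neg {m : ℕ} {M : Type*} [TopologicalSpace M]
    [ChartedSpace (EuclideanSpace ℝ (Fin m)) M]
    (g : ∀ q : M, TangentSpace (𝓡 m) q → TangentSpace (𝓡 m) q → ℝ) {k : ℕ}
    (α : ∀ q : M, (Fin k → TangentSpace (𝓡 m) q) → ℝ) (p : M) (X : TangentSpace (𝓡 m) p)
    (v : Fin k → TangentSpace (𝓡 m) p) :
    covDeriv g (fun q v => - α q v) p X v = - covDeriv g α p X v := by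
  have h1 : coordDeriv p (fun q v => - α q v) X v = - coordDeriv p α X v := by
    have h2 := fderiv_fun_neg (𝕜 := ℝ) (f := fun y => inChart p α y v)
      (x := extChartAt (𝓡 m) p p)
    exact congrArg (fun L => L X) h2
  rw [covDeriv, covDeriv, h1]
  simp only [endAct, Finset.sum_neg_distrib]
  ring

variable {M : Type*} [TopologicalSpace M] [ChartedSpace (EuclideanSpace ℝ (Fin 6)) M]
  {N : Type*} [TopologicalSpace N] [ChartedSpace (EuclideanSpace ℝ (Fin 7)) N]
  [IsManifold (𝓡 7) ∞ N] {S : G2Structure N} {X : OrientedHypersurface M S}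

namespace OrientedHypersurface

theorem psiPlus_zero {θ : M → ℝ} (hθ : ∀ p, θ p = 0) : X.psiPlus θ = X.pullPhi := by
  funext p v
  simp [psiPlus, hθ]

theorem psiMinus_zero {θ : M → ℝ} (hθ : ∀ p, θ p = 0) : X.psiMinus θ = X.pullNStar := by
  funext p v
  simp [psiMinus, hθ]

theorem psiPlus_pi_div_two {θ : M → ℝ} (hθ : ∀ p, θ p = Real.pi / 2) :
    X.psiPlus θ = fun p v => - X.pullNStar p v := by
  funext p v
  simp [psiPlus, hθ]

theorem psiMinus_pi_div_two {θ : M → ℝ} (hθ : ∀ p, θ p = Real.pi / 2) :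
    X.psiMinus θ = X.pullPhi := by
  funext p v
  simp [psiMinus, hθ]

namespace IsStructureFrame

variable {p : M} {κ : ℝ} {e : EuclideanSpace ℝ (Fin 6) →ₗ[ℝ] EuclideanSpace ℝ (Fin 7)}
  {ν : EuclideanSpace ℝ (Fin 7)} {J A : EuclideanSpace ℝ (Fin 6) →ₗ[ℝ] EuclideanSpace ℝ (Fin 6)}
  (fr : X.IsStructureFrame p κ e ν J A) {θ : M → ℝ} {ε : ℝ}
  (hθ : ((∀ p, θ p = 0) ∧ ε = 1) ∨ ((∀ p, θ p = Real.pi / 2) ∧ ε = -1))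
include fr hθ

theorem exists_isIntrinsicTorsion :
    ∃ T : TangentSpace (𝓡 6) p →ₗ[ℝ] TangentSpace (𝓡 6) p →ₗ[ℝ] TangentSpace (𝓡 6) p,
      IsIntrinsicTorsion X.g X.I (X.psiPlus θ) (X.psiMinus θ) p T ∧
      ∀ x y, T x (X.I p y) = - X.I p (T x y) := by
  obtain ⟨T, hT⟩ := fr.complex.exists_torsion (A - κ • J)
  have hb : ∀ x, (A - κ • J) x = A x - κ • J x := fun _ => rfl
  have hg : (fun x y : EuclideanSpace ℝ (Fin 6) => ⟪e x, e y⟫) = X.g p :=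
    funext fun x => funext fun y => (fr.g_eq x y).symm
  have hI : (J : EuclideanSpace ℝ (Fin 6) → EuclideanSpace ℝ (Fin 6)) = X.I p :=
    funext fun x => (fr.I_eq x).symm
  have hω : ∀ (x : EuclideanSpace ℝ (Fin 6)) (v : Fin 2 → EuclideanSpace ℝ (Fin 6)),
      covDeriv X.g (fun q => kahler (X.g q) (X.I q)) p x v
        + endAct (T x) (kahler (X.g p) (X.I p)) v = 0 := fun x v => by
    have h1 := fr.complex.phiTensor_add_endAct_kahler hT x v
    rw [hg, hI] at h1
    rw [fr.covDeriv_kahler]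
    exact h1
  have hΦ : ∀ (x : EuclideanSpace ℝ (Fin 6)) (v : Fin 3 → EuclideanSpace ℝ (Fin 6)),
      covDeriv X.g X.pullPhi p x v + endAct (T x) (X.pullPhi p) v = 0 := fun x v => by
    have h1 := fr.complex.phi_parallel hT hb x (v 0) (v 1) (v 2)
    have h2 := endAct_three (T x) (X.pullPhi p)
      (f := fun a b c => ⟪octonionCross (e a) (e b), e c⟫) fr.pullPhi_eq v
    refine (congrArg₂ (· + ·) (fr.covDeriv_pullPhi x v) h2).trans ?_
    linarith
  have hΨ : ∀ (x : EuclideanSpace ℝ (Fin 6)) (v : Fin 3 → EuclideanSpace ℝ (Fin 6)),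
      covDeriv X.g X.pullNStar p x v + endAct (T x) (X.pullNStar p) v = 0 := fun x v => by
    have h1 := fr.complex.star_parallel hT hb x (v 0) (v 1) (v 2)
    have h2 := endAct_three (T x) (X.pullNStar p)
      (f := fun a b c => crossStar octonionCross ν (e a) (e b) (e c)) fr.pullNStar_eq v
    refine (congrArg₂ (· + ·) (fr.covDeriv_pullNStar x v) h2).trans ?_
    linarith
  have hΨ' : ∀ (x : EuclideanSpace ℝ (Fin 6)) (v : Fin 3 → EuclideanSpace ℝ (Fin 6)),
      covDeriv X.g (fun q v => - X.pullNStar q v) p x v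
        + endAct (T x) (fun v => - X.pullNStar p v) v = 0 := fun x v => by
    have h1 : endAct (T x) (fun v => - X.pullNStar p v) v = - endAct (T x) (X.pullNStar p) v := by
      simp only [endAct, Finset.sum_neg_distrib]
    refine (congrArg₂ (· + ·) (covDeriv_neg X.g X.pullNStar p x v) h1).trans ?_
    linarith [hΨ x v]
  refine ⟨T, ⟨fun x y z => ?_, fun B hB x => ?_, hω, ?_, ?_⟩, fun x y => ?_⟩
  · exact (fr.g_eq _ _).trans ((fr.complex.torsion_skew hT x y z).trans
      (congrArg Neg.neg (fr.g_eq _ _).symm))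
  · have hB' : IsInSu3 (fun x y : EuclideanSpace ℝ (Fin 6) => ⟪e x, e y⟫) J
        (X.psiPlus θ p) (X.psiMinus θ p) B := by
      rw [hg, hI]
      exact hB
    exact fr.complex.trace_comp_torsion_eq_zero hT hB' x
  · rcases hθ with ⟨h0, -⟩ | ⟨h0, -⟩
    · rw [psiPlus_zero h0]; exact hΦ
    · rw [psiPlus_pi_div_two h0]; exact hΨ'
  · rcases hθ with ⟨h0, -⟩ | ⟨h0, -⟩
    · rw [psiMinus_zero h0]; exact hΨ
    · rw [psiMinus_pi_div_two h0]; exact hΦ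
  · have h1 := fr.complex.torsion_I hT x y
    rw [hI] at h1
    exact h1

theorem exists_type_iff (C : Submodule ℝ (TangentSpace (𝓡 6) p →ₗ[ℝ]
      TangentSpace (𝓡 6) p →ₗ[ℝ] TangentSpace (𝓡 6) p →ₗ[ℝ] ℝ)) :
    (∃ T : TangentSpace (𝓡 6) p →ₗ[ℝ] TangentSpace (𝓡 6) p →ₗ[ℝ] TangentSpace (𝓡 6) p,
      IsIntrinsicTorsion X.g X.I (X.psiPlus θ) (X.psiMinus θ) p T ∧
      (∀ x y, T x (X.I p y) = - X.I p (T x y)) ∧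
      ∃ a ∈ C, ∀ x y z, a x y z = covDeriv X.g (fun q => kahler (X.g q) (X.I q)) p x ![y, z]) ↔
    (phiTensor octonionCross e (A - κ • J) : TangentSpace (𝓡 6) p →ₗ[ℝ]
      TangentSpace (𝓡 6) p →ₗ[ℝ] TangentSpace (𝓡 6) p →ₗ[ℝ] ℝ) ∈ C := by
  have h0 : ∀ x y z : EuclideanSpace ℝ (Fin 6), phiTensor octonionCross e (A - κ • J) x y z =
      covDeriv X.g (fun q => kahler (X.g q) (X.I q)) p x ![y, z] := fun x y z =>
    (fr.covDeriv_kahler x ![y, z]).symm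
  constructor
  · rintro ⟨T, -, -, a, ha, h1⟩
    have h2 : a = phiTensor octonionCross e (A - κ • J) :=
      LinearMap.ext fun x => LinearMap.ext fun y => LinearMap.ext fun z =>
        (h1 x y z).trans (h0 x y z).symm
    exact h2 ▸ ha
  · intro h1
    obtain ⟨T, hT, hT'⟩ := fr.exists_isIntrinsicTorsion hθ
    exact ⟨T, hT, hT', _, h1, h0⟩

end IsStructureFrame
end OrientedHypersurface
end TypeOfHypersurface

section SecondFundamentalForm

open scoped RealInnerProductSpace Topology

variable {M : Type*} [TopologicalSpace M] [ChartedSpace (EuclideanSpace ℝ (Fin 6)) M]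
  {N : Type*} [TopologicalSpace N] [ChartedSpace (EuclideanSpace ℝ (Fin 7)) N]
  [IsManifold (𝓡 7) ∞ N] {S : G2Structure N} (X : OrientedHypersurface M S)

namespace OrientedHypersurface

theorem g_smul_normal (p : M) (r : ℝ) :
    S.g (X.incl p) (r • X.normal p) (X.normal p) = r := by
  have h1 := X.normal_unit p
  simp only [G2Structure.g] at h1 ⊢
  simp [h1]

theorem II_eq (p : M) (x y : TangentSpace (𝓡 6) p) : X.II p x y = X.B p x y • X.normal p := by
  rw [B, II, g_smul_normal]

theorem h_eq_sum (p : M) : X.h p =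
    1 / 6 * ∑ i, X.B p (orthoBasis 6 (X.g p) i) (orthoBasis 6 (X.g p) i) := by
  simp only [h, H, B, G2Structure.g]
  simp

theorem H_eq (p : M) : X.H p = X.h p • X.normal p := by
  rw [h_eq_sum, H]
  simp only [II_eq, ← Finset.sum_smul, smul_smul]

theorem smul_normal_inj (p : M) {r s : ℝ} (h : r • X.normal p = s • X.normal p) : r = s := by
  rw [← X.g_smul_normal p r, h, X.g_smul_normal]

theorem isMinimal_iff : X.IsMinimal ↔ ∀ p, X.h p = 0 := by
  refine forall_congr' fun p => ?_
  rw [H_eq]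
  exact ⟨fun h => X.smul_normal_inj p (by rw [h, zero_smul]), fun h => by rw [h, zero_smul]⟩

theorem isTotallyGeodesic_iff : X.IsTotallyGeodesic ↔ ∀ p x y, X.B p x y = 0 := by
  refine forall_congr' fun p => forall_congr' fun x => forall_congr' fun y => ?_
  rw [II_eq]
  exact ⟨fun h => X.smul_normal_inj p (by rw [h, zero_smul]), fun h => by rw [h, zero_smul]⟩

theorem isTotallyUmbilic_iff :
    X.IsTotallyUmbilic ↔ ∀ p x y, X.B p x y = X.h p * X.g p x y := by
  refine forall_congr' fun p => forall_congr' fun x => forall_congr' fun y => ?_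
  rw [II_eq, H_eq, smul_smul, mul_comm (X.h p)]
  exact ⟨fun h => X.smul_normal_inj p h, fun h => by rw [h]⟩

include X in
theorem isTypeP_iff [Nonempty M] {k : ℝ} (hk : ∀ p x y, S.r p x y = k / 4 * S.g p x y) :
    S.IsTypeP ↔ k = 0 := by
  constructor
  · intro h
    obtain ⟨p⟩ := ‹Nonempty M›
    have h1 := h (X.incl p) (X.normal p) (X.normal p)
    rw [hk, X.normal_unit] at h1
    linarith
  · intro h p x y
    rw [hk, h]
    simp

end OrientedHypersurface
end SecondFundamentalForm

section Classification

open scoped RealInnerProductSpace Topology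

variable {M : Type*} [TopologicalSpace M] [ChartedSpace (EuclideanSpace ℝ (Fin 6)) M]
  {N : Type*} [TopologicalSpace N] [ChartedSpace (EuclideanSpace ℝ (Fin 7)) N]
  [IsManifold (𝓡 7) ∞ N] {S : G2Structure N} {X : OrientedHypersurface M S}

namespace OrientedHypersurface
namespace IsStructureFrame

variable {p : M} {κ : ℝ} {e : EuclideanSpace ℝ (Fin 6) →ₗ[ℝ] EuclideanSpace ℝ (Fin 7)}
  {ν : EuclideanSpace ℝ (Fin 7)} {J A : EuclideanSpace ℝ (Fin 6) →ₗ[ℝ] EuclideanSpace ℝ (Fin 6)}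
  (fr : X.IsStructureFrame p κ e ν J A)
include fr

theorem g_eq_fun : X.g p = fun x y : EuclideanSpace ℝ (Fin 6) => ⟪e x, e y⟫ :=
  funext fun x => funext fun y => fr.g_eq x y

theorem IB_eq (x y : EuclideanSpace ℝ (Fin 6)) : X.IB p x y = ⟪e (A (J x)), e (J y)⟫ :=
  (congrArg₂ (X.B p) (fr.I_eq x) (fr.I_eq y)).trans (fr.B_eq _ _)

theorem isOrthonormalTuple : IsOrthonormalTuple (fun x y => ⟪e x, e y⟫)
    (orthoBasis 6 (fun x y => ⟪e x, e y⟫)) :=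
  isOrthonormalTuple_orthoBasis fr.complex.injective (by simp)

theorem h_eq : X.h p = 1 / 6 * ∑ i, ⟪e (A (orthoBasis 6 (fun x y => ⟪e x, e y⟫) i)),
    e (orthoBasis 6 (fun x y => ⟪e x, e y⟫) i)⟫ := by
  rw [X.h_eq_sum, fr.g_eq_fun]
  exact congrArg _ (Finset.sum_congr rfl fun i _ => fr.B_eq _ _)

theorem umbilic_iff : (∀ x y, X.B p x y = X.h p * X.g p x y) ↔
    (∀ x y, X.B p x y + X.IB p x y = 2 * X.h p * X.g p x y) ∧ ∀ x y, X.IB p x y = X.B p x y := by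
  have hgI : ∀ x y, X.g p (X.I p x) (X.I p y) = X.g p x y := fun x y =>
    (congrArg₂ (X.g p) (fr.I_eq x) (fr.I_eq y)).trans ((fr.g_eq _ _).trans
      ((fr.complex.inner_I_I x y).trans (fr.g_eq x y).symm))
  constructor
  · intro h
    have h1 : ∀ x y, X.IB p x y = X.B p x y := fun x y => by
      rw [IB, h, hgI, h]
    exact ⟨fun x y => by rw [h1, h]; ring, h1⟩
  · rintro ⟨h1, h2⟩ x y
    linarith [h1 x y, h2 x y]

theorem antiinvariant_iff : (∀ x y, X.IB p x y = - X.B p x y) ↔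
    X.h p = 0 ∧ ∀ x y, X.B p x y + X.IB p x y = 2 * X.h p * X.g p x y := by
  constructor
  · intro h
    have h1 := fr.complex.sum_inner_I_I (by simp) fr.isOrthonormalTuple A
    have h2 : ∀ x : EuclideanSpace ℝ (Fin 6), ⟪e (A (J x)), e (J x)⟫ = - ⟪e (A x), e x⟫ :=
      fun x => (fr.IB_eq x x).symm.trans ((h x x).trans (congrArg Neg.neg (fr.B_eq x x)))
    simp only [h2, Finset.sum_neg_distrib] at h1
    have h3 : X.h p = 0 := by
      rw [fr.h_eq]
      linarith
    exact ⟨h3, fun x y => by rw [h, h3]; ring⟩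
  · rintro ⟨h1, h2⟩ x y
    have h3 := h2 x y
    rw [h1] at h3
    linarith

theorem geodesic_iff : (∀ x y, X.B p x y = 0) ↔ X.h p = 0 ∧
    (∀ x y, X.B p x y + X.IB p x y = 2 * X.h p * X.g p x y) ∧ ∀ x y, X.IB p x y = X.B p x y := by
  rw [← fr.umbilic_iff]
  constructor
  · intro h
    have h1 : X.h p = 0 := by
      rw [X.h_eq_sum]
      simp [h]
    exact ⟨h1, fun x y => by rw [h, h1, zero_mul]⟩
  · rintro ⟨h1, h2⟩ x y
    rw [h2, h1, zero_mul]

open scoped Classical in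
theorem phiTensor_mem_iff {θ : M → ℝ} {ε : ℝ}
    (hθ : ((∀ p, θ p = 0) ∧ ε = 1) ∨ ((∀ p, θ p = Real.pi / 2) ∧ ε = -1)) (p₁ p₂ p₃ p₄ : Prop) :
    (phiTensor octonionCross e (A - κ • J) : TangentSpace (𝓡 6) p →ₗ[ℝ]
      TangentSpace (𝓡 6) p →ₗ[ℝ] TangentSpace (𝓡 6) p →ₗ[ℝ] ℝ) ∈
      (if p₁ then X.W1 θ ε p else ⊥) ⊔ (if p₂ then X.W1 θ (-ε) p else ⊥) ⊔
      (if p₃ then X.W2 θ ε p else ⊥) ⊔ (if p₄ then X.W3 p else ⊥) ↔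
    (p₁ ∨ X.h p = 0) ∧ (p₂ ∨ κ = 0) ∧
      (p₃ ∨ ∀ x y, X.B p x y + X.IB p x y = 2 * X.h p * X.g p x y) ∧
      (p₄ ∨ ∀ x y, X.IB p x y = X.B p x y) := by
  have hψ : ∃ J' : EuclideanSpace ℝ (Fin 6) →ₗ[ℝ] EuclideanSpace ℝ (Fin 6),
      ((J' = LinearMap.id ∧ ε = 1) ∨ (J' = J ∧ ε = -1)) ∧
      ∀ v : Fin 3 → EuclideanSpace ℝ (Fin 6),
        X.psiPlus θ p v = ⟪octonionCross (e (J' (v 0))) (e (v 1)), e (v 2)⟫ := by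
    rcases hθ with ⟨h0, h1⟩ | ⟨h0, h1⟩
    · exact ⟨LinearMap.id, Or.inl ⟨rfl, h1⟩, fun v => by
        rw [psiPlus_zero h0]
        exact fr.pullPhi_eq v⟩
    · refine ⟨J, Or.inr ⟨rfl, h1⟩, fun v => ?_⟩
      rw [psiPlus_pi_div_two h0]
      refine (congrArg Neg.neg (fr.pullNStar_eq v)).trans ?_
      rw [fr.complex.star_normal, neg_neg]
  obtain ⟨J', hJ', hψ⟩ := hψ
  have hI : X.I p = J := funext fun x => fr.I_eq x
  have key := fr.complex.phiTensor_mem_sup_iff (by simp) hψ hJ' fr.symm κ fr.isOrthonormalTuple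
    fr.h_eq p₁ p₂ p₃ p₄
  have h3 : (∀ x y : EuclideanSpace ℝ (Fin 6), ⟪e (A x), e y⟫ + ⟪e (A (J x)), e (J y)⟫ =
      2 * X.h p * ⟪e x, e y⟫) ↔
      ∀ x y, X.B p x y + X.IB p x y = 2 * X.h p * X.g p x y :=
    forall_congr' fun x => forall_congr' fun y => by
      rw [← fr.B_eq, ← fr.IB_eq, ← fr.g_eq]
  have h4 : (∀ x y : EuclideanSpace ℝ (Fin 6), ⟪e (A (J x)), e (J y)⟫ = ⟪e (A x), e y⟫) ↔
      ∀ x y, X.IB p x y = X.B p x y :=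
    forall_congr' fun x => forall_congr' fun y => by
      rw [← fr.IB_eq, ← fr.B_eq]
  rw [h3, h4, ← fr.g_eq_fun, ← hI] at key
  exact key

end IsStructureFrame

section

variable [IsManifold (𝓡 6) ∞ M] {k : ℝ} (hk : ∀ p x y, S.r p x y = k / 4 * S.g p x y)
include hk

theorem isTotallyUmbilic_iff_and : X.IsTotallyUmbilic ↔
    (∀ p x y, X.B p x y + X.IB p x y = 2 * X.h p * X.g p x y) ∧
      ∀ p x y, X.IB p x y = X.B p x y := by
  rw [X.isTotallyUmbilic_iff, ← forall_and]
  refine forall_congr' fun p => ?_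
  obtain ⟨e, ν, J, A, fr⟩ := X.exists_isStructureFrame hk p
  exact fr.umbilic_iff

theorem IB_eq_neg_iff : (∀ p x y, X.IB p x y = - X.B p x y) ↔
    (∀ p, X.h p = 0) ∧ ∀ p x y, X.B p x y + X.IB p x y = 2 * X.h p * X.g p x y := by
  rw [← forall_and]
  refine forall_congr' fun p => ?_
  obtain ⟨e, ν, J, A, fr⟩ := X.exists_isStructureFrame hk p
  exact fr.antiinvariant_iff

theorem isTotallyGeodesic_iff_and : X.IsTotallyGeodesic ↔ (∀ p, X.h p = 0) ∧
    (∀ p x y, X.B p x y + X.IB p x y = 2 * X.h p * X.g p x y) ∧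
      ∀ p x y, X.IB p x y = X.B p x y := by
  rw [X.isTotallyGeodesic_iff, ← forall_and, ← forall_and]
  refine forall_congr' fun p => ?_
  obtain ⟨e, ν, J, A, fr⟩ := X.exists_isStructureFrame hk p
  exact fr.geodesic_iff

open scoped Classical in
theorem hasType_iff [Nonempty M] {θ : M → ℝ} {ε : ℝ}
    (hθ : ((∀ p, θ p = 0) ∧ ε = 1) ∨ ((∀ p, θ p = Real.pi / 2) ∧ ε = -1)) (p₁ p₂ p₃ p₄ : Prop) :
    X.HasType θ (fun p => (if p₁ then X.W1 θ ε p else ⊥) ⊔ (if p₂ then X.W1 θ (-ε) p else ⊥) ⊔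
      (if p₃ then X.W2 θ ε p else ⊥) ⊔ (if p₄ then X.W3 p else ⊥)) ↔
    (p₁ ∨ ∀ p, X.h p = 0) ∧ (p₂ ∨ k = 0) ∧
      (p₃ ∨ ∀ p x y, X.B p x y + X.IB p x y = 2 * X.h p * X.g p x y) ∧
      (p₄ ∨ ∀ p x y, X.IB p x y = X.B p x y) := by
  rw [← forall_or_left, ← forall_or_left, ← forall_or_left,
    ← forall_const (α := M) (b := p₂ ∨ k = 0), ← forall_and, ← forall_and, ← forall_and]
  refine forall_congr' fun p => ?_
  obtain ⟨e, ν, J, A, fr⟩ := X.exists_isStructureFrame hk p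
  refine (fr.exists_type_iff hθ _).trans ((fr.phiTensor_mem_iff hθ p₁ p₂ p₃ p₄).trans ?_)
  simp

end

end OrientedHypersurface
end Classification

end

theorem theorem4p4
    {N : Type*} [TopologicalSpace N] [ChartedSpace (EuclideanSpace ℝ (Fin 7)) N]
    [IsManifold (𝓡 7) ∞ N]
    {M : Type*} [TopologicalSpace M] [ChartedSpace (EuclideanSpace ℝ (Fin 6)) M]
    [IsManifold (𝓡 6) ∞ M] [Nonempty M]
    (S : G2Structure N) (k : ℝ) (hX1 : S.IsTypeX1)
    (hk : ∀ p v, extDer S.phi p v = k * S.star p v)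
    (X : OrientedHypersurface M S)
    (θ : M → ℝ) (ε : ℝ)
    -- either `θ = 0` and the upper signs, or `θ = π / 2` and the signs in parentheses
    (hθ : ((∀ p, θ p = 0) ∧ ε = 1) ∨ ((∀ p, θ p = Real.pi / 2) ∧ ε = -1)) :
    X.HasType θ (fun p => X.W1 θ ε p ⊔ X.W1 θ (-ε) p ⊔ X.W2 θ ε p ⊔ X.W3 p) ∧
    (X.HasType θ (fun p => X.W1 θ ε p ⊔ X.W1 θ (-ε) p ⊔ X.W2 θ ε p) ↔
      ∀ p x y, X.IB p x y = X.B p x y) ∧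
    (X.HasType θ (fun p => X.W1 θ ε p ⊔ X.W1 θ (-ε) p ⊔ X.W3 p) ↔
      ∀ p x y, X.B p x y + X.IB p x y = 2 * X.h p * X.g p x y) ∧
    (X.HasType θ (fun p => X.W1 θ ε p ⊔ X.W2 θ ε p ⊔ X.W3 p) ↔ S.IsTypeP) ∧
    (X.HasType θ (fun p => X.W1 θ (-ε) p ⊔ X.W2 θ ε p ⊔ X.W3 p) ↔ X.IsMinimal) ∧
    (X.HasType θ (fun p => X.W1 θ ε p ⊔ X.W1 θ (-ε) p) ↔ X.IsTotallyUmbilic) ∧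
    (X.HasType θ (fun p => X.W1 θ ε p ⊔ X.W2 θ ε p) ↔
      (∀ p x y, X.IB p x y = X.B p x y) ∧ S.IsTypeP) ∧
    (X.HasType θ (fun p => X.W1 θ (-ε) p ⊔ X.W2 θ ε p) ↔
      (∀ p x y, X.IB p x y = X.B p x y) ∧ X.IsMinimal) ∧
    (X.HasType θ (fun p => X.W1 θ ε p ⊔ X.W3 p) ↔
      (∀ p x y, X.B p x y + X.IB p x y = 2 * X.h p * X.g p x y) ∧ S.IsTypeP) ∧
    (X.HasType θ (fun p => X.W1 θ (-ε) p ⊔ X.W3 p) ↔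
      ∀ p x y, X.IB p x y = - X.B p x y) ∧
    (X.HasType θ (fun p => X.W2 θ ε p ⊔ X.W3 p) ↔ X.IsMinimal ∧ S.IsTypeP) ∧
    (X.HasType θ (fun p => X.W3 p) ↔
      (∀ p x y, X.IB p x y = - X.B p x y) ∧ S.IsTypeP) ∧
    (X.HasType θ (fun p => X.W2 θ ε p) ↔
      (∀ p x y, X.IB p x y = X.B p x y) ∧ X.IsMinimal ∧ S.IsTypeP) ∧
    (X.HasType θ (fun p => X.W1 θ (-ε) p) ↔ X.IsTotallyGeodesic) ∧
    (X.HasType θ (fun p => X.W1 θ ε p) ↔ X.IsTotallyUmbilic ∧ S.IsTypeP) ∧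
    (X.HasType θ (fun _ => ⊥) ↔ X.IsTotallyGeodesic ∧ S.IsTypeP) := by
  classical
  obtain ⟨k', hk'⟩ := hX1
  have key := X.hasType_iff hk' hθ
  have hu := X.isTotallyUmbilic_iff_and hk'
  have hg := X.isTotallyGeodesic_iff_and hk'
  have ha := X.IB_eq_neg_iff hk'
  have hm := X.isMinimal_iff
  have hp := X.isTypeP_iff hk'
  have t1 := key True True True True
  have t2 := key True True True False
  have t3 := key True True False True
  have t4 := key True False True True
  have t5 := key False True True True
  have t6 := key True True False False
  have t7 := key True False True False
  have t8 := key False True True False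
  have t9 := key True False False True
  have t10 := key False True False True
  have t11 := key False False True True
  have t12 := key False False False True
  have t13 := key False False True False
  have t14 := key False True False False
  have t15 := key True False False False
  have t16 := key False False False False
  simp only [if_true, if_false, sup_bot_eq, bot_sup_eq, true_or, false_or, true_and, and_true]
    at t1 t2 t3 t4 t5 t6 t7 t8 t9 t10 t11 t12 t13 t14 t15 t16
  exact ⟨t1.2 trivial, t2, t3, t4.trans hp.symm, t5.trans hm.symm, t6.trans hu.symm,
    (t7.trans and_comm).trans (and_congr_right' hp.symm),
    (t8.trans and_comm).trans (and_congr_right' hm.symm),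
    (t9.trans and_comm).trans (and_congr_right' hp.symm), t10.trans ha.symm,
    t11.trans (and_congr hm.symm hp.symm),
    (t12.trans (and_left_comm.trans and_comm)).trans
      (and_congr ha.symm hp.symm),
    (t13.trans (and_assoc.symm.trans and_comm)).trans
      (and_congr_right' (and_congr hm.symm hp.symm)), t14.trans hg.symm,
    (t15.trans and_comm).trans (and_congr hu.symm hp.symm),
    (t16.trans (and_left_comm.trans and_comm)).trans (and_congr hg.symm hp.symm)⟩
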